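/- Let $B_0>0$ and let $g:\mathbb{R}_+\to\mathbb{R}_+$ be a measurable function with $\|g\|_\infty\le B_0$ and $$\alpha:=\int_0^\infty g(r)\,r\,\mathrm{d}r\le 1 .$$ Put $f(x,y)=-\int_x^\infty g(\sqrt{t^2+y^2})\,\mathrm{d}t$ and let $$H(B)=-\partial_x^2+\big(i\partial_y+B_0x-f(x,y)\big)^2\qquad\text{in } L^2(\mathbb{R}^2),$$ understood as the self-adjoint operator associated with the closure of the quadratic form $\int_{\mathbb{R}^2}\big(|\partial_x u|^2+|i\partial_y u+(B_0x-f)u|^2\big)\,\mathrm{d}x\,\mathrm{d}y$, $u\in C_0^\infty(\mathbb{R}^2)$; this is the magnetic Laplacian with the magnetic field $B(x,y)=B_0-g(\sqrt{x^2+y^2})$. For $r>0$ and $k=0,1,2,\dots$ put $$a_0(r)=\frac{B_0r}{2},\qquad a(r)=\frac{B_0r}{2}-\frac1r\int_0^r g(s)\,s\,\mathrm{d}s,\qquad V_k(r)=\frac{2k}{r}\big(a_0(r)-a(r)\big)+a(r)^2-a_0(r)^2,$$ $$\psi_k(r)=\sqrt{\frac{B_0}{\Gamma(k+1)}}\,\Big(\frac{B_0}{2}\Big)^{k/2}r^k\exp\Big(-\frac{B_0r^2}{4}\Big),\qquad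 \Lambda_k=\int_0^\infty \psi_k(r)^2\,\big(V_k(r)\big)_-\,r\,\mathrm{d}r ,$$ where $x_-=\max(-x,0)$. Then for every $\gamma\ge 0$ $$\mathrm{tr}\,\big(H(B)-B_0\big)_-^\gamma\ \le\ 2^\gamma\sum_{k=0}^\infty\Lambda_k^\gamma$$ whenever the right-hand side is finite. Here the trace is the sum of $(B_0-\lambda)^\gamma$ over the eigenvalues $\lambda<B_0$ of $H(B)$, counted with multiplicity, and is $+\infty$ if $H(B)$ has essential spectrum below $B_0$; for $\gamma=0$ the convention $0^0=0$ is used on the right-hand side. -/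

import Mathlib

open MeasureTheory Set Filter Topology
open scoped ENNReal ContDiff ComplexConjugate

noncomputable section

/-! ### Spectral notions for unbounded operators -/

section Spectral

variable {E : Type*} [NormedAddCommGroup E] [NormedSpace ℂ E]

/-- `z` belongs to the resolvent set of the unbounded operator `T`: the map `T - z` is a bijection
from the domain of `T` onto the whole space, with a bounded inverse `R`. -/
def IsResolventPoint (T : E →ₗ.[ℂ] E) (z : ℂ) : Prop :=
  ∃ R : E →L[ℂ] E, (∀ v : E, (R v, v + z • R v) ∈ T.graph) ∧
    ∀ u : T.domain, R (T u - z • (u : E)) = u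

/-- The real part of the spectrum (that is, the whole spectrum when `T` is self-adjoint). -/
def realSpectrum (T : E →ₗ.[ℂ] E) : Set ℝ :=
  {l | ¬ IsResolventPoint T (l : ℂ)}

/-- The kernel of `T - z`, i.e. the vectors `u` in the domain of `T` with `T u = z u`. -/
def eigenspaceOf (T : E →ₗ.[ℂ] E) (z : ℂ) : Submodule ℂ E :=
  T.graph.comap (LinearMap.prod LinearMap.id (z • LinearMap.id))

open Classical in
/-- The spectral multiplicity of a self-adjoint operator `T` at `l`, i.e. the rank of its spectral
projection on `(l - ε, l + ε)` for all small `ε > 0`: it is infinite at an accumulation point of the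
spectrum, and it is the dimension (possibly infinite) of `ker (T - l)` at every other point; in
particular it vanishes off the spectrum. -/
def spectralMultiplicity (T : E →ₗ.[ℂ] E) (l : ℝ) : ℕ∞ :=
  if AccPt l (𝓟 (realSpectrum T)) then ⊤
  else Cardinal.toENat (Module.rank ℂ (eigenspaceOf T (l : ℂ)))

/-- The power `x₊ ^ γ` of the positive part, with the usual convention that `x₊ ^ 0` is the
indicator function of `x > 0` (it matters for `γ = 0` only). -/
def posPartPow (x γ : ℝ) : ℝ≥0∞ :=
  if 0 < x then ENNReal.ofReal x ^ γ else 0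

/-- The trace `tr (T - e)₋ ^ γ` of a self-adjoint operator `T`. It is the sum of `(e - l) ^ γ` over
the eigenvalues `l < e`, repeated according to multiplicity, if the spectrum of `T` below `e` is
discrete, and it is `∞` if `T` has essential spectrum below `e`. -/
def traceNegPartPow (T : E →ₗ.[ℂ] E) (e γ : ℝ) : ℝ≥0∞ :=
  ∑' l : ℝ, (spectralMultiplicity T l : ℝ≥0∞) * posPartPow (e - l) γ

end Spectral

/-! ### Magnetic Laplacians in the plane -/

/-- The Hilbert space `L²(ℝ²; ℂ)`, for Lebesgue measure. -/
abbrev PlaneL2 : Type := Lp ℂ 2 (volume : Measure (ℝ × ℝ))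

/-- For a vector potential `A = (A₁, A₂)` on the plane: the triples
`(φ, (i∂₁ + A₁) φ, (i∂₂ + A₂) φ)` in `L²` with a test function `φ ∈ C₀^∞(ℝ²)`. -/
def magneticGradientGraph (A : ℝ × ℝ → ℝ × ℝ) : Submodule ℂ (PlaneL2 × PlaneL2 × PlaneL2) where
  carrier := {p | ∃ φ : ℝ × ℝ → ℂ, ContDiff ℝ ∞ φ ∧ HasCompactSupport φ ∧
    p.1 =ᵐ[volume] φ ∧
    p.2.1 =ᵐ[volume] (fun z => Complex.I * fderiv ℝ φ z (1, 0) + ((A z).1 : ℂ) * φ z) ∧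
    p.2.2 =ᵐ[volume] (fun z => Complex.I * fderiv ℝ φ z (0, 1) + ((A z).2 : ℂ) * φ z)}
  zero_mem' := by
    refine ⟨fun _ => 0, contDiff_const, HasCompactSupport.zero, Lp.coeFn_zero _ _ _, ?_, ?_⟩ <;>
    · filter_upwards [Lp.coeFn_zero ℂ 2 (volume : Measure (ℝ × ℝ))] with z hz
      simp
  add_mem' := by
    rintro p q ⟨φ, hφ, hφc, h0, h1, h2⟩ ⟨ψ, hψ, hψc, k0, k1, k2⟩
    have hd : ∀ z, fderiv ℝ (fun w => φ w + ψ w) z = fderiv ℝ φ z + fderiv ℝ ψ z := fun z =>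
      fderiv_fun_add (hφ.differentiable (by simp) z) (hψ.differentiable (by simp) z)
    refine ⟨fun z => φ z + ψ z, hφ.add hψ, hφc.add hψc, ?_, ?_, ?_⟩
    · filter_upwards [Lp.coeFn_add p.1 q.1, h0, k0] with z hz a b
      simp only [Prod.fst_add, hz, Pi.add_apply, a, b]
    · filter_upwards [Lp.coeFn_add p.2.1 q.2.1, h1, k1] with z hz a b
      simp only [Prod.snd_add, Prod.fst_add, hz, Pi.add_apply, a, b, hd, add_apply]
      ring
    · filter_upwards [Lp.coeFn_add p.2.2 q.2.2, h2, k2] with z hz a b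
      simp only [Prod.snd_add, hz, Pi.add_apply, a, b, hd, add_apply]
      ring
  smul_mem' := by
    rintro c p ⟨φ, hφ, hφc, h0, h1, h2⟩
    have hd : ∀ z, fderiv ℝ (fun w => c * φ w) z = c • fderiv ℝ φ z := fun z =>
      fderiv_const_mul (hφ.differentiable (by simp) z) c
    refine ⟨fun z => c * φ z, contDiff_const.mul hφ, hφc.mul_left, ?_, ?_, ?_⟩
    · filter_upwards [Lp.coeFn_smul c p.1, h0] with z hz a
      simp only [Prod.smul_fst, hz, Pi.smul_apply, a, smul_eq_mul]
    · filter_upwards [Lp.coeFn_smul c p.2.1, h1] with z hz a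
      simp only [Prod.smul_snd, Prod.smul_fst, hz, Pi.smul_apply, a, hd, smul_eq_mul,
        smul_apply]
      ring
    · filter_upwards [Lp.coeFn_smul c p.2.2, h2] with z hz a
      simp only [Prod.smul_snd, hz, Pi.smul_apply, a, hd, smul_eq_mul,
        smul_apply]
      ring

/-- The graph of the self-adjoint operator associated with the closure of the quadratic form
`∫ |(i∂₁ + A₁) φ|² + |(i∂₂ + A₂) φ|²`, `φ ∈ C₀^∞(ℝ²)`. A pair `(u, w)` belongs to it if `u` is in
the domain of the closed form (so that `u` has a magnetic gradient `p`, in the closure of the graph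
above) and the sesquilinear form satisfies `q(φ, u) = ⟪φ, w⟫` for all test functions `φ`. -/
def magneticLaplacianGraph (A : ℝ × ℝ → ℝ × ℝ) : Submodule ℂ (PlaneL2 × PlaneL2) where
  carrier := {uw | ∃ p : PlaneL2 × PlaneL2,
    (uw.1, p) ∈ (magneticGradientGraph A).topologicalClosure ∧
    ∀ t ∈ magneticGradientGraph A,
      inner ℂ t.2.1 p.1 + inner ℂ t.2.2 p.2 = inner ℂ t.1 uw.2}
  zero_mem' := ⟨0, Submodule.zero_mem _, by simp⟩
  add_mem' := by
    rintro x y ⟨p, hp, hp'⟩ ⟨q, hq, hq'⟩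
    refine ⟨p + q, Submodule.add_mem _ hp hq, fun t ht => ?_⟩
    simp only [Prod.fst_add, Prod.snd_add, inner_add_right, ← hp' t ht, ← hq' t ht]
    ring
  smul_mem' := by
    rintro c x ⟨p, hp, hp'⟩
    refine ⟨c • p, Submodule.smul_mem _ c hp, fun t ht => ?_⟩
    simp only [Prod.smul_fst, Prod.smul_snd, inner_smul_right, ← hp' t ht]
    ring

/-- The magnetic Laplacian `(i∂₁ + A₁)² + (i∂₂ + A₂)²` in `L²(ℝ²)`. -/
def magneticLaplacian (A : ℝ × ℝ → ℝ × ℝ) : PlaneL2 →ₗ.[ℂ] PlaneL2 :=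
  (magneticLaplacianGraph A).toLinearPMap

/-! ### Radial perturbations of a constant field -/

/-- `f(x, y) = - ∫_x^∞ g(√(t² + y²)) dt`. -/
def gaugeFun (g : ℝ → ℝ) (z : ℝ × ℝ) : ℝ :=
  -∫ t in Ioi z.1, g (Real.sqrt (t ^ 2 + z.2 ^ 2))

/-- The vector potential `A = (0, B₀ x - f(x, y))` of the field `B₀ - g(√(x² + y²))`. -/
def landauPotential (B₀ : ℝ) (g : ℝ → ℝ) (z : ℝ × ℝ) : ℝ × ℝ :=
  (0, B₀ * z.1 - gaugeFun g z)

/-- The operator `H(B) = -∂ₓ² + (i∂_y + B₀ x - f)²` for the field `B = B₀ - g(√(x² + y²))`. -/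
def perturbedHamiltonian (B₀ : ℝ) (g : ℝ → ℝ) : PlaneL2 →ₗ.[ℂ] PlaneL2 :=
  magneticLaplacian (landauPotential B₀ g)

/-- `a₀(r) = B₀ r / 2`. -/
def circularPotential₀ (B₀ r : ℝ) : ℝ := B₀ * r / 2

/-- `a(r) = B₀ r / 2 - (1 / r) ∫_0^r g(s) s ds`. -/
def circularPotential (B₀ : ℝ) (g : ℝ → ℝ) (r : ℝ) : ℝ :=
  B₀ * r / 2 - 1 / r * ∫ s in (0 : ℝ)..r, g s * s

/-- The effective potential `V_k(r) = (2k / r) (a₀(r) - a(r)) + a(r)² - a₀(r)²`. -/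
def effectivePotential (B₀ : ℝ) (g : ℝ → ℝ) (k : ℕ) (r : ℝ) : ℝ :=
  2 * k / r * (circularPotential₀ B₀ r - circularPotential B₀ g r)
    + circularPotential B₀ g r ^ 2 - circularPotential₀ B₀ r ^ 2

/-- The radial lowest Landau level state
`ψ_k(r) = √(B₀ / Γ(k+1)) (B₀ / 2)^(k/2) r^k exp(-B₀ r² / 4)`. -/
def landauState (B₀ : ℝ) (k : ℕ) (r : ℝ) : ℝ :=
  Real.sqrt (B₀ / Real.Gamma (k + 1)) * (B₀ / 2) ^ ((k : ℝ) / 2) * r ^ k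
    * Real.exp (-(B₀ * r ^ 2 / 4))

/-- `Λ_k = (ψ_k, (V_k)₋ ψ_k)` in `L²(ℝ₊, r dr)`, with `(V_k)₋ = max (-V_k) 0`. -/
def effectiveExpectation (B₀ : ℝ) (g : ℝ → ℝ) (k : ℕ) : ℝ :=
  ∫ r in Ioi (0 : ℝ),
    landauState B₀ k r * (max (-effectivePotential B₀ g k r) 0 * landauState B₀ k r) * r

end

/-!
The proof compares the quadratic form of `H(B)` with that of the constant field, one angular
momentum at a time, and then counts eigenvalues by a matching argument.

*Sectors.* The field is radial, so the Landau potential `(0, B₀ x - f)` is gauge equivalent to the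
circular potential `a(r) (-y, x) / r` (`IsFieldProfile.exists_gauge`). Since `g` is only measurable,
closedness of the difference of the potentials is expressed by the divergence theorem on rectangles
(`IsFieldProfile.integral_rectangle`), which passes to `g` from continuous profiles. In polar
coordinates and after a Fourier expansion in the angle, the form of a test function is a sum over
`m ∈ ℤ` of the radial forms `∫ (|w'| ^ 2 + (m / r - a) ^ 2 |w| ^ 2) r dr`.

*Sectors `m = k ≥ 0`.* The radial form is the one of the constant field plus `∫ V_k |w| ^ 2 r dr`.
For the constant field it equals `B₀ ‖w‖ ^ 2` plus the squared norm of an annihilation operator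
applied to `w`, which is at least `2 B₀` times the squared distance of `w` to the line of `ψ_k`
(`IsRadialProfile.exists_gap`). With `P` the projection onto `ψ_k` and `Q = 1 - P` one has
`(V_k)₋ ≤ 2 P (V_k)₋ P + 2 Q (V_k)₋ Q`, and `(V_k)₋ ≤ B₀` because the flux is at most `1`, so the
gap absorbs the second term. What is left is the form bound `B₀ - 2 Λ_k P`
(`IsRadialProfile.sector_bound`).

*Sectors `m = -k < 0`.* Here the form is at least `B₀`: the flux being at most `1`, the centrifugal
term dominates that of the constant field in the sector `k`
(`IsRadialProfile.opposite_sector_bound`).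

*Counting.* Together, `H(B) ≥ B₀ - ∑ 2 Λ_k |Ψ_k⟩⟨Ψ_k|` for the plane Landau states `Ψ_k`. If the
right-hand side is finite, only finitely many weights `2 Λ_k` are at least a given `t > 0`. Hence
`H(B)` has at most `#{k | t ≤ 2 Λ_k}` eigenvalues at or below `B₀ - t`, and by Lax-Milgram and the
Fredholm alternative no other spectrum there (`IsFormOperator.isResolventPoint`). Hall's marriage
theorem then assigns to the eigenvalues `λ < B₀` distinct indices `k` with `B₀ - λ ≤ 2 Λ_k`
(`sum_posPartPow_le_tsum`), and the trace bound follows by summation. If the right-hand side is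
infinite there is nothing to prove.
-/

noncomputable section

/-! ### Operators defined by quadratic forms -/

/-- `T` is the operator of the closed form `x ↦ ‖D x‖ ^ 2`: here `X` is the form domain with the
graph norm, `J : X → E` its (bounded) map into the underlying Hilbert space, and `(J x, w)` is in
the graph of `T` when `⟪D y, D x⟫ = ⟪J y, w⟫` for all `y`. Injectivity of `J` is not required. -/
structure IsFormOperator {E F X : Type*} [NormedAddCommGroup E] [InnerProductSpace ℂ E]
    [NormedAddCommGroup F] [InnerProductSpace ℂ F] [NormedAddCommGroup X] [InnerProductSpace ℂ X]
    (T : E →ₗ.[ℂ] E) (J : X →L[ℂ] E) (D : X →L[ℂ] F) : Prop where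
  norm_sq : ∀ x, ‖x‖ ^ 2 = ‖J x‖ ^ 2 + ‖D x‖ ^ 2
  mem_graph_iff : ∀ u w, (u, w) ∈ T.graph ↔
    ∃ x, J x = u ∧ ∀ y, inner ℂ (D y) (D x) = inner ℂ (J y) w

/-- The form `‖D x‖ ^ 2` is bounded below by `e` up to a form of finite rank, given by the vectors
`Ψ k` and the weights `b k`, `k ∈ S`. -/
def FormBound {E F X : Type*} [NormedAddCommGroup E] [InnerProductSpace ℂ E]
    [NormedAddCommGroup F] [InnerProductSpace ℂ F] [NormedAddCommGroup X] [InnerProductSpace ℂ X]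
    (J : X →L[ℂ] E) (D : X →L[ℂ] F) (Ψ : ℕ → E) (b : ℕ → ℝ) (S : Finset ℕ) (e : ℝ) : Prop :=
  ∀ x, e * ‖J x‖ ^ 2 ≤ ‖D x‖ ^ 2 + ∑ k ∈ S, b k * ‖inner ℂ (Ψ k) (J x)‖ ^ 2

section FormOperator

variable {E F X : Type*} [NormedAddCommGroup E] [InnerProductSpace ℂ E]
  [NormedAddCommGroup F] [InnerProductSpace ℂ F] [NormedAddCommGroup X] [InnerProductSpace ℂ X]
  {T : E →ₗ.[ℂ] E} {J : X →L[ℂ] E} {D : X →L[ℂ] F} {Ψ : ℕ → E} {b : ℕ → ℝ} {S : Finset ℕ} {e : ℝ}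

/-- The Fredholm alternative for finite-rank perturbations of the identity. -/
theorem surjective_sub_of_finiteDimensional_range {V : Type*} [AddCommGroup V] [Module ℂ V]
    (k : V →ₗ[ℂ] V) [FiniteDimensional ℂ (LinearMap.range k)]
    (h : ∀ x, k x = x → x = 0) (y : V) : ∃ x, x - k x = y := by
  let W := LinearMap.range k
  have hW : ∀ x ∈ W, ((LinearMap.id : V →ₗ[ℂ] V) - k) x ∈ W := fun x hx =>
    W.sub_mem hx (LinearMap.mem_range_self k x)
  let m : W →ₗ[ℂ] W := ((LinearMap.id : V →ₗ[ℂ] V) - k).restrict hW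
  have hinj : Function.Injective m := by
    rw [injective_iff_map_eq_zero]
    rintro ⟨x, hx⟩ h0
    have h1 : x - k x = 0 := congrArg Subtype.val h0
    exact Subtype.ext (h x (sub_eq_zero.1 h1).symm)
  obtain ⟨w, hw⟩ := LinearMap.injective_iff_surjective.1 hinj ⟨k y, LinearMap.mem_range_self k y⟩
  have hw' : (w : V) - k w = k y := congrArg Subtype.val hw
  refine ⟨y + w, ?_⟩
  rw [map_add, ← hw']
  abel

theorem IsFormOperator.mem_eigenspaceOf (h : IsFormOperator T J D) {z : ℂ} {u : E} :
    u ∈ eigenspaceOf T z ↔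
      ∃ x, J x = u ∧ ∀ y, inner ℂ (D y) (D x) = z * inner ℂ (J y) (J x) := by
  have : u ∈ eigenspaceOf T z ↔ (u, z • u) ∈ T.graph := Iff.rfl
  rw [this, h.mem_graph_iff]
  refine exists_congr fun x => and_congr_right fun hx => forall_congr' fun y => ?_
  rw [inner_smul_right, hx]

theorem FormBound.exists_inner_ne_zero (hb : FormBound J D Ψ b S e) {x : X}
    (hx : ‖D x‖ ^ 2 < e * ‖J x‖ ^ 2) : ∃ k ∈ S, inner ℂ (Ψ k) (J x) ≠ 0 := by
  by_contra! h0
  have := hb x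
  rw [Finset.sum_eq_zero (fun k hk => by rw [h0 k hk]; simp)] at this
  linarith

/-- Below the threshold `e` of a bound `FormBound`, there are at most `#S` orthonormal
eigenvectors: a longer family would span a vector orthogonal to all `Ψ k`. -/
theorem FormBound.card_le (hb : FormBound J D Ψ b S e) {ι : Type*} [Fintype ι]
    {v : ι → E} (hv : Orthonormal ℂ v) {l : ι → ℝ} (hl : ∀ j, l j < e) {x : ι → X}
    (hx : ∀ j, J (x j) = v j)
    (hD : ∀ j y, inner ℂ (D y) (D (x j)) = (l j : ℂ) * inner ℂ (J y) (J (x j))) :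
    Fintype.card ι ≤ S.card := by
  classical
  by_contra! hcard
  let m : (ι → ℂ) →ₗ[ℂ] (S → ℂ) :=
    LinearMap.pi fun k => ((innerSL ℂ (Ψ k)).toLinearMap ∘ₗ J.toLinearMap) ∘ₗ
      Fintype.linearCombination ℂ x
  have hker : LinearMap.ker m ≠ ⊥ := by
    apply LinearMap.ker_ne_bot_of_finrank_lt
    simpa using hcard
  obtain ⟨c, hc, hc0⟩ := (Submodule.ne_bot_iff _).1 hker
  let y : X := ∑ j, c j • x j
  have hJy : J y = ∑ j, c j • v j := by simp [y, hx]
  have hn : ‖J y‖ ^ 2 = ∑ j, ‖c j‖ ^ 2 := by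
    have := hv.inner_sum c c Finset.univ
    rw [← hJy, inner_self_eq_norm_sq_to_K] at this
    have h2 : ((‖J y‖ ^ 2 : ℝ) : ℂ) = ((∑ j, ‖c j‖ ^ 2 : ℝ) : ℂ) := by
      push_cast
      simpa [Complex.conj_mul'] using this
    exact_mod_cast h2
  have hd : ‖D y‖ ^ 2 = ∑ j, l j * ‖c j‖ ^ 2 := by
    have h1 : inner ℂ (D y) (D y) = ∑ j, (c j) * ((l j : ℂ) * inner ℂ (J y) (v j)) := by
      have : D y = ∑ j, c j • D (x j) := by simp [y]
      conv_lhs => rw [this, inner_sum]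
      rw [← this]
      exact Finset.sum_congr rfl fun j _ => by rw [inner_smul_right, hD, hx]
    have h3 : ∀ j, inner ℂ (J y) (v j) = conj (c j) := fun j => by
      rw [hJy]; exact hv.inner_left_fintype c j
    rw [inner_self_eq_norm_sq_to_K] at h1
    have h2 : ((‖D y‖ ^ 2 : ℝ) : ℂ) = ((∑ j, l j * ‖c j‖ ^ 2 : ℝ) : ℂ) := by
      push_cast
      refine Eq.trans (by simp) (h1.trans (Finset.sum_congr rfl fun j _ => ?_))
      rw [h3, ← Complex.mul_conj']
      ring
    exact_mod_cast h2
  obtain ⟨j, hj⟩ : ∃ j, c j ≠ 0 := Function.ne_iff.1 hc0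
  have hlt : ‖D y‖ ^ 2 < e * ‖J y‖ ^ 2 := by
    rw [hn, hd, Finset.mul_sum]
    refine Finset.sum_lt_sum (fun i _ => mul_le_mul_of_nonneg_right (hl i).le (by positivity))
      ⟨j, Finset.mem_univ _, mul_lt_mul_of_pos_right (hl j) (by positivity)⟩
  obtain ⟨k, hk, hk0⟩ := hb.exists_inner_ne_zero hlt
  refine hk0 ?_
  have := congrFun (LinearMap.mem_ker.1 hc) ⟨k, hk⟩
  simpa [m, Fintype.linearCombination_apply, y, inner_sum, inner_smul_right] using this

theorem norm_sq_eq_of_eigen {z : ℝ} {x : X}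
    (hx : ∀ y, inner ℂ (D y) (D x) = (z : ℂ) * inner ℂ (J y) (J x)) :
    ‖D x‖ ^ 2 = z * ‖J x‖ ^ 2 := by
  have := hx x
  rw [inner_self_eq_norm_sq_to_K, inner_self_eq_norm_sq_to_K] at this
  have h2 : ((‖D x‖ ^ 2 : ℝ) : ℂ) = ((z * ‖J x‖ ^ 2 : ℝ) : ℂ) := by
    push_cast
    exact this
  exact_mod_cast h2

theorem inner_eq_zero_of_eigen {z z' : ℝ} (hz : z ≠ z') {x x' : X}
    (hx : ∀ y, inner ℂ (D y) (D x) = (z : ℂ) * inner ℂ (J y) (J x))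
    (hx' : ∀ y, inner ℂ (D y) (D x') = (z' : ℂ) * inner ℂ (J y) (J x')) :
    inner ℂ (J x) (J x') = 0 := by
  have h1 := hx' x
  have h2 := congrArg conj (hx x')
  rw [map_mul, inner_conj_symm, inner_conj_symm, Complex.conj_ofReal, h1] at h2
  have h3 : ((z' : ℂ) - z) * inner ℂ (J x) (J x') = 0 := by rw [sub_mul, h2, sub_self]
  refine (mul_eq_zero.1 h3).resolve_left ?_
  exact sub_ne_zero.2 (by exact_mod_cast hz.symm)

/-- Below the threshold of a bound `FormBound`, every spectral point is an eigenvalue: adding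
a finite-rank operator makes the form coercive, and the Fredholm alternative does the rest. -/
theorem IsFormOperator.isResolventPoint [CompleteSpace E] [CompleteSpace F] [CompleteSpace X]
    (h : IsFormOperator T J D)
    (hb : FormBound J D Ψ b S e) (hb0 : ∀ k, 0 ≤ b k) {z : ℝ} (hz : z < e)
    (hker : eigenspaceOf T (z : ℂ) = ⊥) : IsResolventPoint T (z : ℂ) := by
  classical
  let L : X →L[ℂ] X := ContinuousLinearMap.adjoint D ∘L D
    - (z : ℂ) • (ContinuousLinearMap.adjoint J ∘L J)
  let K : X →L[ℂ] X := ∑ k ∈ S, (b k : ℂ) •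
    (InnerProductSpace.rankOne ℂ (ContinuousLinearMap.adjoint J (Ψ k))
      (ContinuousLinearMap.adjoint J (Ψ k)))
  have hL : ∀ y x, inner ℂ y (L x) = inner ℂ (D y) (D x) - z * inner ℂ (J y) (J x) := by
    intro y x
    simp [L, ContinuousLinearMap.adjoint_inner_right]
  have hKapp : ∀ x, K x = ∑ k ∈ S, ((b k : ℂ) * inner ℂ (Ψ k) (J x)) •
      ContinuousLinearMap.adjoint J (Ψ k) := by
    intro x
    simp [K, ContinuousLinearMap.adjoint_inner_left, mul_smul]
  have hK : ∀ x, inner ℂ x (K x) = ((∑ k ∈ S, b k * ‖inner ℂ (Ψ k) (J x)‖ ^ 2 : ℝ) : ℂ) := by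
    intro x
    rw [hKapp, inner_sum]
    push_cast
    refine Finset.sum_congr rfl fun k _ => ?_
    rw [inner_smul_right, ContinuousLinearMap.adjoint_inner_right, mul_assoc,
      ← inner_conj_symm (J x) (Ψ k), Complex.mul_conj']
  obtain ⟨c, hc, hcoer⟩ : ∃ c : ℝ, 0 < c ∧ ∀ x, c * ‖x‖ ^ 2 ≤ ‖D x‖ ^ 2 - z * ‖J x‖ ^ 2
      + ∑ k ∈ S, b k * ‖inner ℂ (Ψ k) (J x)‖ ^ 2 := by
    -- a convex combination `(1 - s) * (e - z) * ‖J x‖ ^ 2 + s * (‖D x‖ ^ 2 - |z| * ‖J x‖ ^ 2)`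
    let κ := e - z
    have hκ : 0 < κ := sub_pos.2 hz
    let s := κ / (2 * (κ + |z| + 1))
    have hden : 0 < κ + |z| + 1 := by positivity
    have hs : 0 < s := by positivity
    have hs' : s * (κ + |z| + 1) = κ / 2 := by simp only [s]; field_simp
    have hs1 : s ≤ 1 := by
      rw [div_le_one (by positivity)]; nlinarith [abs_nonneg z]
    refine ⟨min s (κ / 2), by positivity, fun x => ?_⟩
    have h1 := hb x
    have hP : 0 ≤ ∑ k ∈ S, b k * ‖inner ℂ (Ψ k) (J x)‖ ^ 2 :=
      Finset.sum_nonneg fun k _ => mul_nonneg (hb0 k) (by positivity)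
    set P := ∑ k ∈ S, b k * ‖inner ℂ (Ψ k) (J x)‖ ^ 2
    rw [h.norm_sq]
    have hA : 0 ≤ ‖J x‖ ^ 2 := by positivity
    have hB : 0 ≤ ‖D x‖ ^ 2 := by positivity
    set A := ‖J x‖ ^ 2
    set B := ‖D x‖ ^ 2
    have h3 : min s (κ / 2) * (A + B) ≤ κ / 2 * A + s * B := by
      nlinarith [min_le_left s (κ / 2), min_le_right s (κ / 2)]
    have h4 : (1 - s) * (κ * A) ≤ (1 - s) * (B - z * A + P) := by
      apply mul_le_mul_of_nonneg_left _ (by linarith)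
      simp only [κ]; linarith
    have h5 : s * (z * A) ≤ s * (|z| * A) :=
      mul_le_mul_of_nonneg_left (mul_le_mul_of_nonneg_right (le_abs_self z) hA) hs.le
    have h6 : 0 ≤ s * P := by positivity
    nlinarith
  have hunit : IsUnit (L + K) := by
    apply ContinuousLinearMap.isUnit_of_forall_le_norm_inner_map _ (c := ⟨c, hc.le⟩) hc
    intro x
    have hin : inner ℂ x ((L + K) x) = ((‖D x‖ ^ 2 - z * ‖J x‖ ^ 2
        + ∑ k ∈ S, b k * ‖inner ℂ (Ψ k) (J x)‖ ^ 2 : ℝ) : ℂ) := by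
      rw [add_apply, inner_add_right, hL, hK, inner_self_eq_norm_sq_to_K,
        inner_self_eq_norm_sq_to_K]
      push_cast
      rfl
    rw [← inner_conj_symm, RCLike.norm_conj, hin, Complex.norm_real]
    calc ‖x‖ ^ 2 * c = c * ‖x‖ ^ 2 := mul_comm _ _
      _ ≤ _ := hcoer x
      _ ≤ _ := le_abs_self _
  obtain ⟨U, hU⟩ := hunit
  have hUl : ∀ x, (↑U⁻¹ : X →L[ℂ] X) ((L + K) x) = x := fun x => by
    rw [← hU, ← mul_apply_eq_comp, Units.inv_mul, one_apply_eq_self]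
  have hUr : ∀ x, (L + K) ((↑U⁻¹ : X →L[ℂ] X) x) = x := fun x => by
    rw [← hU, ← mul_apply_eq_comp, Units.mul_inv, one_apply_eq_self]
  have hLinj : ∀ x, L x = 0 → x = 0 := by
    intro x hx
    have hx' : ∀ y, inner ℂ (D y) (D x) = (z : ℂ) * inner ℂ (J y) (J x) := fun y => by
      rw [← sub_eq_zero, ← hL, hx, inner_zero_right]
    have h1 : J x ∈ eigenspaceOf T (z : ℂ) := h.mem_eigenspaceOf.2 ⟨x, rfl, hx'⟩
    rw [hker, Submodule.mem_bot] at h1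
    have h2 := norm_sq_eq_of_eigen hx'
    have h3 := h.norm_sq x
    rw [h2, h1] at h3
    simpa using h3
  let k : X →ₗ[ℂ] X := ((↑U⁻¹ : X →L[ℂ] X) ∘L K).toLinearMap
  have hkfin : FiniteDimensional ℂ (LinearMap.range k) := by
    let W : Submodule ℂ X := Submodule.span ℂ
      ((fun k => (↑U⁻¹ : X →L[ℂ] X) (ContinuousLinearMap.adjoint J (Ψ k))) '' (S : Set ℕ))
    have : FiniteDimensional ℂ W :=
      FiniteDimensional.span_of_finite ℂ (S.finite_toSet.image _)
    refine Submodule.finiteDimensional_of_le (S₂ := W) ?_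
    rintro _ ⟨x, rfl⟩
    have : k x = (↑U⁻¹ : X →L[ℂ] X) (K x) := rfl
    rw [this, hKapp, map_sum]
    refine Submodule.sum_mem _ fun i hi => ?_
    rw [map_smul]
    exact Submodule.smul_mem _ _ (Submodule.subset_span ⟨i, hi, rfl⟩)
  have hkL : ∀ x, L x = (L + K) (x - k x) := by
    intro x
    have : k x = (↑U⁻¹ : X →L[ℂ] X) (K x) := rfl
    rw [map_sub, this, hUr, add_apply]
    abel
  have hLsurj : Function.Surjective L := by
    intro y
    obtain ⟨x, hx⟩ := surjective_sub_of_finiteDimensional_range k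
      (fun x hx => hLinj x (by rw [hkL, hx, sub_self, map_zero])) ((↑U⁻¹ : X →L[ℂ] X) y)
    exact ⟨x, by rw [hkL, hx, hUr]⟩
  let Le : X ≃L[ℂ] X := ContinuousLinearEquiv.ofBijective L
    (LinearMap.ker_eq_bot'.2 hLinj) (LinearMap.range_eq_top.2 hLsurj)
  have hLe : ∀ x, L (Le.symm x) = x := fun x => Le.apply_symm_apply x
  refine ⟨J ∘L (Le.symm : X →L[ℂ] X) ∘L ContinuousLinearMap.adjoint J, fun v => ?_, fun u => ?_⟩
  · rw [h.mem_graph_iff]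
    refine ⟨Le.symm (ContinuousLinearMap.adjoint J v), rfl, fun y => ?_⟩
    have := hL y (Le.symm (ContinuousLinearMap.adjoint J v))
    rw [hLe, ContinuousLinearMap.adjoint_inner_right] at this
    rw [inner_add_right, inner_smul_right, this]
    simp
  · obtain ⟨x, hx, hx'⟩ := (h.mem_graph_iff _ _).1 (T.mem_graph u)
    have : ContinuousLinearMap.adjoint J (T u - (z : ℂ) • (u : E)) = L x := by
      refine ext_inner_left ℂ fun y => ?_
      rw [hL, ContinuousLinearMap.adjoint_inner_right, hx', inner_sub_right, inner_smul_right, hx]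
    have h2 : Le.symm (L x) = x := Le.symm_apply_apply x
    simp only [ContinuousLinearMap.comp_apply, this]
    exact (congrArg J h2).trans hx

end FormOperator

/-! ### Counting eigenvalues below a form bound -/

section TraceBound

variable {E F X : Type*} [NormedAddCommGroup E] [InnerProductSpace ℂ E]
  [NormedAddCommGroup F] [InnerProductSpace ℂ F] [NormedAddCommGroup X] [InnerProductSpace ℂ X]
  {T : E →ₗ.[ℂ] E} {J : X →L[ℂ] E} {D : X →L[ℂ] F} {Ψ : ℕ → E} {b : ℕ → ℝ} {S : Finset ℕ} {e : ℝ}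

theorem posPartPow_of_pos {x : ℝ} (hx : 0 < x) (γ : ℝ) :
    posPartPow x γ = ENNReal.ofReal x ^ γ := if_pos hx

theorem posPartPow_of_nonpos {x : ℝ} (hx : x ≤ 0) (γ : ℝ) : posPartPow x γ = 0 :=
  if_neg hx.not_gt

theorem posPartPow_mono {γ : ℝ} (hγ : 0 ≤ γ) {x y : ℝ} (h : x ≤ y) :
    posPartPow x γ ≤ posPartPow y γ := by
  rcases le_or_gt x 0 with hx | hx
  · rw [posPartPow_of_nonpos hx]; exact zero_le
  · rw [posPartPow_of_pos hx, posPartPow_of_pos (hx.trans_le h)]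
    exact ENNReal.rpow_le_rpow (ENNReal.ofReal_le_ofReal h) hγ

theorem posPartPow_two_mul {γ : ℝ} (hγ : 0 ≤ γ) (x : ℝ) :
    posPartPow (2 * x) γ = 2 ^ γ * posPartPow x γ := by
  rcases le_or_gt x 0 with hx | hx
  · rw [posPartPow_of_nonpos hx, posPartPow_of_nonpos (by linarith), mul_zero]
  · rw [posPartPow_of_pos hx, posPartPow_of_pos (by linarith),
      ENNReal.ofReal_mul (by norm_num), ENNReal.mul_rpow_of_nonneg _ _ hγ]
    norm_num

theorem finite_setOf_le_of_tsum_posPartPow_ne_top {γ : ℝ}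
    (h : ∑' k, posPartPow (b k) γ ≠ ⊤) (hγ : 0 ≤ γ) {t : ℝ} (ht : 0 < t) :
    {k | t ≤ b k}.Finite := by
  have hpos : posPartPow t γ ≠ 0 := by
    rw [posPartPow_of_pos ht]
    exact (ENNReal.rpow_pos (ENNReal.ofReal_pos.2 ht) ENNReal.ofReal_ne_top).ne'
  exact (ENNReal.finite_const_le_of_tsum_ne_top h hpos).subset fun k hk => posPartPow_mono hγ hk

/-- The set of indices with `b k ≥ t`, as a finset; it is empty by convention when the set is
infinite. -/
def levelSet (b : ℕ → ℝ) (t : ℝ) : Finset ℕ := by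
  classical
  exact if h : {k | t ≤ b k}.Finite then h.toFinset else ∅

theorem mem_levelSet {t : ℝ} (h : {k | t ≤ b k}.Finite) {k : ℕ} :
    k ∈ levelSet b t ↔ t ≤ b k := by
  simp [levelSet, h]

/-- Since only finitely many weights exceed `t / 2`, the weights off the level set of `t` are
bounded by some `t' < t`. -/
theorem exists_lt_forall_notMem_levelSet (hb : ∀ t > 0, {k | t ≤ b k}.Finite) {t : ℝ}
    (ht : 0 < t) :
    ∃ t', 0 < t' ∧ t' < t ∧ ∀ k ∉ levelSet b t, b k ≤ t' := by
  classical
  let s : Finset ℝ := insert (t / 2) ((levelSet b (t / 2) \ levelSet b t).image b)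
  have hs : s.Nonempty := ⟨t / 2, Finset.mem_insert_self _ _⟩
  refine ⟨s.max' hs, (half_pos ht).trans_le (s.le_max' _ (Finset.mem_insert_self _ _)), ?_, ?_⟩
  · rw [Finset.max'_lt_iff]
    intro y hy
    rcases Finset.mem_insert.1 hy with rfl | hy
    · exact half_lt_self ht
    · obtain ⟨k, hk, rfl⟩ := Finset.mem_image.1 hy
      rw [Finset.mem_sdiff, mem_levelSet (hb t ht)] at hk
      exact not_le.1 hk.2
  · intro k hk
    by_cases hk2 : k ∈ levelSet b (t / 2)
    · exact s.le_max' _ (Finset.mem_insert_of_mem (Finset.mem_image_of_mem b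
        (Finset.mem_sdiff.2 ⟨hk2, hk⟩)))
    · rw [mem_levelSet (hb _ (half_pos ht)), not_le] at hk2
      exact hk2.le.trans (s.le_max' _ (Finset.mem_insert_self _ _))

/-- The eigenvalues of a finite orthonormal family of eigenvectors are matched injectively with
weights `b k ≥ B - l j`. Hall's condition is the bound `FormBound.card_le` on the number of
eigenvalues below a threshold. -/
theorem sum_posPartPow_le_tsum (B : ℝ) (hb : ∀ t > 0, {k | t ≤ b k}.Finite)
    (hform : ∀ t > 0, ∀ S : Finset ℕ, (∀ k ∉ S, b k ≤ t) → FormBound J D Ψ b S (B - t))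
    {γ : ℝ} (hγ : 0 ≤ γ) {ι : Type*} [Fintype ι]
    {v : ι → E} (hv : Orthonormal ℂ v) {l : ι → ℝ} (hl : ∀ j, l j < B) {x : ι → X}
    (hx : ∀ j, J (x j) = v j)
    (hD : ∀ j y, inner ℂ (D y) (D (x j)) = (l j : ℂ) * inner ℂ (J y) (J (x j))) :
    ∑ j, posPartPow (B - l j) γ ≤ ∑' k, posPartPow (b k) γ := by
  classical
  have hl' : ∀ j, 0 < B - l j := fun j => sub_pos.2 (hl j)
  obtain ⟨σ, hσ, hσ'⟩ : ∃ σ : ι → ℕ, Function.Injective σ ∧ ∀ j, σ j ∈ levelSet b (B - l j) := by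
    refine (Finset.all_card_le_biUnion_card_iff_exists_injective _).1 fun A => ?_
    rcases A.eq_empty_or_nonempty with rfl | hA
    · simp
    obtain ⟨j₀, hj₀, hmax⟩ := A.exists_max_image l hA
    obtain ⟨t', ht0, ht', hlev⟩ := exists_lt_forall_notMem_levelSet hb (hl' j₀)
    have h1 := (hform t' ht0 _ hlev).card_le (ι := A) (v := fun j => v j)
      (hv.comp _ Subtype.val_injective) (l := fun j => l j)
      (fun j => by linarith [hmax j j.2]) (x := fun j => x j) (fun j => hx j) (fun j => hD j)
    rw [Fintype.card_coe] at h1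
    exact h1.trans (Finset.card_le_card
      (Finset.subset_biUnion_of_mem (fun j => levelSet b (B - l j)) hj₀))
  calc ∑ j, posPartPow (B - l j) γ ≤ ∑ j, posPartPow (b (σ j)) γ :=
        Finset.sum_le_sum fun j _ => posPartPow_mono hγ ((mem_levelSet (hb _ (hl' j))).1 (hσ' j))
    _ = ∑ k ∈ Finset.univ.image σ, posPartPow (b k) γ := by
        rw [Finset.sum_image fun i _ j _ h => hσ h]
    _ ≤ _ := ENNReal.sum_le_tsum _

theorem FormBound.finiteDimensional_eigenspaceOf (h : IsFormOperator T J D)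
    (hb : FormBound J D Ψ b S e) {z : ℝ} (hz : z < e) :
    FiniteDimensional ℂ (eigenspaceOf T (z : ℂ)) := by
  let m : eigenspaceOf T (z : ℂ) →ₗ[ℂ] (S → ℂ) :=
    (LinearMap.pi fun k => (innerSL ℂ (Ψ k)).toLinearMap) ∘ₗ Submodule.subtype _
  refine FiniteDimensional.of_injective m ((injective_iff_map_eq_zero _).2 ?_)
  rintro ⟨u, hu⟩ h0
  obtain ⟨x, rfl, hx⟩ := h.mem_eigenspaceOf.1 hu
  by_contra hne
  have hJ : J x ≠ 0 := fun h1 => hne (Subtype.ext h1)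
  obtain ⟨k, hk, hk0⟩ := hb.exists_inner_ne_zero (x := x) (by
    rw [norm_sq_eq_of_eigen hx]
    exact mul_lt_mul_of_pos_right hz (by positivity))
  exact hk0 (congrFun h0 ⟨k, hk⟩)

theorem FormBound.finite_realSpectrum_inter_Iio [CompleteSpace E] [CompleteSpace F]
    [CompleteSpace X] (h : IsFormOperator T J D)
    (hb : FormBound J D Ψ b S e) (hb0 : ∀ k, 0 ≤ b k) : (realSpectrum T ∩ Iio e).Finite := by
  by_contra hinf
  obtain ⟨s, hs, hcard⟩ := Set.Infinite.exists_subset_card_eq hinf (S.card + 1)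
  have hev : ∀ z : s, ∃ x : X, ‖J x‖ = 1 ∧
      ∀ y, inner ℂ (D y) (D x) = (z.1 : ℂ) * inner ℂ (J y) (J x) := by
    rintro ⟨z, hz⟩
    have hne : eigenspaceOf T (z : ℂ) ≠ ⊥ := fun h0 =>
      (hs hz).1 (h.isResolventPoint hb hb0 (hs hz).2 h0)
    obtain ⟨u, hu, hu0⟩ := (Submodule.ne_bot_iff _).1 hne
    have hu' := Submodule.smul_mem _ ((‖u‖ : ℂ)⁻¹) hu
    obtain ⟨x, hx, hx'⟩ := h.mem_eigenspaceOf.1 hu'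
    exact ⟨x, by rw [hx]; exact norm_smul_inv_norm hu0, hx'⟩
  choose x hx1 hx2 using hev
  have := hb.card_le (ι := s) (v := fun z => J (x z)) (l := fun z => z)
    ⟨hx1, fun i j hij => inner_eq_zero_of_eigen (fun h => hij (Subtype.ext h)) (hx2 i) (hx2 j)⟩
    (fun z => (hs z.2).2) (fun _ => rfl) hx2
  rw [Fintype.card_coe, hcard] at this
  omega

/-- If `T ≥ B - ∑ k, b k |Ψ k⟩⟨Ψ k|` in the sense of quadratic forms, then the negative part of
`T - B` is bounded by `∑ k, b k ^ γ`. No orthogonality of the `Ψ k` is needed. -/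
theorem IsFormOperator.traceNegPartPow_le [CompleteSpace E] [CompleteSpace F]
    [CompleteSpace X] (h : IsFormOperator T J D) (B : ℝ) (hb0 : ∀ k, 0 ≤ b k)
    (hform : ∀ t > 0, ∀ S : Finset ℕ, (∀ k ∉ S, b k ≤ t) → FormBound J D Ψ b S (B - t))
    {γ : ℝ} (hγ : 0 ≤ γ) : traceNegPartPow T B γ ≤ ∑' k, posPartPow (b k) γ := by
  classical
  by_cases htop : ∑' k, posPartPow (b k) γ = ⊤
  · rw [htop]; exact le_top
  have hfin : ∀ t > 0, {k | t ≤ b k}.Finite := fun t ht =>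
    finite_setOf_le_of_tsum_posPartPow_ne_top htop hγ ht
  have hbound : ∀ l < B, ∃ (S : Finset ℕ) (e : ℝ), l < e ∧ FormBound J D Ψ b S e := by
    intro l hl
    have ht : 0 < (B - l) / 2 := by linarith
    refine ⟨levelSet b ((B - l) / 2), _, ?_, hform _ ht _ fun k hk => ?_⟩
    · linarith
    · rw [mem_levelSet (hfin _ ht), not_le] at hk
      exact hk.le
  have hfd : ∀ l < B, FiniteDimensional ℂ (eigenspaceOf T (l : ℂ)) := fun l hl => by
    obtain ⟨S, e, hle, hS⟩ := hbound l hl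
    exact hS.finiteDimensional_eigenspaceOf h hle
  have hmult : ∀ l < B, spectralMultiplicity T l =
      (Module.finrank ℂ (eigenspaceOf T (l : ℂ)) : ℕ∞) := by
    intro l hl
    have := hfd l hl
    rw [spectralMultiplicity, if_neg, ← Module.finrank_eq_rank, Cardinal.toENat_nat]
    intro hacc
    obtain ⟨S, e, hle, hS⟩ := hbound l hl
    refine Set.Infinite.of_accPt (hacc.nhds_inter (Iio_mem_nhds hle)) ?_
    exact (hS.finite_realSpectrum_inter_Iio h hb0).subset fun z hz => ⟨hz.2, hz.1⟩
  refine ENNReal.summable.tsum_le_of_sum_le fun s => ?_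
  let s' : Finset ℝ := s.filter (· < B)
  have hs' : ∀ l : s', l.1 < B := fun l => (Finset.mem_filter.1 l.2).2
  have hfd' : ∀ l : s', FiniteDimensional ℂ (eigenspaceOf T (l.1 : ℂ)) := fun l => hfd l (hs' l)
  let ι := Σ l : s', Fin (Module.finrank ℂ (eigenspaceOf T (l.1 : ℂ)))
  let v : ι → E := fun j => (stdOrthonormalBasis ℂ (eigenspaceOf T (j.1.1 : ℂ)) j.2 : E)
  have hev : ∀ j : ι, ∃ x : X, J x = v j ∧
      ∀ y, inner ℂ (D y) (D x) = (j.1.1 : ℂ) * inner ℂ (J y) (J x) := fun j =>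
    h.mem_eigenspaceOf.1 (stdOrthonormalBasis ℂ (eigenspaceOf T (j.1.1 : ℂ)) j.2).2
  choose x hx hD using hev
  have hv : Orthonormal ℂ v := by
    refine ⟨fun j => (stdOrthonormalBasis ℂ (eigenspaceOf T (j.1.1 : ℂ))).orthonormal.1 j.2, ?_⟩
    rintro ⟨l, i⟩ ⟨l', i'⟩ hne
    by_cases hll : l = l'
    · subst hll
      exact (stdOrthonormalBasis ℂ (eigenspaceOf T (l.1 : ℂ))).orthonormal.2
        (fun h => hne (congrArg (Sigma.mk l) h))
    · rw [← hx, ← hx]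
      exact inner_eq_zero_of_eigen (fun h => hll (Subtype.ext h)) (hD ⟨l, i⟩) (hD ⟨l', i'⟩)
  have key := sum_posPartPow_le_tsum B hfin hform hγ hv (l := fun j => j.1.1)
    (fun j => hs' j.1) hx hD
  refine le_trans (le_of_eq ?_) key
  rw [Fintype.sum_sigma]
  simp only [Finset.sum_const, Finset.card_univ, Fintype.card_fin, nsmul_eq_mul]
  rw [Finset.sum_coe_sort s' (fun l => (Module.finrank ℂ (eigenspaceOf T (l : ℂ)) : ℝ≥0∞) *
    posPartPow (B - l) γ), Finset.sum_filter]
  refine Finset.sum_congr rfl fun l _ => ?_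
  split_ifs with hl
  · rw [hmult l hl]
    simp
  · rw [posPartPow_of_nonpos (by linarith), mul_zero]

end TraceBound

/-! ### The radial lowest Landau level states -/

section Radial

theorem landauState_pos {B : ℝ} (hB : 0 < B) (k : ℕ) {r : ℝ} (hr : 0 < r) :
    0 < landauState B k r := by
  have : 0 < Real.Gamma (k + 1) := Real.Gamma_pos_of_pos (by positivity)
  unfold landauState
  positivity

theorem hasDerivAt_landauState (B : ℝ) (k : ℕ) {r : ℝ} (hr : r ≠ 0) :
    HasDerivAt (landauState B k) ((k / r - B * r / 2) * landauState B k r) r := by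
  unfold landauState
  have h1 : HasDerivAt (fun r : ℝ => -(B * r ^ 2 / 4)) (-(B * r / 2)) r := by
    have := (((hasDerivAt_pow 2 r).const_mul B).div_const 4).neg
    refine this.congr_deriv ?_
    simp; ring
  have h2 := (((hasDerivAt_pow k r).const_mul
    (Real.sqrt (B / Real.Gamma (k + 1)) * (B / 2) ^ ((k : ℝ) / 2))).mul h1.exp)
  refine h2.congr_deriv ?_
  have h3 : (k : ℝ) * r ^ (k - 1) = k / r * r ^ k := by
    rcases k with _ | k
    · simp
    · rw [Nat.add_sub_cancel, pow_succ]; field_simp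
  rw [h3]
  ring

theorem continuous_landauState (B : ℝ) (k : ℕ) : Continuous (landauState B k) := by
  unfold landauState
  fun_prop

theorem landauState_sq {B : ℝ} (hB : 0 < B) (k : ℕ) (r : ℝ) :
    landauState B k r ^ 2 =
      B / Real.Gamma (k + 1) * (B / 2) ^ k * (r ^ (2 * k) * Real.exp (-(B / 2) * r ^ 2)) := by
  have hΓ : 0 < Real.Gamma (k + 1) := Real.Gamma_pos_of_pos (by positivity)
  have h1 : ((B / 2) ^ ((k : ℝ) / 2)) ^ 2 = (B / 2) ^ k := by
    rw [← Real.rpow_natCast, ← Real.rpow_mul (by positivity), ← Real.rpow_natCast]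
    congr 1
    push_cast; ring
  have h2 : Real.exp (-(B * r ^ 2 / 4)) ^ 2 = Real.exp (-(B / 2) * r ^ 2) := by
    rw [← Real.exp_nat_mul]; congr 1; push_cast; ring
  rw [landauState, mul_pow, mul_pow, mul_pow, Real.sq_sqrt (by positivity), h1, h2, ← pow_mul,
    mul_comm k 2]
  ring

theorem landauState_sq_mul_eqOn {B : ℝ} (hB : 0 < B) (k : ℕ) :
    EqOn (fun r => landauState B k r ^ 2 * r) (fun r => B / Real.Gamma (k + 1) * (B / 2) ^ k *
      (r ^ (2 * k + 1 : ℝ) * Real.exp (-(B / 2) * r ^ (2 : ℝ)))) (Ioi 0) := by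
  intro r _
  have h1 : r ^ (2 * k + 1 : ℝ) = r ^ (2 * k) * r := by
    rw [← pow_succ, ← Real.rpow_natCast]; push_cast; rfl
  have h2 : r ^ (2 : ℝ) = r ^ 2 := by rw [← Real.rpow_natCast]; norm_num
  simp only [landauState_sq hB, h1, h2]
  ring

theorem integrableOn_landauState_sq {B : ℝ} (hB : 0 < B) (k : ℕ) :
    IntegrableOn (fun r => landauState B k r ^ 2 * r) (Ioi 0) := by
  rw [integrableOn_congr_fun (landauState_sq_mul_eqOn hB k) measurableSet_Ioi]
  refine Integrable.const_mul (integrableOn_rpow_mul_exp_neg_mul_rpow ?_ (by norm_num)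
    (by positivity)) _
  have : (0 : ℝ) ≤ k := by positivity
  linarith

theorem integral_landauState_sq {B : ℝ} (hB : 0 < B) (k : ℕ) :
    ∫ r in Ioi (0 : ℝ), landauState B k r ^ 2 * r = 1 := by
  have hk : (0 : ℝ) ≤ k := by positivity
  rw [setIntegral_congr_fun measurableSet_Ioi (landauState_sq_mul_eqOn hB k), integral_const_mul,
    integral_rpow_mul_exp_neg_mul_rpow (by norm_num) (by linarith) (by positivity)]
  have hΓ : 0 < Real.Gamma (k + 1) := Real.Gamma_pos_of_pos (by positivity)
  have h1 : (2 * (k : ℝ) + 1 + 1) / 2 = k + 1 := by ring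
  have h2 : -(2 * (k : ℝ) + 1 + 1) / 2 = -((k + 1 : ℕ) : ℝ) := by push_cast; ring
  rw [h1, h2, Real.rpow_neg (by positivity), Real.rpow_natCast, pow_succ]
  field_simp

/-! ### Radial sectors of the Hamiltonian -/

theorem integrableOn_Ioi_zero_of_bounded {F : Type*} [NormedAddCommGroup F] {f : ℝ → F} {R M : ℝ}
    (hc : ContinuousOn f (Ioi 0)) (hM : ∀ r, 0 < r → r < R → ‖f r‖ ≤ M)
    (h0 : ∀ r, R ≤ r → f r = 0) : IntegrableOn f (Ioi 0) := by
  have h1 : IntegrableOn f (Ioo 0 R) := by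
    refine IntegrableOn.of_bound measure_Ioo_lt_top
      ((hc.mono Ioo_subset_Ioi_self).aestronglyMeasurable measurableSet_Ioo) M ?_
    filter_upwards [ae_restrict_mem measurableSet_Ioo] with r hr using hM r hr.1 hr.2
  refine h1.of_forall_sdiff_eq_zero measurableSet_Ioi fun r hr => h0 r ?_
  by_contra! h
  exact hr.2 ⟨hr.1, h⟩

/-- A radial profile: a `C¹` function `w` on the half-line that vanishes beyond the radius `R`
and, in the sectors of angular momentum `k ≠ 0`, at the origin. -/
structure IsRadialProfile (k : ℕ) (R : ℝ) (w w' : ℝ → ℂ) : Prop where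
  hasDerivAt : ∀ r, HasDerivAt w (w' r) r
  continuous_deriv : Continuous w'
  pos : 0 < R
  eq_zero : ∀ r, R ≤ r → w r = 0
  deriv_eq_zero : ∀ r, R ≤ r → w' r = 0
  zero : k ≠ 0 → w 0 = 0

/-- The annihilation operator `w ↦ w' - (k / r - B r / 2) w` of the sector of angular momentum `k`;
its kernel is spanned by `landauState B k`. -/
def radialAnnihilation (B : ℝ) (k : ℕ) (w w' : ℝ → ℂ) (r : ℝ) : ℂ :=
  w' r - (k / r - B * r / 2 : ℝ) • w r

variable {B : ℝ} {k : ℕ} {R : ℝ} {w w' : ℝ → ℂ}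

namespace IsRadialProfile

theorem continuous (h : IsRadialProfile k R w w') : Continuous w :=
  continuous_iff_continuousAt.2 fun r => (h.hasDerivAt r).continuousAt

theorem exists_bound (h : IsRadialProfile k R w w') :
    ∃ M, 0 ≤ M ∧ ∀ r, 0 ≤ r → ‖w r‖ ≤ M ∧ ‖w' r‖ ≤ M ∧ ‖(k / r : ℝ) • w r‖ ≤ M := by
  obtain ⟨M₁, hM₁⟩ := (isCompact_Icc (a := (0 : ℝ)) (b := R)).exists_bound_of_continuousOn
    h.continuous.continuousOn
  obtain ⟨M₂, hM₂⟩ := (isCompact_Icc (a := (0 : ℝ)) (b := R)).exists_bound_of_continuousOn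
    h.continuous_deriv.continuousOn
  have h1 : ∀ r, 0 ≤ r → ‖w r‖ ≤ max M₁ 0 := fun r hr => by
    rcases le_or_gt R r with h' | h'
    · rw [h.eq_zero r h', norm_zero]; exact le_max_right _ _
    · exact (hM₁ r ⟨hr, h'.le⟩).trans (le_max_left _ _)
  have h2 : ∀ r, 0 ≤ r → ‖w' r‖ ≤ max M₂ 0 := fun r hr => by
    rcases le_or_gt R r with h' | h'
    · rw [h.deriv_eq_zero r h', norm_zero]; exact le_max_right _ _
    · exact (hM₂ r ⟨hr, h'.le⟩).trans (le_max_left _ _)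
  have h3 : ∀ r, 0 ≤ r → ‖(k / r : ℝ) • w r‖ ≤ k * max M₂ 0 := fun r hr => by
    rcases eq_or_ne k 0 with rfl | hk
    · simp
    rcases hr.eq_or_lt with rfl | hr'
    · simp; positivity
    have := (convex_Ici (0 : ℝ)).norm_image_sub_le_of_norm_hasDerivWithin_le
      (fun x _ => (h.hasDerivAt x).hasDerivWithinAt) (fun x hx => h2 x hx) self_mem_Ici hr
    rw [h.zero hk, sub_zero, sub_zero, Real.norm_of_nonneg hr] at this
    rw [norm_smul, Real.norm_of_nonneg (by positivity)]
    calc k / r * ‖w r‖ ≤ k / r * (max M₂ 0 * r) := by gcongr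
      _ = _ := by field_simp
  refine ⟨max (max M₁ 0) (max (max M₂ 0) (k * max M₂ 0)), by positivity, fun r hr => ⟨?_, ?_, ?_⟩⟩
  · exact (h1 r hr).trans (le_max_left _ _)
  · exact (h2 r hr).trans ((le_max_left _ _).trans (le_max_right _ _))
  · exact (h3 r hr).trans ((le_max_right _ _).trans (le_max_right _ _))

theorem annihilation_eq_zero (h : IsRadialProfile k R w w') {r : ℝ} (hr : R ≤ r) :
    radialAnnihilation B k w w' r = 0 := by
  simp [radialAnnihilation, h.eq_zero r hr, h.deriv_eq_zero r hr]

theorem continuousOn_annihilation (h : IsRadialProfile k R w w') :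
    ContinuousOn (radialAnnihilation B k w w') (Ioi 0) := by
  unfold radialAnnihilation
  have h1 : ContinuousOn (fun r : ℝ => (k / r - B * r / 2 : ℝ)) (Ioi 0) :=
    (continuousOn_const.div continuousOn_id fun r hr => (ne_of_gt hr)).sub (by fun_prop)
  exact h.continuous_deriv.continuousOn.sub (h1.smul h.continuous.continuousOn)

theorem integrableOn_annihilation (h : IsRadialProfile k R w w') :
    IntegrableOn (fun r => r * ‖radialAnnihilation B k w w' r‖ ^ 2) (Ioi 0) := by
  obtain ⟨M, hM0, hM⟩ := h.exists_bound
  refine integrableOn_Ioi_zero_of_bounded (R := R) (M := R * (M + M + |B| * R / 2 * M) ^ 2)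
    (continuousOn_id.mul (h.continuousOn_annihilation.norm.pow 2)) (fun r hr hrR => ?_)
    fun r hr => by simp [h.annihilation_eq_zero hr]
  obtain ⟨h1, h2, h3⟩ := hM r hr.le
  have : ‖radialAnnihilation B k w w' r‖ ≤ M + M + |B| * R / 2 * M := by
    have e : radialAnnihilation B k w w' r
        = w' r - (k / r : ℝ) • w r + (B * r / 2 : ℝ) • w r := by
      rw [radialAnnihilation, sub_smul]; abel
    rw [e]
    refine (norm_add_le _ _).trans (add_le_add ((norm_sub_le _ _).trans (add_le_add h2 h3)) ?_)
    rw [norm_smul, Real.norm_eq_abs, abs_div, abs_mul, abs_of_pos hr, abs_two]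
    have := h.pos.le
    gcongr
  rw [norm_mul, norm_pow, norm_norm, Real.norm_of_nonneg hr.le]
  gcongr
  exact h.pos.le

/-- Integrability of `c r * r * ‖w r‖ ^ 2` for bounded continuous coefficients `c`. -/
theorem integrableOn_mul_norm_sq (h : IsRadialProfile k R w w') {c : ℝ → ℝ} {C : ℝ}
    (hc : ContinuousOn c (Ioi 0)) (hC : ∀ r, 0 < r → |c r| ≤ C) :
    IntegrableOn (fun r => r * (c r * ‖w r‖ ^ 2)) (Ioi 0) := by
  obtain ⟨M, hM0, hM⟩ := h.exists_bound
  refine integrableOn_Ioi_zero_of_bounded (R := R) (M := R * (C * M ^ 2))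
    (continuousOn_id.mul (hc.mul (h.continuous.continuousOn.norm.pow 2))) (fun r hr hrR => ?_)
    fun r hr => by simp [h.eq_zero r hr]
  have hC0 : 0 ≤ C := (abs_nonneg _).trans (hC r hr)
  rw [norm_mul, norm_mul, norm_pow, norm_norm, Real.norm_of_nonneg hr.le, Real.norm_eq_abs]
  gcongr
  · exact h.pos.le
  · exact hC r hr
  · exact (hM r hr.le).1

theorem integrableOn_norm_sq (h : IsRadialProfile k R w w') :
    IntegrableOn (fun r => r * ‖w r‖ ^ 2) (Ioi 0) := by
  simpa using h.integrableOn_mul_norm_sq (c := fun _ => 1) (C := 1) continuousOn_const (by simp)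

theorem integrableOn_landauState_mul (h : IsRadialProfile k R w w') (B : ℝ) (j : ℕ) :
    IntegrableOn (fun r => (landauState B j r * r : ℝ) • w r) (Ioi 0) := by
  have hc : Continuous fun r => (landauState B j r * r : ℝ) • w r :=
    ((continuous_landauState B j).mul continuous_id).smul h.continuous
  obtain ⟨M, hM⟩ := (isCompact_Icc (a := (0 : ℝ)) (b := R)).exists_bound_of_continuousOn
    hc.continuousOn
  exact integrableOn_Ioi_zero_of_bounded (R := R) (M := M) hc.continuousOn
    (fun r hr hrR => hM r ⟨hr.le, hrR.le⟩) fun r hr => by simp [h.eq_zero r hr]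

theorem integrableOn_norm_sub_sq (h : IsRadialProfile k R w w') (hB : 0 < B) (c : ℂ) :
    IntegrableOn (fun r => r * ‖w r - landauState B k r • c‖ ^ 2) (Ioi 0) := by
  have h1 := h.integrableOn_norm_sq
  have h2 := (integrableOn_landauState_sq hB k).mul_const (‖c‖ ^ 2)
  have hc : Continuous fun r => r * ‖w r - landauState B k r • c‖ ^ 2 :=
    continuous_id.mul ((h.continuous.sub
      ((continuous_landauState B k).smul continuous_const)).norm.pow 2)
  refine Integrable.mono' ((h1.add h2).const_mul 2) hc.aestronglyMeasurable ?_
  filter_upwards [ae_restrict_mem measurableSet_Ioi] with r hr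
  have hr' : 0 < r := hr
  rw [norm_mul, norm_pow, norm_norm, Real.norm_of_nonneg hr'.le]
  have h3 : ‖w r - landauState B k r • c‖ ≤ ‖w r‖ + |landauState B k r| * ‖c‖ := by
    refine (norm_sub_le _ _).trans (by rw [norm_smul, Real.norm_eq_abs])
  have h4 : ‖w r - landauState B k r • c‖ ^ 2 ≤ (‖w r‖ + |landauState B k r| * ‖c‖) ^ 2 := by
    gcongr
  have h5 : (|landauState B k r| * ‖c‖) ^ 2 = landauState B k r ^ 2 * ‖c‖ ^ 2 := by
    rw [mul_pow, sq_abs]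
  simp only [Pi.add_apply]
  calc r * ‖w r - landauState B k r • c‖ ^ 2
      ≤ r * (2 * (‖w r‖ ^ 2 + landauState B k r ^ 2 * ‖c‖ ^ 2)) := by
        gcongr
        nlinarith [sq_nonneg (‖w r‖ - |landauState B k r| * ‖c‖)]
    _ = _ := by ring

/-- The spectral gap above the lowest Landau level in a radial sector, for *some* multiple
of the Landau state. With `m = 2 (k + 1) / B`, the function `(r ^ 2 - m) * landauState B k r` is
the next eigenstate, and comparing `w - c • landauState B k` with it produces a total derivative;
its boundary term at the node `√m` vanishes if `c` makes the difference vanish there. -/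
theorem exists_gap (h : IsRadialProfile k R w w') (hB : 0 < B) :
    ∃ c : ℂ, 2 * B * ∫ r in Ioi (0 : ℝ), r * ‖w r - landauState B k r • c‖ ^ 2 ≤
      ∫ r in Ioi (0 : ℝ), r * ‖radialAnnihilation B k w w' r‖ ^ 2 := by
  let m : ℝ := 2 * (k + 1) / B
  have hm : 0 < m := by positivity
  let r₀ := Real.sqrt m
  have hr₀ : 0 < r₀ := Real.sqrt_pos.2 hm
  have hr₀m : r₀ ^ 2 = m := Real.sq_sqrt hm.le
  let c : ℂ := (landauState B k r₀)⁻¹ • w r₀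
  refine ⟨c, ?_⟩
  let q : ℝ → ℂ := fun r => w r - landauState B k r • c
  let q' : ℝ → ℂ := fun r => w' r - ((k / r - B * r / 2) * landauState B k r) • c
  have hq0 : q r₀ = 0 := by
    simp only [q, c, smul_smul]
    rw [mul_inv_cancel₀ (landauState_pos hB k hr₀).ne', one_smul, sub_self]
  have hqd : ∀ r, 0 < r → HasDerivAt q (q' r) r := fun r hr =>
    (h.hasDerivAt r).sub ((hasDerivAt_landauState B k hr.ne').smul_const c)
  have hqc : Continuous q := h.continuous.sub ((continuous_landauState B k).smul continuous_const)
  have hqD : ∀ r, q' r = radialAnnihilation B k w w' r + (k / r - B * r / 2 : ℝ) • q r := by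
    intro r
    simp only [q, q', radialAnnihilation, smul_sub, smul_smul]
    abel
  let Y : ℝ → ℝ := fun r => 2 * r ^ 2 * ‖q r‖ ^ 2 / (r ^ 2 - m)
  have hne : ∀ r, 0 < r → r ≠ r₀ → r ^ 2 - m ≠ 0 := fun r hr hrr h0 => hrr (by
    rw [← hr₀m, sub_eq_zero] at h0
    exact (pow_left_inj₀ hr.le hr₀.le two_ne_zero).1 h0)
  have hm0 : (0 : ℝ) ^ 2 - m ≠ 0 := by simp [hm.ne']
  have hYc : ∀ r, 0 ≤ r → ContinuousAt Y r := by
    intro r hr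
    by_cases hrr : r = r₀
    · subst hrr
      -- near the node, `Y` is a bounded factor times `slope q` times `q`
      have hs := (hqd _ hr₀).tendsto_slope
      have hlim : Tendsto (fun r => 2 * r ^ 2 / (r + r₀) * (‖slope q r₀ r‖ * ‖q r‖)) (𝓝[≠] r₀)
          (𝓝 (2 * r₀ ^ 2 / (r₀ + r₀) * (‖q' r₀‖ * ‖q r₀‖))) := by
        refine Tendsto.mul ?_ (hs.norm.mul (hqc.norm.continuousAt.mono_left nhdsWithin_le_nhds))
        have : ContinuousAt (fun r : ℝ => 2 * r ^ 2 / (r + r₀)) r₀ := by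
          refine ContinuousAt.div (by fun_prop) (by fun_prop) (by positivity)
        exact this.mono_left nhdsWithin_le_nhds
      have hY0 : Y r₀ = 0 := by simp [Y, hq0]
      rw [continuousAt_iff_punctured_nhds, hY0]
      rw [hq0, norm_zero, mul_zero, mul_zero] at hlim
      rw [tendsto_zero_iff_norm_tendsto_zero] at hlim ⊢
      refine hlim.congr' ?_
      have hpos : ∀ᶠ r in 𝓝[≠] r₀, 0 < r := nhdsWithin_le_nhds (lt_mem_nhds hr₀)
      filter_upwards [hpos, self_mem_nhdsWithin] with r hr hrr
      have h1 : r - r₀ ≠ 0 := sub_ne_zero.2 hrr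
      have h2 : r ^ 2 - m = (r + r₀) * (r - r₀) := by rw [← hr₀m]; ring
      have h3 : (r + r₀) ≠ 0 := by positivity
      simp only [Y, slope_def_module, hq0, sub_zero, norm_mul, norm_div, norm_smul, norm_inv,
        norm_norm, h2, norm_pow]
      have h4 : ‖r - r₀‖ ≠ 0 := norm_ne_zero_iff.2 h1
      have h5 : ‖r + r₀‖ ≠ 0 := norm_ne_zero_iff.2 h3
      field_simp
    · refine ContinuousAt.div (by fun_prop) (by fun_prop) ?_
      rcases hr.eq_or_lt with rfl | hr
      · exact hm0
      · exact hne r hr hrr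
  let Y' : ℝ → ℝ := fun r => ((4 * r) * ‖q r‖ ^ 2 + 2 * r ^ 2 * (2 * inner ℝ (q r) (q' r)))
    / (r ^ 2 - m) - 2 * r ^ 2 * ‖q r‖ ^ 2 * (2 * r) / (r ^ 2 - m) ^ 2
  have hYd : ∀ r, 0 < r → r ≠ r₀ → HasDerivAt Y (Y' r) r := by
    intro r hr hrr
    have h1 : HasDerivAt (fun r : ℝ => 2 * r ^ 2) (4 * r) r :=
      ((hasDerivAt_pow 2 r).const_mul 2).congr_deriv (by simp; ring)
    have h2 : HasDerivAt (fun r : ℝ => r ^ 2 - m) (2 * r) r :=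
      ((hasDerivAt_pow 2 r).sub_const m).congr_deriv (by simp)
    refine ((h1.mul (hqd r hr).norm_sq).div h2 (hne r hr hrr)).congr_deriv ?_
    have := hne r hr hrr
    simp only [Y', Pi.mul_apply]
    field_simp
  let φ : ℝ → ℝ := fun r => r * ‖radialAnnihilation B k w w' r‖ ^ 2 - 2 * B * (r * ‖q r‖ ^ 2)
  have hφY : ∀ r, 0 < r → r ≠ r₀ → Y' r ≤ φ r := by
    intro r hr hrr
    have h0 := hne r hr hrr
    have hsq : 0 ≤ r * ‖radialAnnihilation B k w w' r - (2 * r / (r ^ 2 - m)) • q r‖ ^ 2 := by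
      positivity
    have hid : φ r - Y' r
        = r * ‖radialAnnihilation B k w w' r - (2 * r / (r ^ 2 - m)) • q r‖ ^ 2 := by
      rw [norm_sub_sq_real, inner_smul_right, norm_smul, mul_pow, Real.norm_eq_abs, sq_abs]
      simp only [φ, Y', hqD, inner_add_right, inner_smul_right, real_inner_self_eq_norm_sq]
      rw [real_inner_comm (q r)]
      generalize inner ℝ (q r) (radialAnnihilation B k w w' r) = i
      generalize ‖q r‖ = n
      generalize ‖radialAnnihilation B k w w' r‖ = d
      have hk : (k : ℝ) = m * B / 2 - 1 := by simp only [m]; field_simp; ring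
      rw [hk]
      field_simp
      ring
    linarith
  have hqi : IntegrableOn (fun r => r * ‖q r‖ ^ 2) (Ioi 0) := h.integrableOn_norm_sub_sq hB c
  have hφi : IntegrableOn φ (Ioi 0) := h.integrableOn_annihilation.sub (hqi.const_mul _)
  have hφii : IntegrableOn φ (Ici 0) := (integrableOn_Ici_iff_integrableOn_Ioi).2 hφi
  have hpart : ∀ b, r₀ ≤ b → 0 ≤ ∫ r in (0 : ℝ)..b, φ r := by
    intro b hb
    have h1 : Y r₀ - Y 0 ≤ ∫ r in (0 : ℝ)..r₀, φ r :=
      intervalIntegral.sub_le_integral_of_hasDeriv_right_of_le hr₀.le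
        (fun r hr => (hYc r hr.1).continuousWithinAt)
        (fun r hr => (hYd r hr.1 hr.2.ne).hasDerivWithinAt)
        (hφii.mono_set Icc_subset_Ici_self) (fun r hr => hφY r hr.1 hr.2.ne)
    have h2 : Y b - Y r₀ ≤ ∫ r in r₀..b, φ r :=
      intervalIntegral.sub_le_integral_of_hasDeriv_right_of_le hb
        (fun r hr => (hYc r (hr₀.le.trans hr.1)).continuousWithinAt)
        (fun r hr => (hYd r (hr₀.trans hr.1) hr.1.ne').hasDerivWithinAt)
        (hφii.mono_set fun r hr => hr₀.le.trans hr.1) (fun r hr => hφY r (hr₀.trans hr.1) hr.1.ne')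
    have h3 : Y 0 = 0 := by simp [Y]
    have h4 : 0 ≤ Y b := by
      refine div_nonneg (by positivity) ?_
      rw [← hr₀m, sub_nonneg]
      gcongr
    have hi : ∀ x y, 0 ≤ x → 0 ≤ y → IntervalIntegrable φ volume x y := fun x y hx hy =>
      ⟨hφi.mono_set fun r hr => lt_of_le_of_lt hx hr.1,
        hφi.mono_set fun r hr => lt_of_le_of_lt hy hr.1⟩
    rw [← intervalIntegral.integral_add_adjacent_intervals (hi 0 r₀ le_rfl hr₀.le)
      (hi r₀ b hr₀.le (hr₀.le.trans hb))]
    linarith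
  have hlim := intervalIntegral_tendsto_integral_Ioi 0 hφi tendsto_id
  have := ge_of_tendsto hlim ((eventually_ge_atTop r₀).mono hpart)
  rw [integral_sub h.integrableOn_annihilation (hqi.const_mul _), integral_const_mul] at this
  linarith

theorem integral_norm_sub_sq_eq (h : IsRadialProfile k R w w') (hB : 0 < B) (c : ℂ) :
    ∫ r in Ioi (0 : ℝ), r * ‖w r - landauState B k r • c‖ ^ 2 =
      (∫ r in Ioi (0 : ℝ), r * ‖w r‖ ^ 2)
        - 2 * inner ℝ c (∫ s in Ioi (0 : ℝ), (landauState B k s * s : ℝ) • w s) + ‖c‖ ^ 2 := by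
  have e : ∀ r : ℝ, r * ‖w r - landauState B k r • c‖ ^ 2 = r * ‖w r‖ ^ 2
      - 2 * inner ℝ c ((landauState B k r * r : ℝ) • w r)
      + (landauState B k r ^ 2 * r) * ‖c‖ ^ 2 := by
    intro r
    rw [norm_sub_sq_real, inner_smul_right, inner_smul_right, norm_smul, mul_pow,
      Real.norm_eq_abs, sq_abs, real_inner_comm]
    ring
  have h2 := (h.integrableOn_landauState_mul B k).const_inner (𝕜 := ℝ) c
  simp_rw [e]
  rw [integral_add (f := fun r => r * ‖w r‖ ^ 2
      - 2 * inner ℝ c ((landauState B k r * r : ℝ) • w r))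
    (Integrable.sub h.integrableOn_norm_sq (h2.const_mul 2))
    ((integrableOn_landauState_sq hB k).mul_const _),
    integral_sub h.integrableOn_norm_sq (h2.const_mul 2), integral_const_mul, integral_mul_const,
    integral_landauState_sq hB, one_mul,
    integral_inner (h.integrableOn_landauState_mul B k) c]

/-- The radial projection onto the Landau state is the best approximation. -/
theorem integral_norm_sub_le (h : IsRadialProfile k R w w') (hB : 0 < B) (c : ℂ) :
    ∫ r in Ioi (0 : ℝ), r * ‖w r - landauState B k r •
        ∫ s in Ioi (0 : ℝ), (landauState B k s * s : ℝ) • w s‖ ^ 2 ≤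
      ∫ r in Ioi (0 : ℝ), r * ‖w r - landauState B k r • c‖ ^ 2 := by
  rw [h.integral_norm_sub_sq_eq hB, h.integral_norm_sub_sq_eq hB, real_inner_self_eq_norm_sq]
  set p := ∫ s in Ioi (0 : ℝ), (landauState B k s * s : ℝ) • w s
  have := norm_sub_sq_real c p
  nlinarith [sq_nonneg ‖c - p‖]

/-- Bessel's inequality for the Landau state. -/
theorem norm_sq_integral_landauState_mul_le (h : IsRadialProfile k R w w') (hB : 0 < B) :
    ‖∫ s in Ioi (0 : ℝ), (landauState B k s * s : ℝ) • w s‖ ^ 2 ≤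
      ∫ r in Ioi (0 : ℝ), r * ‖w r‖ ^ 2 := by
  have h1 := h.integral_norm_sub_sq_eq hB (∫ s in Ioi (0 : ℝ), (landauState B k s * s : ℝ) • w s)
  rw [real_inner_self_eq_norm_sq] at h1
  have h2 : 0 ≤ ∫ r in Ioi (0 : ℝ), r * ‖w r - landauState B k r •
      ∫ s in Ioi (0 : ℝ), (landauState B k s * s : ℝ) • w s‖ ^ 2 :=
    setIntegral_nonneg measurableSet_Ioi fun r hr => mul_nonneg (le_of_lt hr) (sq_nonneg _)
  linarith

end IsRadialProfile
end Radial

/-! ### Lower bounds in the angular sectors -/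

section RadialSectors

/-- The bounds on the flux `Φ(r) = ∫_0^r g(s) s ds` that hold for a field with `0 ≤ g ≤ B` and
`∫_0^∞ g(s) s ds ≤ 1`. -/
structure IsAdmissibleFlux (B : ℝ) (g : ℝ → ℝ) : Prop where
  continuous : ContinuousOn (fun r => ∫ s in (0 : ℝ)..r, g s * s) (Ioi 0)
  nonneg : ∀ r, 0 < r → 0 ≤ ∫ s in (0 : ℝ)..r, g s * s
  le_one : ∀ r, 0 < r → ∫ s in (0 : ℝ)..r, g s * s ≤ 1
  le_sq : ∀ r, 0 < r → ∫ s in (0 : ℝ)..r, g s * s ≤ B * r ^ 2 / 2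

variable {B : ℝ} {g : ℝ → ℝ} {k : ℕ} {R : ℝ} {w w' : ℝ → ℂ}

theorem effectivePotential_eq {r : ℝ} (hr : 0 < r) :
    effectivePotential B g k r = (2 * k + ∫ s in (0 : ℝ)..r, g s * s)
      * ((∫ s in (0 : ℝ)..r, g s * s) / r ^ 2) - B * ∫ s in (0 : ℝ)..r, g s * s := by
  unfold effectivePotential circularPotential circularPotential₀
  field_simp
  ring

theorem effectivePotential_eq_sub_sq {r : ℝ} (hr : 0 < r) :
    effectivePotential B g k r = (k / r - circularPotential B g r) ^ 2
      - (k / r - B * r / 2) ^ 2 := by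
  unfold effectivePotential circularPotential₀
  field_simp
  ring

theorem effectiveExpectation_eq :
    effectiveExpectation B g k =
      ∫ r in Ioi (0 : ℝ), max (-effectivePotential B g k r) 0 * (landauState B k r ^ 2 * r) := by
  unfold effectiveExpectation
  congr 1
  ext r
  ring

theorem effectiveExpectation_nonneg (B : ℝ) (g : ℝ → ℝ) (k : ℕ) :
    0 ≤ effectiveExpectation B g k := by
  rw [effectiveExpectation_eq]
  refine setIntegral_nonneg measurableSet_Ioi fun r hr => ?_
  have hr' : 0 < r := hr
  positivity

namespace IsAdmissibleFlux

theorem continuousOn_circularPotential (hg : IsAdmissibleFlux B g) :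
    ContinuousOn (circularPotential B g) (Ioi 0) := by
  unfold circularPotential
  have h1 : ContinuousOn (fun r : ℝ => 1 / r) (Ioi 0) :=
    continuousOn_const.div continuousOn_id fun r hr => (ne_of_gt hr)
  exact ContinuousOn.sub (by fun_prop) (h1.mul hg.continuous)

theorem continuousOn_effectivePotential (hg : IsAdmissibleFlux B g) (k : ℕ) :
    ContinuousOn (effectivePotential B g k) (Ioi 0) := by
  unfold effectivePotential circularPotential₀
  have h1 : ContinuousOn (fun r : ℝ => 2 * k / r) (Ioi 0) :=
    continuousOn_const.div continuousOn_id fun r hr => (ne_of_gt hr)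
  have h2 := hg.continuousOn_circularPotential
  fun_prop

/-- The attractive part of the effective potential is at most `B`, half of the Landau gap. -/
theorem neg_effectivePotential_le (hg : IsAdmissibleFlux B g) (hB : 0 < B) {r : ℝ} (hr : 0 < r) :
    -effectivePotential B g k r ≤ B := by
  rw [effectivePotential_eq hr]
  have h1 := hg.nonneg r hr
  have h2 := hg.le_one r hr
  set Φ := ∫ s in (0 : ℝ)..r, g s * s
  have h3 : 0 ≤ (2 * k + Φ) * (Φ / r ^ 2) := by positivity
  nlinarith

theorem abs_effectivePotential_le (hg : IsAdmissibleFlux B g) (hB : 0 < B) {r : ℝ} (hr : 0 < r) :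
    |effectivePotential B g k r| ≤ (2 * k + 1) * (B / 2) + B := by
  have h0 := hg.neg_effectivePotential_le (k := k) hB hr
  have hp : 0 ≤ (2 * k + 1) * (B / 2) := by positivity
  rw [abs_le]
  refine ⟨by linarith, ?_⟩
  rw [effectivePotential_eq hr]
  have h1 := hg.nonneg r hr
  have h2 := hg.le_one r hr
  have h3 := hg.le_sq r hr
  set Φ := ∫ s in (0 : ℝ)..r, g s * s
  have h4 : Φ / r ^ 2 ≤ B / 2 := by rw [div_le_iff₀ (by positivity)]; linarith
  have h5 : (2 * k + Φ) * (Φ / r ^ 2) ≤ (2 * k + 1) * (B / 2) := by gcongr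
  have h6 : 0 ≤ B * Φ := by positivity
  linarith

theorem integrableOn_effectiveExpectation (hg : IsAdmissibleFlux B g) (hB : 0 < B) (k : ℕ) :
    IntegrableOn (fun r => max (-effectivePotential B g k r) 0 * (landauState B k r ^ 2 * r))
      (Ioi 0) := by
  have hc : ContinuousOn (fun r => max (-effectivePotential B g k r) 0) (Ioi 0) :=
    (hg.continuousOn_effectivePotential k).neg.sup continuousOn_const
  refine Integrable.bdd_mul (c := B) (integrableOn_landauState_sq hB k)
    (hc.aestronglyMeasurable measurableSet_Ioi) ?_
  filter_upwards [ae_restrict_mem measurableSet_Ioi] with r hr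
  rw [Real.norm_of_nonneg (le_max_right _ _)]
  exact max_le (hg.neg_effectivePotential_le hB hr) hB.le

end IsAdmissibleFlux

namespace IsRadialProfile

/-- The total derivative that relates the radial Hamiltonian to `radialAnnihilation`. -/
theorem integral_deriv_eq_zero (h : IsRadialProfile k R w w') (B : ℝ) :
    IntegrableOn (fun r => 2 * inner ℝ (w r) (w' r) * (k - B * r ^ 2 / 2) - ‖w r‖ ^ 2 * (B * r))
      (Ioi 0) ∧
    ∫ r in Ioi (0 : ℝ), (2 * inner ℝ (w r) (w' r) * (k - B * r ^ 2 / 2) - ‖w r‖ ^ 2 * (B * r))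
      = 0 := by
  have hw := h.continuous
  have hw' := h.continuous_deriv
  have hc : Continuous fun r =>
      (2 * inner ℝ (w r) (w' r) * (k - B * r ^ 2 / 2) - ‖w r‖ ^ 2 * (B * r)) := by fun_prop
  obtain ⟨M, hM⟩ := (isCompact_Icc (a := (0 : ℝ)) (b := R)).exists_bound_of_continuousOn
    hc.continuousOn
  have hi := integrableOn_Ioi_zero_of_bounded (R := R) (M := M) hc.continuousOn
    (fun r hr hrR => hM r ⟨hr.le, hrR.le⟩) (fun r hr => by simp [h.eq_zero r hr])
  refine ⟨hi, ?_⟩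
  have hd : ∀ r ∈ Ici (0 : ℝ), HasDerivAt (fun r => ‖w r‖ ^ 2 * (k - B * r ^ 2 / 2))
      (2 * inner ℝ (w r) (w' r) * (k - B * r ^ 2 / 2) - ‖w r‖ ^ 2 * (B * r)) r := by
    intro r _
    have h1 : HasDerivAt (fun r : ℝ => k - B * r ^ 2 / 2) (-(B * r)) r := by
      refine ((((hasDerivAt_pow 2 r).const_mul B).div_const 2).const_sub (k : ℝ)).congr_deriv ?_
      simp; ring
    exact ((h.hasDerivAt r).norm_sq.mul h1).congr_deriv (by ring)
  have hlim : Tendsto (fun r => ‖w r‖ ^ 2 * (k - B * r ^ 2 / 2)) atTop (𝓝 0) := by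
    refine tendsto_const_nhds.congr' ?_
    filter_upwards [eventually_ge_atTop R] with r hr
    simp [h.eq_zero r hr]
  rw [integral_Ioi_of_hasDerivAt_of_tendsto' hd hi hlim]
  rcases eq_or_ne k 0 with rfl | hk
  · simp
  · simp [h.zero hk]

/-- In the sectors that carry a Landau state, the radial Hamiltonian is bounded below by `B`, up to
twice the expectation of the attractive part of the effective potential: this part is at most `B`,
so its contribution off the Landau state is absorbed by the gap `2 B`. -/
theorem sector_bound (h : IsRadialProfile k R w w') (hg : IsAdmissibleFlux B g) (hB : 0 < B) :
    IntegrableOn (fun r => r * (‖w' r‖ ^ 2 + (k / r - circularPotential B g r) ^ 2 * ‖w r‖ ^ 2))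
      (Ioi 0) ∧
    B * ∫ r in Ioi (0 : ℝ), r * ‖w r‖ ^ 2 ≤
      (∫ r in Ioi (0 : ℝ), r * (‖w' r‖ ^ 2 + (k / r - circularPotential B g r) ^ 2 * ‖w r‖ ^ 2))
      + 2 * effectiveExpectation B g k *
        ‖∫ s in Ioi (0 : ℝ), (landauState B k s * s : ℝ) • w s‖ ^ 2 := by
  set p := ∫ s in Ioi (0 : ℝ), (landauState B k s * s : ℝ) • w s with hp
  obtain ⟨hGi, hG0⟩ := h.integral_deriv_eq_zero B
  have hDi := h.integrableOn_annihilation (B := B)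
  have hni := h.integrableOn_norm_sq
  have hVi := h.integrableOn_mul_norm_sq (hg.continuousOn_effectivePotential k)
    (fun r hr => hg.abs_effectivePotential_le hB hr)
  have hid : EqOn (fun r => r * (‖w' r‖ ^ 2 + (k / r - circularPotential B g r) ^ 2 * ‖w r‖ ^ 2))
      (fun r => r * ‖radialAnnihilation B k w w' r‖ ^ 2
        + (2 * inner ℝ (w r) (w' r) * (k - B * r ^ 2 / 2) - ‖w r‖ ^ 2 * (B * r))
        + B * (r * ‖w r‖ ^ 2)
        + r * (effectivePotential B g k r * ‖w r‖ ^ 2)) (Ioi 0) := by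
    intro r hr
    have hr' : (0 : ℝ) < r := hr
    simp only [effectivePotential_eq_sub_sq hr', radialAnnihilation]
    rw [norm_sub_sq_real, inner_smul_right, norm_smul, mul_pow, Real.norm_eq_abs, sq_abs,
      real_inner_comm]
    field_simp
    ring
  have hsum1 := Integrable.add hDi hGi
  have hsum2 := Integrable.add hsum1 (hni.const_mul B)
  have hsum3 := Integrable.add hsum2 hVi
  refine ⟨(integrableOn_congr_fun hid measurableSet_Ioi).2 hsum3, ?_⟩
  have htot : ∫ r in Ioi (0 : ℝ),
      r * (‖w' r‖ ^ 2 + (k / r - circularPotential B g r) ^ 2 * ‖w r‖ ^ 2) =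
      (∫ r in Ioi (0 : ℝ), r * ‖radialAnnihilation B k w w' r‖ ^ 2)
        + B * (∫ r in Ioi (0 : ℝ), r * ‖w r‖ ^ 2)
        + ∫ r in Ioi (0 : ℝ), r * (effectivePotential B g k r * ‖w r‖ ^ 2) := by
    rw [setIntegral_congr_fun measurableSet_Ioi hid]
    refine (integral_add hsum2 hVi).trans ?_
    congr 1
    refine (integral_add hsum1 (hni.const_mul B)).trans ?_
    rw [integral_const_mul]
    congr 1
    refine (integral_add hDi hGi).trans ?_
    rw [hG0, add_zero]
  have hqi := h.integrableOn_norm_sub_sq hB p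
  have hEi := hg.integrableOn_effectiveExpectation hB k
  have hneg : ∫ r in Ioi (0 : ℝ), -(r * (effectivePotential B g k r * ‖w r‖ ^ 2)) ≤
      ∫ r in Ioi (0 : ℝ), (2 * ‖p‖ ^ 2 *
        (max (-effectivePotential B g k r) 0 * (landauState B k r ^ 2 * r))
        + 2 * B * (r * ‖w r - landauState B k r • p‖ ^ 2)) := by
    refine setIntegral_mono_on hVi.neg ((hEi.const_mul _).add (hqi.const_mul _))
      measurableSet_Ioi fun r hr => ?_
    have hr' : (0 : ℝ) < r := hr
    have hV := max_le (hg.neg_effectivePotential_le (k := k) hB hr') hB.le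
    have hV1 := le_max_left (-effectivePotential B g k r) 0
    have hV0 := le_max_right (-effectivePotential B g k r) 0
    set V := max (-effectivePotential B g k r) 0
    -- the factor `2` of the bound comes from splitting `w` into its two components here
    have hw : ‖w r‖ ^ 2 ≤ 2 * (landauState B k r ^ 2 * ‖p‖ ^ 2)
        + 2 * ‖w r - landauState B k r • p‖ ^ 2 := by
      have h1 : ‖w r‖ ≤ ‖landauState B k r • p‖ + ‖w r - landauState B k r • p‖ := by
        simpa using norm_add_le (landauState B k r • p) (w r - landauState B k r • p)
      have h2 : ‖landauState B k r • p‖ ^ 2 = landauState B k r ^ 2 * ‖p‖ ^ 2 := by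
        rw [norm_smul, mul_pow, Real.norm_eq_abs, sq_abs]
      rw [← h2]
      nlinarith [norm_nonneg (w r), sq_nonneg (‖landauState B k r • p‖
        - ‖w r - landauState B k r • p‖)]
    calc -(r * (effectivePotential B g k r * ‖w r‖ ^ 2))
        = r * (-effectivePotential B g k r * ‖w r‖ ^ 2) := by ring
      _ ≤ r * (V * ‖w r‖ ^ 2) := by gcongr
      _ ≤ r * (V * (2 * (landauState B k r ^ 2 * ‖p‖ ^ 2)
        + 2 * ‖w r - landauState B k r • p‖ ^ 2)) := by gcongr
      _ = 2 * ‖p‖ ^ 2 * (V * (landauState B k r ^ 2 * r))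
        + 2 * (r * (V * ‖w r - landauState B k r • p‖ ^ 2)) := by ring
      _ ≤ 2 * ‖p‖ ^ 2 * (V * (landauState B k r ^ 2 * r))
        + 2 * (r * (B * ‖w r - landauState B k r • p‖ ^ 2)) := by gcongr
      _ = _ := by ring
  rw [integral_neg, integral_add (hEi.const_mul _) (hqi.const_mul _), integral_const_mul,
    integral_const_mul, ← effectiveExpectation_eq] at hneg
  obtain ⟨c, hc⟩ := h.exists_gap hB
  have hproj := h.integral_norm_sub_le hB c
  rw [← hp] at hproj
  have : 2 * B * ∫ r in Ioi (0 : ℝ), r * ‖w r - landauState B k r • p‖ ^ 2 ≤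
      2 * B * ∫ r in Ioi (0 : ℝ), r * ‖w r - landauState B k r • c‖ ^ 2 := by gcongr
  rw [htot]
  linarith

/-- In the sectors of the opposite angular momentum the radial Hamiltonian is at least `B`:
since the flux is at most `1 ≤ 2 * k`, the centrifugal term dominates the one of the sector
`k` in the constant field. -/
theorem opposite_sector_bound (h : IsRadialProfile k R w w') (hg : IsAdmissibleFlux B g)
    (hB : 0 < B) (hk : k ≠ 0) :
    IntegrableOn (fun r => r * (‖w' r‖ ^ 2 + (k / r + circularPotential B g r) ^ 2 * ‖w r‖ ^ 2))
      (Ioi 0) ∧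
    B * ∫ r in Ioi (0 : ℝ), r * ‖w r‖ ^ 2 ≤
      ∫ r in Ioi (0 : ℝ), r * (‖w' r‖ ^ 2 + (k / r + circularPotential B g r) ^ 2 * ‖w r‖ ^ 2) := by
  obtain ⟨hGi, hG0⟩ := h.integral_deriv_eq_zero B
  have hni := h.integrableOn_norm_sq
  have hci : IntegrableOn (fun r => r * ((4 * k / r * circularPotential B g r) * ‖w r‖ ^ 2))
      (Ioi 0) := by
    refine h.integrableOn_mul_norm_sq (C := 2 * k * B) ?_ fun r hr => ?_
    · exact (continuousOn_const.div continuousOn_id fun r hr => (ne_of_gt hr)).mul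
        hg.continuousOn_circularPotential
    · have h1 := hg.nonneg r hr
      have h2 := hg.le_sq r hr
      have e : 4 * k / r * circularPotential B g r
          = 4 * k * (B / 2 - (∫ s in (0 : ℝ)..r, g s * s) / r ^ 2) := by
        unfold circularPotential
        field_simp
      have h3 : (∫ s in (0 : ℝ)..r, g s * s) / r ^ 2 ≤ B / 2 := by
        rw [div_le_iff₀ (by positivity)]; linarith
      have h4 : 0 ≤ (∫ s in (0 : ℝ)..r, g s * s) / r ^ 2 := by positivity
      rw [e, abs_of_nonneg (mul_nonneg (by positivity) (by linarith))]
      have : (4 : ℝ) * k * (B / 2 - (∫ s in (0 : ℝ)..r, g s * s) / r ^ 2) ≤ 4 * k * (B / 2) := by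
        gcongr; linarith
      linarith
  have hi : IntegrableOn (fun r => r * (‖w' r‖ ^ 2
      + (k / r + circularPotential B g r) ^ 2 * ‖w r‖ ^ 2)) (Ioi 0) := by
    refine (Integrable.add (h.sector_bound hg hB).1 hci).congr (Eventually.of_forall fun r => ?_)
    simp only [Pi.add_apply]
    ring
  refine ⟨hi, ?_⟩
  have hle : ∫ r in Ioi (0 : ℝ), (B * (r * ‖w r‖ ^ 2)
      + (2 * inner ℝ (w r) (w' r) * (k - B * r ^ 2 / 2) - ‖w r‖ ^ 2 * (B * r))) ≤
      ∫ r in Ioi (0 : ℝ),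
        r * (‖w' r‖ ^ 2 + (k / r + circularPotential B g r) ^ 2 * ‖w r‖ ^ 2) := by
    refine setIntegral_mono_on ((hni.const_mul B).add hGi) hi measurableSet_Ioi fun r hr => ?_
    have hr' : (0 : ℝ) < r := hr
    have hk1 : (1 : ℝ) ≤ k := by exact_mod_cast Nat.one_le_iff_ne_zero.2 hk
    have hsq : (k / r - B * r / 2) ^ 2 ≤ (k / r + circularPotential B g r) ^ 2 := by
      have e : (k / r + circularPotential B g r) ^ 2 - (k / r - B * r / 2) ^ 2 =
          (2 * k - ∫ s in (0 : ℝ)..r, g s * s)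
            * (B * r ^ 2 / 2 - (∫ s in (0 : ℝ)..r, g s * s) + B * r ^ 2 / 2) / r ^ 2 := by
        unfold circularPotential
        field_simp
        ring
      have h1 := hg.le_one r hr'
      have h2 := hg.le_sq r hr'
      have h3 : 0 ≤ (k / r + circularPotential B g r) ^ 2 - (k / r - B * r / 2) ^ 2 := by
        rw [e]
        refine div_nonneg (mul_nonneg (by linarith) ?_) (by positivity)
        have : 0 ≤ B * r ^ 2 / 2 := by positivity
        linarith
      linarith
    have hD : 0 ≤ r * ‖radialAnnihilation B k w w' r‖ ^ 2 := by positivity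
    have e : r * ‖radialAnnihilation B k w w' r‖ ^ 2 = r * ‖w' r‖ ^ 2
        + r * ((k / r - B * r / 2) ^ 2 * ‖w r‖ ^ 2)
        - 2 * inner ℝ (w r) (w' r) * (k - B * r ^ 2 / 2) := by
      rw [radialAnnihilation, norm_sub_sq_real, inner_smul_right, norm_smul, mul_pow,
        Real.norm_eq_abs, sq_abs, real_inner_comm]
      field_simp
      ring
    have h4 : r * ((k / r - B * r / 2) ^ 2 * ‖w r‖ ^ 2)
        ≤ r * ((k / r + circularPotential B g r) ^ 2 * ‖w r‖ ^ 2) := by gcongr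
    rw [mul_add]
    linarith
  rw [integral_add (hni.const_mul B) hGi, hG0, add_zero, integral_const_mul] at hle
  exact hle

end IsRadialProfile
end RadialSectors

/-! ### Integrals of radial functions along lines -/

section Lines

/-- The substitution `r = √(t² + y²)`, with `t dt = r dr`. -/
theorem lintegral_Ioi_comp_sqrt_le (u : ℝ → ℝ≥0∞) (y : ℝ) :
    ∫⁻ t in Ioi (0 : ℝ), ENNReal.ofReal t * u (Real.sqrt (t ^ 2 + y ^ 2)) ≤
      ∫⁻ r in Ioi (0 : ℝ), ENNReal.ofReal r * u r := by
  have hpos : ∀ t ∈ Ioi (0 : ℝ), 0 < t ^ 2 + y ^ 2 := fun t ht => by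
    have : (0 : ℝ) < t := ht
    positivity
  have hd : ∀ t ∈ Ioi (0 : ℝ), HasDerivWithinAt (fun t => Real.sqrt (t ^ 2 + y ^ 2))
      (t / Real.sqrt (t ^ 2 + y ^ 2)) (Ioi 0) t := by
    intro t ht
    have h1 : HasDerivAt (fun t : ℝ => t ^ 2 + y ^ 2) (2 * t) t :=
      ((hasDerivAt_pow 2 t).add_const _).congr_deriv (by simp)
    refine ((h1.sqrt (hpos t ht).ne').congr_deriv ?_).hasDerivWithinAt
    rw [mul_div_mul_left _ _ two_ne_zero]
  have hm : MonotoneOn (fun t => Real.sqrt (t ^ 2 + y ^ 2)) (Ioi 0) := by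
    intro s hs t ht hst
    have : (0 : ℝ) < s := hs
    exact Real.sqrt_le_sqrt (by gcongr)
  have key := lintegral_image_eq_lintegral_deriv_mul_of_monotoneOn measurableSet_Ioi hd hm
    (fun r => ENNReal.ofReal r * u r)
  have hsub : (fun t => Real.sqrt (t ^ 2 + y ^ 2)) '' Ioi 0 ⊆ Ioi 0 := by
    rintro _ ⟨t, ht, rfl⟩
    exact Real.sqrt_pos.2 (hpos t ht)
  refine le_trans (le_of_eq ?_) (lintegral_mono_set hsub)
  rw [key]
  refine setLIntegral_congr_fun measurableSet_Ioi fun t ht => ?_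
  have h1 : 0 < Real.sqrt (t ^ 2 + y ^ 2) := Real.sqrt_pos.2 (hpos t ht)
  have h2 : (0 : ℝ) < t := ht
  rw [← mul_assoc, ← ENNReal.ofReal_mul (by positivity), div_mul_cancel₀ _ h1.ne']

theorem lintegral_eq_two_mul_of_even {F : ℝ → ℝ≥0∞} (h : ∀ t, F (-t) = F t) :
    ∫⁻ t, F t = 2 * ∫⁻ t in Ioi (0 : ℝ), F t := by
  have h1 : ∫⁻ t in Iic (0 : ℝ), F t = ∫⁻ t in Ioi (0 : ℝ), F t := by
    have := (Measure.measurePreserving_neg (volume : Measure ℝ)).setLIntegral_comp_preimage_emb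
      (MeasurableEquiv.neg ℝ).measurableEmbedding F (Iic 0)
    rw [← this]
    have hpre : (Neg.neg : ℝ → ℝ) ⁻¹' Iic 0 = Ici 0 := by ext; simp
    rw [hpre, setLIntegral_congr Ioi_ae_eq_Ici.symm]
    simp only [h]
  rw [← lintegral_add_compl F measurableSet_Iic, compl_Iic, h1, two_mul]

/-- Along every line, a bounded radial function has small integral if it is small in
`L¹(r dr)`, uniformly in the line. -/
theorem lintegral_comp_sqrt_le {d : ℝ → ℝ} (hd : Measurable d) {M : ℝ} (hM : ∀ r, |d r| ≤ M)
    {δ : ℝ} (hδ : 0 < δ) (y : ℝ) :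
    ∫⁻ t, ‖d (Real.sqrt (t ^ 2 + y ^ 2))‖ₑ ≤ 2 * (ENNReal.ofReal (M * δ) +
      ENNReal.ofReal δ⁻¹ * ∫⁻ r in Ioi (0 : ℝ), ENNReal.ofReal r * ‖d r‖ₑ) := by
  rw [lintegral_eq_two_mul_of_even (by intro t; rw [neg_sq])]
  gcongr
  have hle : ∀ t ∈ Ioi (0 : ℝ), ‖d (Real.sqrt (t ^ 2 + y ^ 2))‖ₑ ≤
      (Ioc 0 δ).indicator (fun _ => ENNReal.ofReal M) t
        + ENNReal.ofReal δ⁻¹ * (ENNReal.ofReal t * ‖d (Real.sqrt (t ^ 2 + y ^ 2))‖ₑ) := by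
    intro t ht
    by_cases h : t ≤ δ
    · rw [indicator_of_mem (show t ∈ Ioc 0 δ from ⟨ht, h⟩)]
      refine le_add_right ?_
      rw [← ofReal_norm]
      exact ENNReal.ofReal_le_ofReal (hM _)
    · refine le_add_left ?_
      rw [← mul_assoc, ← ENNReal.ofReal_mul (by positivity)]
      refine le_mul_of_one_le_left (zero_le) ?_
      rw [ENNReal.one_le_ofReal, inv_mul_eq_div, one_le_div hδ]
      exact (not_le.1 h).le
  refine (setLIntegral_mono' measurableSet_Ioi hle).trans ?_
  rw [lintegral_add_left (measurable_const.indicator measurableSet_Ioc)]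
  gcongr
  · rw [lintegral_indicator_const measurableSet_Ioc]
    refine (mul_le_mul_right (Measure.restrict_apply_le _ _) _).trans ?_
    rw [Real.volume_Ioc, sub_zero, ENNReal.ofReal_mul ((abs_nonneg _).trans (hM 0))]
  · rw [lintegral_const_mul _ (by fun_prop)]
    refine mul_le_mul_right ?_ _
    exact lintegral_Ioi_comp_sqrt_le (fun r => ‖d r‖ₑ) y

/-- A bounded nonnegative field profile with finite flux. -/
structure IsFieldProfile (B : ℝ) (g : ℝ → ℝ) : Prop where
  measurable : Measurable g
  nonneg : ∀ r, 0 ≤ g r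
  le : ∀ r, g r ≤ B
  integrableOn : IntegrableOn (fun r => g r * r) (Ioi 0)

variable {B : ℝ} {g h : ℝ → ℝ}

namespace IsFieldProfile

theorem lintegral_ne_top (hg : IsFieldProfile B g) :
    ∫⁻ r in Ioi (0 : ℝ), ENNReal.ofReal r * ‖g r‖ₑ ≠ ⊤ := by
  have := hg.integrableOn.2
  rw [hasFiniteIntegral_iff_enorm] at this
  refine ne_of_lt (lt_of_le_of_lt (le_of_eq ?_) this)
  refine setLIntegral_congr_fun measurableSet_Ioi fun r hr => ?_
  have : (0 : ℝ) < r := hr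
  simp only [enorm_mul]
  rw [mul_comm, Real.enorm_of_nonneg this.le]

theorem abs_sub_le (hg : IsFieldProfile B g) (hh : IsFieldProfile B h) (r : ℝ) :
    |g r - h r| ≤ B := by
  rw [abs_le]
  constructor <;> linarith [hg.nonneg r, hh.nonneg r, hg.le r, hh.le r]

theorem integrable_comp_sqrt (hg : IsFieldProfile B g) (y : ℝ) :
    Integrable fun t => g (Real.sqrt (t ^ 2 + y ^ 2)) := by
  have hm := hg.measurable
  refine ⟨(by fun_prop : Measurable _).aestronglyMeasurable, ?_⟩
  rw [hasFiniteIntegral_iff_enorm]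
  refine (lintegral_comp_sqrt_le hm (M := B) (fun r => ?_) one_pos y).trans_lt ?_
  · rw [abs_of_nonneg (hg.nonneg r)]; exact hg.le r
  · refine ENNReal.mul_lt_top (by simp) (ENNReal.add_lt_top.2 ⟨by simp, ?_⟩)
    exact ENNReal.mul_lt_top (by simp) hg.lintegral_ne_top.lt_top

/-- A field profile is approximated in `L¹(r dr)` by continuous profiles with compact support. -/
theorem exists_approx (hg : IsFieldProfile B g) (hB : 0 ≤ B) {ε : ℝ≥0∞} (hε : ε ≠ 0) :
    ∃ h : ℝ → ℝ, Continuous h ∧ HasCompactSupport h ∧ IsFieldProfile B h ∧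
      ∫⁻ r in Ioi (0 : ℝ), ENNReal.ofReal r * ‖g r - h r‖ₑ ≤ ε := by
  let μ := (volume.restrict (Ioi (0 : ℝ))).withDensity (fun r => ENNReal.ofReal r)
  have : IsLocallyFiniteMeasure μ := IsLocallyFiniteMeasure.withDensity_ofReal
    (μ := volume.restrict (Ioi (0 : ℝ))) (f := fun r => r) continuous_id
  have hgμ : Integrable g μ := by
    rw [integrable_withDensity_iff (by fun_prop) (by simp)]
    refine hg.integrableOn.congr ?_
    filter_upwards [ae_restrict_mem measurableSet_Ioi] with r hr
    rw [ENNReal.toReal_ofReal (le_of_lt hr)]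
  obtain ⟨h₀, hc, hle, hcont, -⟩ := hgμ.exists_hasCompactSupport_lintegral_sub_le hε
  let h : ℝ → ℝ := fun r => max 0 (min (h₀ r) B)
  have hhc : Continuous h := continuous_const.max (hcont.min continuous_const)
  have hhs : HasCompactSupport h := by
    have := hc.comp_left (g := fun x : ℝ => max 0 (min x B)) (by simp [hB])
    exact this
  refine ⟨h, hhc, hhs, ⟨hhc.measurable, fun r => le_max_left _ _, fun r =>
    max_le hB (min_le_right _ _), ?_⟩, ?_⟩
  · exact ((hhc.mul continuous_id).integrable_of_hasCompactSupport hhs.mul_right).integrableOn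
  · have h2 : Measurable fun r => ‖g r - h₀ r‖ₑ := by
      have := hg.measurable
      have := hcont.measurable
      fun_prop
    rw [lintegral_withDensity_eq_lintegral_mul _ (by fun_prop) h2] at hle
    refine le_trans (lintegral_mono fun r => ?_) hle
    simp only [Pi.mul_apply]
    gcongr
    refine enorm_le_iff_norm_le.2 ?_
    -- truncation to `[0, B]` does not increase the distance to `g r ∈ [0, B]`
    have h0 := hg.nonneg r
    have h1 := hg.le r
    simp only [h, Real.norm_eq_abs]
    rcases le_total (h₀ r) B with h3 | h3
    · rw [min_eq_left h3]
      rcases le_total 0 (h₀ r) with h4 | h4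
      · rw [max_eq_right h4]
      · rw [max_eq_left h4, sub_zero, abs_of_nonneg h0, abs_of_nonneg (by linarith)]
        linarith
    · rw [min_eq_right h3, max_eq_right hB, abs_of_nonpos (by linarith),
        abs_of_nonpos (by linarith)]
      linarith

/-- Approximation of a field profile by continuous ones: in `L¹(r dr)`, and uniformly for the
integrals along lines. -/
theorem exists_seq (hg : IsFieldProfile B g) (hB : 0 < B) :
    ∃ h : ℕ → ℝ → ℝ, (∀ n, Continuous (h n)) ∧ (∀ n, HasCompactSupport (h n)) ∧
      (∀ n, IsFieldProfile B (h n)) ∧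
      Tendsto (fun n => ∫⁻ r in Ioi (0 : ℝ), ENNReal.ofReal r * ‖g r - h n r‖ₑ) atTop (𝓝 0) ∧
      ∀ ε > 0, ∀ᶠ n in atTop, ∀ y : ℝ,
        ∫ t, |g (Real.sqrt (t ^ 2 + y ^ 2)) - h n (Real.sqrt (t ^ 2 + y ^ 2))| ≤ ε := by
  have h1 : ∀ n : ℕ, ((n : ℝ≥0∞) + 1)⁻¹ ≠ 0 := fun n => by simp
  choose h hc hs hp hle using fun n : ℕ => hg.exists_approx hB.le (h1 n)
  have hlim : Tendsto (fun n => ∫⁻ r in Ioi (0 : ℝ), ENNReal.ofReal r * ‖g r - h n r‖ₑ) atTop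
      (𝓝 0) := by
    have h2 : Tendsto (fun n : ℕ => ((n : ℝ≥0∞) + 1)⁻¹) atTop (𝓝 0) := by
      have := (tendsto_add_atTop_iff_nat 1).2 ENNReal.tendsto_inv_nat_nhds_zero
      simpa using this
    exact tendsto_of_tendsto_of_tendsto_of_le_of_le tendsto_const_nhds h2 (fun _ => zero_le) hle
  refine ⟨h, hc, hs, hp, hlim, fun ε hε => ?_⟩
  let δ := ε / (4 * B)
  have hδ : 0 < δ := by positivity
  have hlt : Tendsto (fun n => 2 * (ENNReal.ofReal (B * δ) + ENNReal.ofReal δ⁻¹ *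
      ∫⁻ r in Ioi (0 : ℝ), ENNReal.ofReal r * ‖g r - h n r‖ₑ)) atTop
      (𝓝 (2 * (ENNReal.ofReal (B * δ) + ENNReal.ofReal δ⁻¹ * 0))) :=
    ENNReal.Tendsto.const_mul (tendsto_const_nhds.add
      (ENNReal.Tendsto.const_mul hlim (Or.inr ENNReal.ofReal_ne_top))) (Or.inr (by simp))
  have hval : 2 * (ENNReal.ofReal (B * δ) + ENNReal.ofReal δ⁻¹ * 0) < ENNReal.ofReal ε := by
    rw [mul_zero, add_zero]
    have : (2 : ℝ≥0∞) = ENNReal.ofReal 2 := by norm_num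
    rw [this, ← ENNReal.ofReal_mul (by norm_num)]
    refine (ENNReal.ofReal_lt_ofReal_iff hε).2 ?_
    have : 2 * (B * δ) = ε / 2 := by simp only [δ]; field_simp; norm_num
    linarith
  filter_upwards [hlt.eventually (gt_mem_nhds hval)] with n hn y
  have hm := hg.measurable
  have hm' := (hc n).measurable
  have hb := lintegral_comp_sqrt_le (hm.sub hm') (M := B) (hg.abs_sub_le (hp n)) hδ y
  have h3 := hb.trans hn.le
  have hi : Integrable fun t =>
      |g (Real.sqrt (t ^ 2 + y ^ 2)) - h n (Real.sqrt (t ^ 2 + y ^ 2))| :=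
    ((hg.integrable_comp_sqrt y).sub ((hp n).integrable_comp_sqrt y)).abs
  rw [integral_eq_lintegral_of_nonneg_ae (Eventually.of_forall fun t => abs_nonneg _)
    hi.aestronglyMeasurable]
  refine ENNReal.toReal_le_of_le_ofReal hε.le (le_trans (le_of_eq ?_) h3)
  refine lintegral_congr fun t => ?_
  simp only [Pi.sub_apply]
  rw [← ofReal_norm, Real.norm_eq_abs]

theorem gaugeFun_sub (hg : IsFieldProfile B g) (x₁ x₂ y : ℝ) :
    gaugeFun g (x₂, y) - gaugeFun g (x₁, y) =
      ∫ t in x₁..x₂, g (Real.sqrt (t ^ 2 + y ^ 2)) := by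
  have hi := hg.integrable_comp_sqrt y
  have := intervalIntegral.integral_interval_add_Ioi (a := x₁) (b := x₂) hi.integrableOn
    hi.integrableOn
  simp only [gaugeFun]
  linarith

theorem continuous_gaugeFun_of_continuous (hg : IsFieldProfile B g) (hc : Continuous g)
    (hs : HasCompactSupport g) : Continuous (gaugeFun g) := by
  obtain ⟨L, hL⟩ := hs.isCompact.isBounded.subset_closedBall 0
  have h0 : ∀ r, L < r → g r = 0 := fun r hr => by
    by_contra hne
    have := hL (subset_tsupport _ hne)
    rw [mem_closedBall_zero_iff, Real.norm_eq_abs] at this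
    linarith [le_abs_self r]
  have hL0 : ∀ y, gaugeFun g (L, y) = 0 := by
    intro y
    simp only [gaugeFun, neg_eq_zero]
    refine setIntegral_eq_zero_of_forall_eq_zero fun t ht => h0 _ ?_
    refine lt_of_lt_of_le (lt_of_lt_of_le ht (le_abs_self t)) ?_
    rw [← Real.sqrt_sq_eq_abs]
    exact Real.sqrt_le_sqrt (by nlinarith)
  have heq : gaugeFun g = fun z : ℝ × ℝ => ∫ t in L..z.1, g (Real.sqrt (t ^ 2 + z.2 ^ 2)) := by
    ext ⟨x, y⟩
    rw [← hg.gaugeFun_sub, hL0, sub_zero]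
  rw [heq]
  exact intervalIntegral.continuous_parametric_intervalIntegral_of_continuous
    (f := fun (z : ℝ × ℝ) t => g (Real.sqrt (t ^ 2 + z.2 ^ 2)))
    (by unfold Function.uncurry; fun_prop) continuous_fst

theorem continuous_gaugeFun (hg : IsFieldProfile B g) (hB : 0 < B) : Continuous (gaugeFun g) := by
  obtain ⟨h, hc, hs, hp, -, hunif⟩ := hg.exists_seq hB
  refine continuous_of_uniform_approx_of_continuous fun u hu => ?_
  obtain ⟨ε, hε, hεu⟩ := Metric.mem_uniformity_dist.1 hu
  obtain ⟨n, hn⟩ := (hunif (ε / 2) (half_pos hε)).exists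
  refine ⟨gaugeFun (h n), (hp n).continuous_gaugeFun_of_continuous (hc n) (hs n),
    fun z => hεu ?_⟩
  have hi := hg.integrable_comp_sqrt z.2
  have hi' := (hp n).integrable_comp_sqrt z.2
  have : gaugeFun g z - gaugeFun (h n) z = -∫ t in Ioi z.1,
      (g (Real.sqrt (t ^ 2 + z.2 ^ 2)) - h n (Real.sqrt (t ^ 2 + z.2 ^ 2))) := by
    rw [integral_sub hi.integrableOn hi'.integrableOn]
    simp only [gaugeFun]
    ring
  rw [Real.dist_eq, this, abs_neg]
  refine (abs_integral_le_integral_abs.trans ?_).trans_lt ((hn z.2).trans_lt (half_lt_self hε))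
  exact setIntegral_le_integral (hi.sub hi').abs (Eventually.of_forall fun _ => abs_nonneg _)

end IsFieldProfile
end Lines

/-! ### Flux and the gauge transformation -/

section Gauge

/-- The flux `Φ(r) = ∫_0^r g(s) s ds` through the disc of radius `r`, up to the factor `2π`. -/
def fluxFun (g : ℝ → ℝ) (r : ℝ) : ℝ := ∫ s in (0 : ℝ)..r, g s * s

/-- The first component of the radial vector field `Φ(|z|) z / |z|²` at `z = (u, v)`, whose
divergence is `g(|z|)`. The second component is obtained by exchanging the coordinates. -/
def radialField (g : ℝ → ℝ) (u v : ℝ) : ℝ :=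
  fluxFun g (Real.sqrt (u ^ 2 + v ^ 2)) / (u ^ 2 + v ^ 2) * u

variable {B : ℝ} {g h : ℝ → ℝ}

namespace IsFieldProfile

theorem intervalIntegrable (hg : IsFieldProfile B g) (a b : ℝ) :
    IntervalIntegrable (fun s => g s * s) volume a b := by
  have hm := hg.measurable
  have hb : IntervalIntegrable (fun s => B * |s|) volume a b :=
    (continuous_const.mul continuous_abs).intervalIntegrable a b
  refine hb.mono_fun' (by fun_prop : Measurable _).aestronglyMeasurable
    (Eventually.of_forall fun s => ?_)
  simp only [norm_mul, Real.norm_of_nonneg (hg.nonneg s), Real.norm_eq_abs]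
  exact mul_le_mul_of_nonneg_right (hg.le s) (abs_nonneg s)

theorem continuous_fluxFun (hg : IsFieldProfile B g) : Continuous (fluxFun g) :=
  intervalIntegral.continuous_primitive (fun a b => hg.intervalIntegrable a b) 0

theorem fluxFun_nonneg (hg : IsFieldProfile B g) {r : ℝ} (hr : 0 ≤ r) : 0 ≤ fluxFun g r :=
  intervalIntegral.integral_nonneg hr fun s hs => mul_nonneg (hg.nonneg s) hs.1

theorem fluxFun_le (hg : IsFieldProfile B g) {r : ℝ} (hr : 0 ≤ r) :
    fluxFun g r ≤ B * r ^ 2 / 2 := by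
  have h1 : ∫ s in (0 : ℝ)..r, B * s = B * r ^ 2 / 2 := by
    rw [intervalIntegral.integral_const_mul, integral_id]; ring
  rw [← h1]
  exact intervalIntegral.integral_mono_on hr (hg.intervalIntegrable 0 r)
    ((continuous_const.mul continuous_id).intervalIntegrable 0 r)
    fun s hs => mul_le_mul_of_nonneg_right (hg.le s) hs.1

theorem isAdmissibleFlux (hg : IsFieldProfile B g) (hflux : ∫ r in Ioi (0 : ℝ), g r * r ≤ 1) :
    IsAdmissibleFlux B g where
  continuous := hg.continuous_fluxFun.continuousOn
  nonneg _ hr := hg.fluxFun_nonneg hr.le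
  le_sq _ hr := hg.fluxFun_le hr.le
  le_one r hr := by
    refine le_trans ?_ hflux
    rw [intervalIntegral.integral_of_le hr.le]
    refine setIntegral_mono_set hg.integrableOn ?_ Ioc_subset_Ioi_self.eventuallyLE
    filter_upwards [ae_restrict_mem measurableSet_Ioi] with s hs
    exact mul_nonneg (hg.nonneg s) (le_of_lt hs)

theorem abs_fluxFun_sub_le (hg : IsFieldProfile B g) (hh : IsFieldProfile B h) {r : ℝ}
    (hr : 0 ≤ r) : ENNReal.ofReal |fluxFun g r - fluxFun h r| ≤
      ∫⁻ r in Ioi (0 : ℝ), ENNReal.ofReal r * ‖g r - h r‖ₑ := by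
  rw [fluxFun, fluxFun, ← intervalIntegral.integral_sub (hg.intervalIntegrable 0 r)
    (hh.intervalIntegrable 0 r), intervalIntegral.integral_of_le hr, ← Real.norm_eq_abs,
    ofReal_norm]
  refine (enorm_integral_le_lintegral_enorm _).trans ?_
  refine (lintegral_mono_set Ioc_subset_Ioi_self).trans (le_of_eq ?_)
  refine setLIntegral_congr_fun measurableSet_Ioi fun s hs => ?_
  rw [← sub_mul, enorm_mul, mul_comm, Real.enorm_of_nonneg (le_of_lt hs)]

theorem abs_radialField_le (hg : IsFieldProfile B g) (u v : ℝ) :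
    |radialField g u v| ≤ B / 2 * |u| := by
  have h0 : 0 ≤ u ^ 2 + v ^ 2 := by positivity
  have h1 := hg.fluxFun_nonneg (Real.sqrt_nonneg (u ^ 2 + v ^ 2))
  have h2 := hg.fluxFun_le (Real.sqrt_nonneg (u ^ 2 + v ^ 2))
  rw [Real.sq_sqrt h0] at h2
  rw [radialField, abs_mul, abs_of_nonneg (by positivity)]
  refine mul_le_mul_of_nonneg_right ?_ (abs_nonneg u)
  rcases h0.eq_or_lt with h | h
  · rw [← h, div_zero]
    linarith [(hg.nonneg 0).trans (hg.le 0)]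
  · rw [div_le_iff₀ h]; linarith

theorem continuous_radialField (hg : IsFieldProfile B g) :
    Continuous fun z : ℝ × ℝ => radialField g z.1 z.2 := by
  rw [continuous_iff_continuousAt]
  intro z
  have hc := hg.continuous_fluxFun
  by_cases hz : z.1 ^ 2 + z.2 ^ 2 = 0
  · have hz1 : z.1 = 0 := by nlinarith [sq_nonneg z.1, sq_nonneg z.2]
    have h0 : radialField g z.1 z.2 = 0 := by rw [radialField, hz1, mul_zero]
    rw [ContinuousAt, h0]
    refine squeeze_zero_norm (fun y => hg.abs_radialField_le y.1 y.2) ?_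
    have : ContinuousAt (fun y : ℝ × ℝ => B / 2 * |y.1|) z := by fun_prop
    simpa [ContinuousAt, hz1] using this
  · unfold radialField
    refine ContinuousAt.mul (ContinuousAt.div ?_ ?_ hz) continuousAt_fst
    · exact (by fun_prop : Continuous fun z : ℝ × ℝ =>
        fluxFun g (Real.sqrt (z.1 ^ 2 + z.2 ^ 2))).continuousAt
    · exact (by fun_prop : Continuous fun z : ℝ × ℝ => z.1 ^ 2 + z.2 ^ 2).continuousAt

theorem continuous_radialField_comp (hg : IsFieldProfile B g) {Y : Type*} [TopologicalSpace Y]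
    {u v : Y → ℝ} (hu : Continuous u) (hv : Continuous v) :
    Continuous fun y => radialField g (u y) (v y) := by
  have h := hg.continuous_radialField.comp (hu.prodMk hv)
  simpa only [Function.comp_def] using h

/-- The divergence theorem for `Φ(|z|) z / |z|²` on rectangles, for continuous `g`. -/
theorem integral_rectangle_of_continuous (hg : IsFieldProfile B g) (hc : Continuous g)
    (a₁ a₂ b₁ b₂ : ℝ) :
    ∫ u in a₁..a₂, ∫ v in b₁..b₂, g (Real.sqrt (u ^ 2 + v ^ 2)) =
      (∫ u in a₁..a₂, (radialField g b₂ u - radialField g b₁ u))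
        + ∫ v in b₁..b₂, (radialField g a₂ v - radialField g a₁ v) := by
  have hN := hg.continuous_radialField
  have hN' : Continuous fun z : ℝ × ℝ => radialField g z.2 z.1 :=
    hg.continuous_radialField_comp continuous_snd continuous_fst
  let S : ℝ → ℝ := fun ρ => fluxFun g (Real.sqrt ρ) / ρ
  let S' : ℝ → ℝ := fun ρ => (g (Real.sqrt ρ) / 2 * ρ - fluxFun g (Real.sqrt ρ)) / ρ ^ 2
  have hS : ∀ ρ, 0 < ρ → HasDerivAt S (S' ρ) ρ := by
    intro ρ hρ
    have hsq : 0 < Real.sqrt ρ := Real.sqrt_pos.2 hρ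
    have h1 : HasDerivAt (fluxFun g) (g (Real.sqrt ρ) * Real.sqrt ρ) (Real.sqrt ρ) :=
      intervalIntegral.integral_hasDerivAt_right (hg.intervalIntegrable _ _)
        (Continuous.stronglyMeasurableAtFilter (by fun_prop) _ _)
        (Continuous.continuousAt (by fun_prop))
    have h2 := (h1.comp ρ (Real.hasDerivAt_sqrt hρ.ne')).div (hasDerivAt_id ρ) hρ.ne'
    refine h2.congr_deriv ?_
    simp only [S', Function.comp, id]
    field_simp
  let fst := ContinuousLinearMap.fst ℝ ℝ ℝ
  let snd := ContinuousLinearMap.snd ℝ ℝ ℝ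
  let ρ : ℝ × ℝ → ℝ := fun z => z.1 ^ 2 + z.2 ^ 2
  have hρ : ∀ z, HasFDerivAt ρ ((2 * z.1) • fst + (2 * z.2) • snd) z := by
    intro z
    have h1 := ((hasFDerivAt_fst (𝕜 := ℝ) (p := z)).pow 2).add
      ((hasFDerivAt_snd (𝕜 := ℝ) (p := z)).pow 2)
    refine h1.congr_fderiv ?_
    ext <;> simp [fst, snd]
  have hρpos : ∀ z : ℝ × ℝ, z ≠ 0 → 0 < ρ z := by
    intro z hz
    by_contra! hle
    simp only [ρ] at hle
    have h1 : z.1 ^ 2 = 0 := by nlinarith [sq_nonneg z.1, sq_nonneg z.2]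
    have h2 : z.2 ^ 2 = 0 := by nlinarith [sq_nonneg z.1, sq_nonneg z.2]
    exact hz (Prod.ext (pow_eq_zero_iff two_ne_zero |>.1 h1) (pow_eq_zero_iff two_ne_zero |>.1 h2))
  let f' : ℝ × ℝ → ℝ × ℝ →L[ℝ] ℝ := fun z => if z = 0 then g 0 • fst else
    S (ρ z) • fst + z.1 • (S' (ρ z) • ((2 * z.1) • fst + (2 * z.2) • snd))
  let g' : ℝ × ℝ → ℝ × ℝ →L[ℝ] ℝ := fun z => if z = 0 then 0 else
    S (ρ z) • snd + z.2 • (S' (ρ z) • ((2 * z.1) • fst + (2 * z.2) • snd))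
  have hf' : ∀ z : ℝ × ℝ, z ≠ 0 → HasFDerivAt (fun z => radialField g z.1 z.2) (f' z) z := by
    intro z hz
    simp only [f', if_neg hz]
    exact (((hS _ (hρpos z hz)).comp_hasFDerivAt z (hρ z)).mul hasFDerivAt_fst)
  have hg' : ∀ z : ℝ × ℝ, z ≠ 0 → HasFDerivAt (fun z => radialField g z.2 z.1) (g' z) z := by
    intro z hz
    simp only [g', if_neg hz]
    refine (((hS _ (hρpos z hz)).comp_hasFDerivAt z (hρ z)).mul
      hasFDerivAt_snd).congr_of_eventuallyEq (Eventually.of_forall fun y => ?_)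
    simp only [radialField, S, ρ, Pi.mul_apply, Function.comp, add_comm]
  have hdiv : ∀ z : ℝ × ℝ, f' z (1, 0) + g' z (0, 1) = g (Real.sqrt (z.1 ^ 2 + z.2 ^ 2)) := by
    intro z
    by_cases hz : z = 0
    · subst hz; simp [f', g', fst]
    · have hp := hρpos z hz
      simp only [f', g', if_neg hz, fst, snd, S, S']
      simp only [add_apply, smul_apply, ContinuousLinearMap.coe_fst', ContinuousLinearMap.coe_snd',
        smul_eq_mul]
      simp only [ρ] at hp ⊢
      field_simp
      ring
  have key := integral2_divergence_prod_of_hasFDerivAt_off_countable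
    (fun z : ℝ × ℝ => radialField g z.1 z.2) (fun z : ℝ × ℝ => radialField g z.2 z.1) f' g'
    a₁ b₁ a₂ b₂ {0} (countable_singleton _) hN.continuousOn hN'.continuousOn
    (fun z hz => hf' z hz.2) (fun z hz => hg' z hz.2) (by
      simp only [hdiv]
      exact (by fun_prop : Continuous fun z : ℝ × ℝ =>
        g (Real.sqrt (z.1 ^ 2 + z.2 ^ 2))).continuousOn.integrableOn_compact
        (isCompact_uIcc.prod isCompact_uIcc))
  simp only [hdiv] at key
  have c1 : ∀ b, Continuous fun u => radialField g b u := fun b =>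
    hg.continuous_radialField_comp continuous_const continuous_id
  rw [key, intervalIntegral.integral_sub ((c1 b₂).intervalIntegrable _ _)
    ((c1 b₁).intervalIntegrable _ _), intervalIntegral.integral_sub
    ((c1 a₂).intervalIntegrable _ _) ((c1 a₁).intervalIntegrable _ _)]
  ring

/-- The divergence theorem for `Φ(|z|) z / |z|²` on rectangles. For merely measurable `g` it follows
by approximation. -/
theorem integral_rectangle (hg : IsFieldProfile B g) (hB : 0 < B) (a₁ a₂ b₁ b₂ : ℝ) :
    ∫ u in a₁..a₂, ∫ v in b₁..b₂, g (Real.sqrt (u ^ 2 + v ^ 2)) =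
      (∫ u in a₁..a₂, (radialField g b₂ u - radialField g b₁ u))
        + ∫ v in b₁..b₂, (radialField g a₂ v - radialField g a₁ v) := by
  obtain ⟨h, hc, hs, hp, hlim, hunif⟩ := hg.exists_seq hB
  have hflux : ∀ r, 0 ≤ r → Tendsto (fun n => fluxFun (h n) r) atTop (𝓝 (fluxFun g r)) := by
    intro r hr
    rw [tendsto_iff_dist_tendsto_zero]
    have h1 : Tendsto (fun n => ENNReal.ofReal |fluxFun g r - fluxFun (h n) r|) atTop (𝓝 0) :=
      tendsto_of_tendsto_of_tendsto_of_le_of_le tendsto_const_nhds hlim (fun _ => zero_le)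
        fun n => hg.abs_fluxFun_sub_le (hp n) hr
    have h2 := (ENNReal.tendsto_toReal ENNReal.zero_ne_top).comp h1
    refine h2.congr fun n => ?_
    rw [Function.comp, ENNReal.toReal_ofReal (abs_nonneg _), Real.dist_eq, abs_sub_comm]
  have hfield : ∀ u v, Tendsto (fun n => radialField (h n) u v) atTop (𝓝 (radialField g u v)) :=
    fun u v => ((hflux _ (Real.sqrt_nonneg _)).div_const _).mul_const _
  have c1 : ∀ n b, Continuous fun u => radialField (h n) b u := fun n b =>
    (hp n).continuous_radialField_comp continuous_const continuous_id
  have hfield' : ∀ x y p q : ℝ, Tendsto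
      (fun n => ∫ u in x..y, (radialField (h n) p u - radialField (h n) q u)) atTop
      (𝓝 (∫ u in x..y, (radialField g p u - radialField g q u))) := by
    intro x y p q
    refine intervalIntegral.tendsto_integral_filter_of_dominated_convergence
      (fun _ => B / 2 * |p| + B / 2 * |q|)
      (Eventually.of_forall fun n => ((c1 n p).sub (c1 n q)).aestronglyMeasurable)
      (Eventually.of_forall fun n => Eventually.of_forall fun u _ => ?_)
      intervalIntegrable_const
      (Eventually.of_forall fun u _ => (hfield p u).sub (hfield q u))
    exact (norm_sub_le _ _).trans
      (add_le_add ((hp n).abs_radialField_le p u) ((hp n).abs_radialField_le q u))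
  have hinner : ∀ u, Tendsto (fun n => ∫ v in b₁..b₂, h n (Real.sqrt (u ^ 2 + v ^ 2))) atTop
      (𝓝 (∫ v in b₁..b₂, g (Real.sqrt (u ^ 2 + v ^ 2)))) := by
    intro u
    rw [Metric.tendsto_nhds]
    intro ε hε
    filter_upwards [hunif (ε / 2) (half_pos hε)] with n hn
    have hi : Integrable fun v => g (Real.sqrt (u ^ 2 + v ^ 2)) := by
      simpa only [add_comm] using hg.integrable_comp_sqrt u
    have hi' : Integrable fun v => h n (Real.sqrt (u ^ 2 + v ^ 2)) := by
      simpa only [add_comm] using (hp n).integrable_comp_sqrt u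
    rw [dist_comm, Real.dist_eq, ← intervalIntegral.integral_sub hi.intervalIntegrable
      hi'.intervalIntegrable]
    refine lt_of_le_of_lt ?_ (half_lt_self hε)
    refine le_trans ?_ (hn u)
    rw [← Real.norm_eq_abs]
    refine intervalIntegral.norm_integral_le_integral_norm_uIoc.trans ?_
    simp only [Real.norm_eq_abs, add_comm (u ^ 2)]
    refine setIntegral_le_integral ?_ (Eventually.of_forall fun _ => abs_nonneg _)
    exact ((hg.integrable_comp_sqrt u).sub ((hp n).integrable_comp_sqrt u)).abs
  have hleft : Tendsto (fun n => ∫ u in a₁..a₂, ∫ v in b₁..b₂, h n (Real.sqrt (u ^ 2 + v ^ 2)))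
      atTop (𝓝 (∫ u in a₁..a₂, ∫ v in b₁..b₂, g (Real.sqrt (u ^ 2 + v ^ 2)))) := by
    refine intervalIntegral.tendsto_integral_filter_of_dominated_convergence
      (fun _ => B * |b₂ - b₁|) (Eventually.of_forall fun n => ?_)
      (Eventually.of_forall fun n => Eventually.of_forall fun u _ => ?_)
      intervalIntegrable_const (Eventually.of_forall fun u _ => hinner u)
    · have := hc n
      exact (intervalIntegral.continuous_parametric_intervalIntegral_of_continuous'
        (f := fun u v => h n (Real.sqrt (u ^ 2 + v ^ 2)))
        (by unfold Function.uncurry; fun_prop) b₁ b₂).aestronglyMeasurable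
    · refine intervalIntegral.norm_integral_le_of_norm_le_const fun v _ => ?_
      rw [Real.norm_of_nonneg ((hp n).nonneg _)]
      exact (hp n).le _
  refine tendsto_nhds_unique hleft ?_
  simp only [fun n => (hp n).integral_rectangle_of_continuous (hc n) a₁ a₂ b₁ b₂]
  exact (hfield' a₁ a₂ b₂ b₁).add (hfield' b₁ b₂ a₂ a₁)

/-- The Landau gauge `(0, f)` of the radial field `g` and its circular gauge
`Φ(|z|) (-y, x) / |z|²` differ by a gradient: the primitive is the integral of the difference along
the two sides of a rectangle, and does not depend on their order. -/
theorem exists_gauge (hg : IsFieldProfile B g) (hB : 0 < B) :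
    ∃ η : ℝ × ℝ → ℝ, ∀ z : ℝ × ℝ, HasFDerivAt η
      (radialField g z.2 z.1 • ContinuousLinearMap.fst ℝ ℝ ℝ
        + (gaugeFun g z - radialField g z.1 z.2) • ContinuousLinearMap.snd ℝ ℝ ℝ) z := by
  have hN := hg.continuous_radialField
  have hf := hg.continuous_gaugeFun hB
  let P : ℝ → ℝ → ℝ := fun x y => radialField g y x
  let Q : ℝ → ℝ → ℝ := fun x y => gaugeFun g (x, y) - radialField g x y
  have hP : Continuous fun z : ℝ × ℝ => P z.1 z.2 :=
    hg.continuous_radialField_comp continuous_snd continuous_fst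
  have hQ : Continuous fun z : ℝ × ℝ => Q z.1 z.2 := hf.sub hN
  have hPx : ∀ y, Continuous fun x => P x y := fun y =>
    hg.continuous_radialField_comp continuous_const continuous_id
  have hQy : ∀ x, Continuous fun y => Q x y := fun x =>
    hQ.comp (continuous_const.prodMk continuous_id)
  have hrect : ∀ x y, (∫ t in (0 : ℝ)..x, P t y) + ∫ s in (0 : ℝ)..y, Q 0 s =
      (∫ t in (0 : ℝ)..x, P t 0) + ∫ s in (0 : ℝ)..y, Q x s := by
    intro x y
    have h1 := hg.integral_rectangle hB 0 y 0 x
    have h2 : ∀ s, ∫ t in (0 : ℝ)..x, g (Real.sqrt (s ^ 2 + t ^ 2)) =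
        gaugeFun g (x, s) - gaugeFun g (0, s) := fun s => by
      rw [hg.gaugeFun_sub]; simp only [add_comm]
    simp only [h2] at h1
    have h3 : ∫ s in (0 : ℝ)..y, (Q x s - Q 0 s) =
        (∫ s in (0 : ℝ)..y, (gaugeFun g (x, s) - gaugeFun g (0, s)))
          - ∫ s in (0 : ℝ)..y, (radialField g x s - radialField g 0 s) := by
      have cf : ∀ x, Continuous fun s => gaugeFun g (x, s) := fun x =>
        hf.comp (continuous_const.prodMk continuous_id)
      have cn : ∀ x, Continuous fun s => radialField g x s := fun x =>
        hg.continuous_radialField_comp continuous_const continuous_id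
      refine Eq.trans ?_ (intervalIntegral.integral_sub
        (((cf x).sub (cf 0)).intervalIntegrable _ _) (((cn x).sub (cn 0)).intervalIntegrable _ _))
      congr 1
      ext s
      simp only [Q]
      ring
    have h4 : ∫ t in (0 : ℝ)..x, (radialField g y t - radialField g 0 t) =
        (∫ t in (0 : ℝ)..x, P t y) - ∫ t in (0 : ℝ)..x, P t 0 :=
      intervalIntegral.integral_sub ((hPx y).intervalIntegrable _ _)
        ((hPx 0).intervalIntegrable _ _)
    rw [intervalIntegral.integral_sub ((hQy x).intervalIntegrable _ _)
      ((hQy 0).intervalIntegrable _ _)] at h3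
    linarith
  let η : ℝ → ℝ → ℝ := fun x y => (∫ t in (0 : ℝ)..x, P t y) + ∫ s in (0 : ℝ)..y, Q 0 s
  have hηx : ∀ x y, HasDerivAt (fun x => η x y) (P x y) x := fun x y =>
    ((hPx y).integral_hasStrictDerivAt 0 x).hasDerivAt.add_const _
  have hηy : ∀ x y, HasDerivAt (fun y => η x y) (Q x y) y := fun x y => by
    simp only [η, hrect]
    exact ((hQy x).integral_hasStrictDerivAt 0 y).hasDerivAt.const_add _
  refine ⟨fun z => η z.1 z.2, fun z => ?_⟩
  have key := hasStrictFDerivAt_uncurry_coprod (𝕜 := ℝ) (u := z) (f := η)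
    (f₁ := fun x y => ContinuousLinearMap.toSpanSingleton ℝ (P x y))
    (f₂ := fun x y => ContinuousLinearMap.toSpanSingleton ℝ (Q x y))
    (Eventually.of_forall fun v => (hηx v.1 v.2).hasFDerivAt)
    (Eventually.of_forall fun v => (hηy v.1 v.2).hasFDerivAt)
    ((ContinuousLinearMap.toSpanSingletonCLE (𝕜 := ℝ) (E := ℝ)).continuous.comp hP).continuousAt
    ((ContinuousLinearMap.toSpanSingletonCLE (𝕜 := ℝ) (E := ℝ)).continuous.comp hQ).continuousAt
  refine key.hasFDerivAt.congr_fderiv ?_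
  ext <;> simp [P, Q, Function.HasUncurry.uncurry]

end IsFieldProfile
end Gauge

/-! ### Angular Fourier coefficients -/

section Angular

/-- The Fourier coefficient `(2π)⁻¹ ∫_{-π}^π e^{-imθ} F(θ) dθ`. -/
def angCoeff (m : ℤ) (F : ℝ → ℂ) : ℂ :=
  (2 * Real.pi)⁻¹ • ∫ θ in -Real.pi..Real.pi, Complex.exp (-(m * θ * Complex.I)) * F θ

theorem neg_pi_lt_pi : -Real.pi < Real.pi := by linarith [Real.pi_pos]

theorem angCoeff_eq_fourierCoeffOn (m : ℤ) (F : ℝ → ℂ) :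
    angCoeff m F = fourierCoeffOn neg_pi_lt_pi F m := by
  have hT : Real.pi - -Real.pi = 2 * Real.pi := by ring
  rw [fourierCoeffOn_eq_integral, angCoeff, hT, one_div]
  congr 1
  refine intervalIntegral.integral_congr fun θ _ => ?_
  rw [fourier_coe_apply, smul_eq_mul]
  congr 2
  have : (Real.pi : ℂ) ≠ 0 := by exact_mod_cast Real.pi_ne_zero
  push_cast
  field_simp

/-- Parseval's identity on the circle. -/
theorem lintegral_enorm_sq_eq_tsum_angCoeff {F : ℝ → ℂ} (hF : Continuous F) :
    ∫⁻ θ in Ioo (-Real.pi) Real.pi, ‖F θ‖ₑ ^ 2 =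
      ENNReal.ofReal (2 * Real.pi) * ∑' m : ℤ, ‖angCoeff m F‖ₑ ^ 2 := by
  have hi : IntegrableOn (fun θ => ‖F θ‖ ^ 2) (Ioc (-Real.pi) Real.pi) :=
    ((hF.norm.pow 2).integrableOn_Icc).mono_set Ioc_subset_Icc_self
  have hmem : MemLp F 2 (volume.restrict (Ioc (-Real.pi) Real.pi)) :=
    (memLp_two_iff_integrable_sq_norm hF.aestronglyMeasurable).2 hi
  have hsum := hasSum_sq_fourierCoeffOn neg_pi_lt_pi hmem
  simp only [← angCoeff_eq_fourierCoeffOn] at hsum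
  have h1 : ∑' m : ℤ, ‖angCoeff m F‖ₑ ^ 2 = ENNReal.ofReal
      ((Real.pi - -Real.pi)⁻¹ • ∫ θ in -Real.pi..Real.pi, ‖F θ‖ ^ 2) := by
    rw [← hsum.tsum_eq, ENNReal.ofReal_tsum_of_nonneg (fun _ => by positivity) hsum.summable]
    simp only [ENNReal.ofReal_pow (norm_nonneg _), ofReal_norm]
  have h2 : ∫⁻ θ in Ioo (-Real.pi) Real.pi, ‖F θ‖ₑ ^ 2 =
      ENNReal.ofReal (∫ θ in -Real.pi..Real.pi, ‖F θ‖ ^ 2) := by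
    rw [intervalIntegral.integral_of_le neg_pi_lt_pi.le, ofReal_integral_eq_lintegral_ofReal hi
      (Eventually.of_forall fun _ => by positivity), setLIntegral_congr Ioo_ae_eq_Ioc]
    simp only [ENNReal.ofReal_pow (norm_nonneg _), ofReal_norm]
  have hpi := Real.pi_pos
  rw [h1, h2, ← ENNReal.ofReal_mul (by positivity)]
  congr 1
  rw [smul_eq_mul, sub_neg_eq_add, ← two_mul, mul_inv_cancel_left₀ (by positivity)]

theorem angCoeff_deriv {F F' : ℝ → ℂ} (hF : ∀ θ, HasDerivAt F (F' θ) θ) (hF' : Continuous F')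
    (hper : F Real.pi = F (-Real.pi)) (m : ℤ) :
    angCoeff m F' = m * Complex.I * angCoeff m F := by
  let e : ℝ → ℂ := fun θ => Complex.exp (-(m * θ * Complex.I))
  have he : ∀ θ, HasDerivAt e (e θ * (-(m * Complex.I))) θ := by
    intro θ
    have h1 : HasDerivAt (fun θ : ℝ => -((m : ℂ) * θ * Complex.I)) (-(m * Complex.I)) θ := by
      have := (((Complex.ofRealCLM.hasDerivAt (x := θ)).const_mul (m : ℂ)).mul_const
        Complex.I).fun_neg
      simpa using this
    exact h1.cexp
  have hec : Continuous e := continuous_iff_continuousAt.2 fun θ => (he θ).continuousAt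
  have hFc : Continuous F := continuous_iff_continuousAt.2 fun θ => (hF θ).continuousAt
  have hd : ∀ θ, HasDerivAt (fun θ => e θ * F θ)
      (e θ * (-(m * Complex.I)) * F θ + e θ * F' θ) θ := fun θ => (he θ).mul (hF θ)
  have hper' : e Real.pi = e (-Real.pi) := by
    simp only [e]
    rw [Complex.exp_eq_exp_iff_exists_int]
    exact ⟨-m, by push_cast; ring⟩
  have key := intervalIntegral.integral_eq_sub_of_hasDerivAt (a := -Real.pi) (b := Real.pi)
    (fun θ _ => hd θ) (Continuous.intervalIntegrable (by fun_prop) _ _)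
  rw [hper, hper', sub_self, intervalIntegral.integral_add
    (Continuous.intervalIntegrable (by fun_prop) _ _)
    (Continuous.intervalIntegrable (by fun_prop) _ _)] at key
  have h2 : ∫ θ in -Real.pi..Real.pi, e θ * (-(m * Complex.I)) * F θ =
      -(m * Complex.I) * ∫ θ in -Real.pi..Real.pi, e θ * F θ := by
    rw [← intervalIntegral.integral_const_mul]
    congr 1; ext θ; ring
  rw [h2, neg_mul, neg_add_eq_zero] at key
  change (2 * Real.pi)⁻¹ • (∫ θ in -Real.pi..Real.pi, e θ * F' θ) =
    m * Complex.I * ((2 * Real.pi)⁻¹ • ∫ θ in -Real.pi..Real.pi, e θ * F θ)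
  rw [← key, mul_smul_comm]

theorem angCoeff_const_mul (m : ℤ) (c : ℂ) (F : ℝ → ℂ) :
    angCoeff m (fun θ => c * F θ) = c * angCoeff m F := by
  simp only [angCoeff, mul_left_comm _ c, intervalIntegral.integral_const_mul, mul_smul_comm]

theorem angCoeff_add (m : ℤ) {F G : ℝ → ℂ} (hF : Continuous F) (hG : Continuous G) :
    angCoeff m (fun θ => F θ + G θ) = angCoeff m F + angCoeff m G := by
  simp only [angCoeff, mul_add]
  rw [intervalIntegral.integral_add (Continuous.intervalIntegrable (by fun_prop) _ _)
    (Continuous.intervalIntegrable (by fun_prop) _ _), smul_add]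

theorem angCoeff_const {m : ℤ} (hm : m ≠ 0) (c : ℂ) : angCoeff m (fun _ => c) = 0 := by
  have h := angCoeff_deriv (F := fun _ => c) (F' := fun _ => 0) (fun θ => hasDerivAt_const θ c)
    continuous_const rfl m
  have h0 : angCoeff m (fun _ => 0) = 0 := by simp [angCoeff]
  rw [h0] at h
  have hm' : (m : ℂ) * Complex.I ≠ 0 := mul_ne_zero (by exact_mod_cast hm) Complex.I_ne_zero
  exact (mul_eq_zero.1 h.symm).resolve_left hm'

/-! ### Functions of the plane in polar coordinates -/

/-- The point with polar coordinates `(r, θ)`, for `r` of either sign. -/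
def polarPt (r θ : ℝ) : ℝ × ℝ := (r * Real.cos θ, r * Real.sin θ)

@[fun_prop]
theorem Continuous.polarPt {Y : Type*} [TopologicalSpace Y] {r θ : Y → ℝ} (hr : Continuous r)
    (hθ : Continuous θ) : Continuous fun y => polarPt (r y) (θ y) := by
  unfold _root_.polarPt; fun_prop

theorem continuous_polarPt : Continuous fun p : ℝ × ℝ => polarPt p.1 p.2 := by
  unfold polarPt; fun_prop

/-- The `m`-th angular Fourier coefficient of `v` on the circle of radius `r`. -/
def radialPart (v : ℝ × ℝ → ℂ) (m : ℤ) (r : ℝ) : ℂ := angCoeff m fun θ => v (polarPt r θ)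

/-- The derivative of `radialPart`, the angular Fourier coefficient of `∂ᵣ v`. -/
def radialPartDeriv (v : ℝ × ℝ → ℂ) (m : ℤ) (r : ℝ) : ℂ :=
  angCoeff m fun θ => fderiv ℝ v (polarPt r θ) (Real.cos θ, Real.sin θ)

variable {v : ℝ × ℝ → ℂ}

theorem hasDerivAt_polarPt_left (hv : ContDiff ℝ 1 v) (r θ : ℝ) :
    HasDerivAt (fun r => v (polarPt r θ))
      (fderiv ℝ v (polarPt r θ) (Real.cos θ, Real.sin θ)) r := by
  have h1 : HasDerivAt (fun r => polarPt r θ) (Real.cos θ, Real.sin θ) r := by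
    unfold polarPt
    simpa using ((hasDerivAt_id r).mul_const (Real.cos θ)).prodMk
      ((hasDerivAt_id r).mul_const (Real.sin θ))
  exact ((hv.differentiable one_ne_zero _).hasFDerivAt).comp_hasDerivAt r h1

theorem hasDerivAt_polarPt_right (hv : ContDiff ℝ 1 v) (r θ : ℝ) :
    HasDerivAt (fun θ => v (polarPt r θ))
      (fderiv ℝ v (polarPt r θ) (-(r * Real.sin θ), r * Real.cos θ)) θ := by
  have h1 : HasDerivAt (fun θ => polarPt r θ) (-(r * Real.sin θ), r * Real.cos θ) θ := by
    unfold polarPt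
    simpa using ((Real.hasDerivAt_cos θ).const_mul r).prodMk ((Real.hasDerivAt_sin θ).const_mul r)
  exact ((hv.differentiable one_ne_zero _).hasFDerivAt).comp_hasDerivAt θ h1

theorem continuous_fderiv_polarPt (hv : ContDiff ℝ 1 v) {a b : ℝ × ℝ → ℝ} (ha : Continuous a)
    (hb : Continuous b) :
    Continuous fun p : ℝ × ℝ => fderiv ℝ v (polarPt p.1 p.2) (a p, b p) :=
  ((hv.continuous_fderiv one_ne_zero).comp continuous_polarPt).clm_apply (ha.prodMk hb)

theorem exists_radius (hs : HasCompactSupport v) :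
    ∃ R, 0 < R ∧ ∀ r θ, R ≤ r → v (polarPt r θ) = 0 ∧ fderiv ℝ v (polarPt r θ) = 0 := by
  obtain ⟨L, hL⟩ := hs.isCompact.isBounded.subset_closedBall 0
  refine ⟨2 * (|L| + 1), by positivity, fun r θ hr => ?_⟩
  have hnot : polarPt r θ ∉ tsupport v := by
    intro hmem
    have h1 := hL hmem
    rw [mem_closedBall_zero_iff, polarPt, Prod.norm_def, max_le_iff, Real.norm_eq_abs,
      Real.norm_eq_abs] at h1
    have h2 := sq_le_sq' (neg_le_of_abs_le h1.1) (le_of_abs_le h1.1)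
    have h3 := sq_le_sq' (neg_le_of_abs_le h1.2) (le_of_abs_le h1.2)
    have h4 := Real.sin_sq_add_cos_sq θ
    have h5 : r ^ 2 ≤ 2 * L ^ 2 := by
      have : r ^ 2 = (r * Real.cos θ) ^ 2 + (r * Real.sin θ) ^ 2 := by
        rw [mul_pow, mul_pow, ← mul_add, add_comm (Real.cos θ ^ 2), h4, mul_one]
      linarith
    nlinarith [sq_abs L, abs_nonneg L]
  exact ⟨image_eq_zero_of_notMem_tsupport hnot, image_eq_zero_of_notMem_tsupport
    fun h => hnot (tsupport_fderiv_subset ℝ h)⟩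

theorem hasDerivAt_radialPart (hv : ContDiff ℝ 1 v) (hs : HasCompactSupport v) (m : ℤ) (r : ℝ) :
    HasDerivAt (radialPart v m) (radialPartDeriv v m r) r := by
  obtain ⟨C, hC⟩ := (hs.fderiv ℝ).exists_bound_of_continuous (hv.continuous_fderiv one_ne_zero)
  have hc1 : Continuous fun p : ℝ × ℝ =>
      Complex.exp (-(m * p.2 * Complex.I)) * v (polarPt p.1 p.2) := by
    have := hv.continuous
    fun_prop
  have hc2 : Continuous fun p : ℝ × ℝ => Complex.exp (-(m * p.2 * Complex.I)) *
      fderiv ℝ v (polarPt p.1 p.2) (Real.cos p.2, Real.sin p.2) := by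
    have := continuous_fderiv_polarPt hv (a := fun p => Real.cos p.2) (b := fun p => Real.sin p.2)
      (by fun_prop) (by fun_prop)
    fun_prop
  have hcl : ∀ x : ℝ, Continuous fun θ : ℝ => (x, θ) := fun x => by fun_prop
  have key := intervalIntegral.hasDerivAt_integral_of_dominated_loc_of_deriv_le
    (μ := volume) (a := -Real.pi) (b := Real.pi)
    (F := fun r θ => Complex.exp (-(m * θ * Complex.I)) * v (polarPt r θ))
    (F' := fun r θ => Complex.exp (-(m * θ * Complex.I)) *
      fderiv ℝ v (polarPt r θ) (Real.cos θ, Real.sin θ))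
    (x₀ := r) (s := univ) (bound := fun _ => C) univ_mem
    (Eventually.of_forall fun x => (hc1.comp (hcl x)).aestronglyMeasurable)
    ((hc1.comp (hcl r)).intervalIntegrable _ _)
    (hc2.comp (hcl r)).aestronglyMeasurable
    (Eventually.of_forall fun θ _ x _ => ?_) intervalIntegrable_const
    (Eventually.of_forall fun θ _ x _ => (hasDerivAt_polarPt_left hv x θ).const_mul _)
  · exact key.2.fun_const_smul _
  · have h1 : ‖Complex.exp (-(m * θ * Complex.I))‖ = 1 := by
      rw [Complex.norm_exp]; simp
    rw [norm_mul, h1, one_mul]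
    refine (ContinuousLinearMap.le_opNorm _ _).trans ?_
    have h2 : ‖((Real.cos θ, Real.sin θ) : ℝ × ℝ)‖ ≤ 1 := by
      rw [Prod.norm_def]
      exact max_le (Real.abs_cos_le_one θ) (Real.abs_sin_le_one θ)
    calc ‖fderiv ℝ v (polarPt x θ)‖ * ‖((Real.cos θ, Real.sin θ) : ℝ × ℝ)‖
        ≤ C * 1 := mul_le_mul (hC _) h2 (norm_nonneg _) ((norm_nonneg _).trans (hC 0))
      _ = C := mul_one C

theorem continuous_radialPartDeriv (hv : ContDiff ℝ 1 v) (m : ℤ) :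
    Continuous (radialPartDeriv v m) := by
  have hc2 : Continuous fun p : ℝ × ℝ => Complex.exp (-(m * p.2 * Complex.I)) *
      fderiv ℝ v (polarPt p.1 p.2) (Real.cos p.2, Real.sin p.2) := by
    have := continuous_fderiv_polarPt hv (a := fun p => Real.cos p.2) (b := fun p => Real.sin p.2)
      (by fun_prop) (by fun_prop)
    fun_prop
  have h := intervalIntegral.continuous_parametric_intervalIntegral_of_continuous' (μ := volume)
    (f := fun r θ : ℝ => Complex.exp (-(m * θ * Complex.I)) *
      fderiv ℝ v (polarPt r θ) (Real.cos θ, Real.sin θ)) hc2 (-Real.pi) Real.pi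
  exact h.const_smul (2 * Real.pi)⁻¹

/-- The angular Fourier coefficients of a `C¹` function with compact support are radial profiles. -/
theorem isRadialProfile_radialPart (hv : ContDiff ℝ 1 v) {R : ℝ} (hR : 0 < R)
    (hvR : ∀ r θ, R ≤ r → v (polarPt r θ) = 0 ∧ fderiv ℝ v (polarPt r θ) = 0)
    (hs : HasCompactSupport v) {m : ℤ} {k : ℕ} (hk : k ≠ 0 → m ≠ 0) :
    IsRadialProfile k R (radialPart v m) (radialPartDeriv v m) where
  hasDerivAt := hasDerivAt_radialPart hv hs m
  continuous_deriv := continuous_radialPartDeriv hv m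
  pos := hR
  eq_zero r hr := by simp [radialPart, angCoeff, (hvR r _ hr).1]
  deriv_eq_zero r hr := by simp [radialPartDeriv, angCoeff, (hvR r _ hr).2]
  zero h := by
    have : ∀ θ, polarPt 0 θ = 0 := fun θ => by simp [polarPt]
    simp only [radialPart, this]
    exact angCoeff_const (hk h) _

/-- The angular Fourier coefficients of the angular covariant derivative `(i / r) ∂_θ v + a v`. -/
theorem angCoeff_angular (hv : ContDiff ℝ 1 v) (m : ℤ) (r : ℝ) (a : ℝ) :
    angCoeff m (fun θ => (Complex.I / r) *
        fderiv ℝ v (polarPt r θ) (-(r * Real.sin θ), r * Real.cos θ) + a * v (polarPt r θ)) =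
      ((a - m / r : ℝ) : ℂ) * radialPart v m r := by
  have hcl : Continuous fun θ : ℝ => (r, θ) := by fun_prop
  have h1 : Continuous v := hv.continuous
  have h2 : Continuous fun θ =>
      fderiv ℝ v (polarPt r θ) (-(r * Real.sin θ), r * Real.cos θ) :=
    (continuous_fderiv_polarPt hv (a := fun p => -(p.1 * Real.sin p.2))
      (b := fun p => p.1 * Real.cos p.2) (by fun_prop) (by fun_prop)).comp hcl
  rw [angCoeff_add m (by fun_prop) (by fun_prop), angCoeff_const_mul, angCoeff_const_mul,
    angCoeff_deriv (hasDerivAt_polarPt_right hv r) h2 (by simp [polarPt]) m, radialPart]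
  push_cast
  linear_combination (m / r * angCoeff m fun θ => v (polarPt r θ)) * Complex.I_sq

end Angular

/-! ### Decomposition of the energy into angular sectors -/

section Sectors

theorem measurableSet_polarTarget :
    MeasurableSet (Ioi (0 : ℝ) ×ˢ Ioo (-Real.pi) Real.pi) :=
  measurableSet_Ioi.prod measurableSet_Ioo

/-- Parseval's identity in polar coordinates. -/
theorem lintegral_polar_eq_tsum {G : ℝ → ℝ → ℂ}
    (hG : ContinuousOn (Function.uncurry G) (Ioi 0 ×ˢ univ))
    (hm : ∀ m, ContinuousOn (fun r => angCoeff m (G r)) (Ioi 0)) :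
    ∫⁻ p in Ioi (0 : ℝ) ×ˢ Ioo (-Real.pi) Real.pi, ENNReal.ofReal p.1 * ‖G p.1 p.2‖ₑ ^ 2 =
      ENNReal.ofReal (2 * Real.pi) *
        ∑' m : ℤ, ∫⁻ r in Ioi (0 : ℝ), ENNReal.ofReal (r * ‖angCoeff m (G r)‖ ^ 2) := by
  have hGm : AEMeasurable (fun p : ℝ × ℝ => ENNReal.ofReal p.1 * ‖G p.1 p.2‖ₑ ^ 2)
      ((volume : Measure (ℝ × ℝ)).restrict (Ioi (0 : ℝ) ×ˢ Ioo (-Real.pi) Real.pi)) := by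
    have h1 : AEMeasurable (Function.uncurry G)
        ((volume : Measure (ℝ × ℝ)).restrict (Ioi (0 : ℝ) ×ˢ Ioo (-Real.pi) Real.pi)) :=
      (hG.mono (prod_mono subset_rfl (subset_univ _))).aemeasurable measurableSet_polarTarget
    exact (by fun_prop : Measurable fun p : ℝ × ℝ => ENNReal.ofReal p.1).aemeasurable.mul
      (h1.enorm.pow_const 2)
  rw [Measure.volume_eq_prod, ← Measure.prod_restrict] at hGm ⊢
  rw [lintegral_prod _ hGm]
  have h2 : ∀ r ∈ Ioi (0 : ℝ), ∫⁻ θ in Ioo (-Real.pi) Real.pi, ENNReal.ofReal r * ‖G r θ‖ₑ ^ 2 =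
      ENNReal.ofReal (2 * Real.pi) * ∑' m : ℤ, ENNReal.ofReal (r * ‖angCoeff m (G r)‖ ^ 2) := by
    intro r hr
    have hGr : Continuous (G r) := by
      rw [← continuousOn_univ]
      exact hG.comp (f := fun θ => (r, θ)) (by fun_prop) fun θ _ => ⟨hr, mem_univ θ⟩
    rw [lintegral_const_mul _ (by fun_prop), lintegral_enorm_sq_eq_tsum_angCoeff hGr,
      mul_left_comm, ← ENNReal.tsum_mul_left]
    congr 1
    refine tsum_congr fun m => ?_
    rw [ENNReal.ofReal_mul (le_of_lt hr), ENNReal.ofReal_pow (norm_nonneg _), ofReal_norm]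
  rw [setLIntegral_congr_fun measurableSet_Ioi h2, lintegral_const_mul' _ _ ENNReal.ofReal_ne_top,
    lintegral_tsum fun m => ?_]
  have := ((hm m).norm.pow 2).aemeasurable (μ := volume) measurableSet_Ioi
  exact (aemeasurable_id.mul this).ennreal_ofReal

variable {v : ℝ × ℝ → ℂ} {B : ℝ} {g : ℝ → ℝ}

/-- The energy of the `m`-th angular sector of `v`. -/
def sectorEnergy (B : ℝ) (g : ℝ → ℝ) (v : ℝ × ℝ → ℂ) (m : ℤ) : ℝ≥0∞ :=
  ∫⁻ r in Ioi (0 : ℝ), ENNReal.ofReal (r * (‖radialPartDeriv v m r‖ ^ 2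
    + (m / r - circularPotential B g r) ^ 2 * ‖radialPart v m r‖ ^ 2))

/-- The squared norm of the `m`-th angular sector of `v`. -/
def sectorNorm (v : ℝ × ℝ → ℂ) (m : ℤ) : ℝ≥0∞ :=
  ∫⁻ r in Ioi (0 : ℝ), ENNReal.ofReal (r * ‖radialPart v m r‖ ^ 2)

/-- The component of `v` along the Landau state of angular momentum `k`, up to normalisation. -/
def landauComponent (B : ℝ) (v : ℝ × ℝ → ℂ) (k : ℕ) : ℂ :=
  ∫ s in Ioi (0 : ℝ), (landauState B k s * s : ℝ) • radialPart v k s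

theorem continuous_radialPart (hv : ContDiff ℝ 1 v) (hs : HasCompactSupport v) (m : ℤ) :
    Continuous (radialPart v m) :=
  continuous_iff_continuousAt.2 fun r => (hasDerivAt_radialPart hv hs m r).continuousAt

theorem lintegral_polar_norm (hv : ContDiff ℝ 1 v) (hs : HasCompactSupport v) :
    ∫⁻ p in Ioi (0 : ℝ) ×ˢ Ioo (-Real.pi) Real.pi,
        ENNReal.ofReal p.1 * ‖v (polarPt p.1 p.2)‖ₑ ^ 2 =
      ENNReal.ofReal (2 * Real.pi) * ∑' m : ℤ, sectorNorm v m :=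
  lintegral_polar_eq_tsum (G := fun r θ => v (polarPt r θ))
    (hv.continuous.comp continuous_polarPt).continuousOn
    fun m => (continuous_radialPart hv hs m).continuousOn

theorem lintegral_polar_energy (hv : ContDiff ℝ 1 v) (hs : HasCompactSupport v)
    (hg : IsAdmissibleFlux B g) :
    ∫⁻ p in Ioi (0 : ℝ) ×ˢ Ioo (-Real.pi) Real.pi, ENNReal.ofReal p.1 *
        (‖fderiv ℝ v (polarPt p.1 p.2) (Real.cos p.2, Real.sin p.2)‖ₑ ^ 2
          + ‖(Complex.I / p.1) * fderiv ℝ v (polarPt p.1 p.2)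
              (-(p.1 * Real.sin p.2), p.1 * Real.cos p.2)
            + circularPotential B g p.1 * v (polarPt p.1 p.2)‖ₑ ^ 2) =
      ENNReal.ofReal (2 * Real.pi) * ∑' m : ℤ, sectorEnergy B g v m := by
  have hc := continuous_radialPart hv hs
  have hc' := continuous_radialPartDeriv hv
  have ha := hg.continuousOn_circularPotential
  have hdr : Continuous fun p : ℝ × ℝ =>
      fderiv ℝ v (polarPt p.1 p.2) (Real.cos p.2, Real.sin p.2) :=
    continuous_fderiv_polarPt hv (a := fun p => Real.cos p.2) (b := fun p => Real.sin p.2)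
      (by fun_prop) (by fun_prop)
  have h1 := lintegral_polar_eq_tsum
    (G := fun r θ => fderiv ℝ v (polarPt r θ) (Real.cos θ, Real.sin θ))
    hdr.continuousOn fun m => (hc' m).continuousOn
  have hcoef : ∀ m : ℤ, ContinuousOn
      (fun r : ℝ => ((circularPotential B g r - m / r : ℝ) : ℂ) * radialPart v m r) (Ioi 0) := by
    intro m
    have : ContinuousOn (fun r : ℝ => circularPotential B g r - m / r) (Ioi 0) :=
      ha.sub (continuousOn_const.div continuousOn_id fun r hr => ne_of_gt hr)
    exact (Complex.continuous_ofReal.comp_continuousOn this).mul (hc m).continuousOn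
  have h2 := lintegral_polar_eq_tsum (G := fun r θ => (Complex.I / r) *
      fderiv ℝ v (polarPt r θ) (-(r * Real.sin θ), r * Real.cos θ)
      + circularPotential B g r * v (polarPt r θ)) (by
    refine ContinuousOn.add (ContinuousOn.mul ?_ ?_) (ContinuousOn.mul ?_ ?_)
    · refine continuousOn_const.div (Continuous.continuousOn (by fun_prop)) fun p hp => ?_
      exact Complex.ofReal_ne_zero.2 (ne_of_gt hp.1)
    · exact (continuous_fderiv_polarPt hv (a := fun p => -(p.1 * Real.sin p.2))
        (b := fun p => p.1 * Real.cos p.2) (by fun_prop) (by fun_prop)).continuousOn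
    · exact Complex.continuous_ofReal.comp_continuousOn
        (ha.comp continuous_fst.continuousOn fun p hp => hp.1)
    · exact (hv.continuous.comp continuous_polarPt).continuousOn) (fun m => by
    simp only [angCoeff_angular hv]
    exact hcoef m)
  simp only [angCoeff_angular hv] at h2
  simp only [mul_add]
  have hmeas : Measurable fun p : ℝ × ℝ => ENNReal.ofReal p.1 *
      ‖fderiv ℝ v (polarPt p.1 p.2) (Real.cos p.2, Real.sin p.2)‖ₑ ^ 2 :=
    measurable_fst.ennreal_ofReal.mul (hdr.measurable.enorm.pow_const 2)
  rw [lintegral_add_left hmeas]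
  refine (congrArg₂ (· + ·) h1 h2).trans ?_
  rw [← mul_add, ← ENNReal.tsum_add]
  congr 1
  refine tsum_congr fun m => ?_
  rw [sectorEnergy, ← lintegral_add_left' ?_]
  · refine setLIntegral_congr_fun measurableSet_Ioi fun r hr => ?_
    have hr' : (0 : ℝ) < r := hr
    rw [← ENNReal.ofReal_add (by positivity) (by positivity), norm_mul, mul_pow,
      Complex.norm_real, Real.norm_eq_abs, sq_abs]
    congr 1
    simp only [radialPartDeriv]
    ring
  · exact (ENNReal.continuous_ofReal.comp
      (continuous_id.mul ((hc' m).norm.pow 2))).measurable.aemeasurable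

theorem ofReal_integral_Ioi_mul {f : ℝ → ℝ} (hf : IntegrableOn (fun r => r * f r) (Ioi 0))
    (h0 : ∀ r, 0 ≤ f r) :
    ∫⁻ r in Ioi (0 : ℝ), ENNReal.ofReal (r * f r) =
      ENNReal.ofReal (∫ r in Ioi (0 : ℝ), r * f r) := by
  rw [ofReal_integral_eq_lintegral_ofReal hf]
  filter_upwards [ae_restrict_mem measurableSet_Ioi] with r hr
  exact mul_nonneg (le_of_lt hr) (h0 r)

/-- The lower bound in a single angular sector. The terms with `k ∉ S` are covered by `t` times the
norm, by Bessel's inequality. -/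
theorem sectorNorm_le (hv : ContDiff ℝ 1 v) (hs : HasCompactSupport v)
    (hg : IsAdmissibleFlux B g) (hB : 0 < B) {S : Finset ℕ} {t : ℝ} (ht : 0 ≤ t)
    (hS : ∀ k ∉ S, 2 * effectiveExpectation B g k ≤ t) (m : ℤ) :
    ENNReal.ofReal B * sectorNorm v m ≤ sectorEnergy B g v m + ENNReal.ofReal t * sectorNorm v m
      + if m ∈ S.map Nat.castEmbedding then
          ENNReal.ofReal (2 * effectiveExpectation B g m.toNat * ‖landauComponent B v m.toNat‖ ^ 2)
        else 0 := by
  obtain ⟨R, hR, hvR⟩ := exists_radius hs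
  rcases le_or_gt 0 m with hm | hm
  · lift m to ℕ using hm with k
    have hw : IsRadialProfile k R (radialPart v k) (radialPartDeriv v k) :=
      isRadialProfile_radialPart hv hR hvR hs (by simp)
    obtain ⟨hi, hle⟩ := hw.sector_bound hg hB
    have hb := hw.norm_sq_integral_landauState_mul_le hB
    have hΛ := effectiveExpectation_nonneg B g k
    have hn0 : 0 ≤ ∫ r in Ioi (0 : ℝ), r * ‖radialPart v k r‖ ^ 2 := (sq_nonneg _).trans hb
    have hq0 : 0 ≤ ∫ r in Ioi (0 : ℝ), r * (‖radialPartDeriv v k r‖ ^ 2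
        + (k / r - circularPotential B g r) ^ 2 * ‖radialPart v k r‖ ^ 2) :=
      setIntegral_nonneg measurableSet_Ioi fun r hr => mul_nonneg (le_of_lt hr) (by positivity)
    simp only [sectorNorm, sectorEnergy, Int.cast_natCast, Int.toNat_natCast]
    rw [ofReal_integral_Ioi_mul hw.integrableOn_norm_sq (fun _ => by positivity),
      ofReal_integral_Ioi_mul hi (fun _ => by positivity), ← ENNReal.ofReal_mul hB.le,
      ← ENNReal.ofReal_mul ht, ← ENNReal.ofReal_add hq0 (mul_nonneg ht hn0)]
    have hmem : ((k : ℤ) ∈ S.map Nat.castEmbedding) ↔ k ∈ S := by simp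
    rw [if_congr hmem rfl rfl]
    split_ifs with hk
    · rw [← ENNReal.ofReal_add (by positivity) (by positivity)]
      refine ENNReal.ofReal_le_ofReal (hle.trans ?_)
      rw [landauComponent]
      have := mul_nonneg ht hn0
      linarith
    · rw [add_zero]
      refine ENNReal.ofReal_le_ofReal (hle.trans ?_)
      gcongr
      exact hS k hk
  · obtain ⟨k, rfl⟩ := Int.exists_eq_neg_ofNat hm.le
    have hk : k ≠ 0 := by rintro rfl; simp at hm
    have hw : IsRadialProfile k R (radialPart v (-k)) (radialPartDeriv v (-k)) :=
      isRadialProfile_radialPart hv hR hvR hs (by simp)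
    obtain ⟨hi, hle⟩ := hw.opposite_sector_bound hg hB hk
    refine le_trans ?_ (le_add_right le_self_add)
    have hq : sectorEnergy B g v (-k) = ∫⁻ r in Ioi (0 : ℝ),
        ENNReal.ofReal (r * (‖radialPartDeriv v (-k) r‖ ^ 2
          + (k / r + circularPotential B g r) ^ 2 * ‖radialPart v (-k) r‖ ^ 2)) := by
      rw [sectorEnergy]
      refine lintegral_congr fun r => ?_
      congr 3
      push_cast
      ring
    rw [hq, sectorNorm, ofReal_integral_Ioi_mul hw.integrableOn_norm_sq (fun _ => by positivity),
      ofReal_integral_Ioi_mul hi (fun _ => by positivity), ← ENNReal.ofReal_mul hB.le]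
    exact ENNReal.ofReal_le_ofReal hle

/-- The lower bound on the energy in polar coordinates, summed over all sectors. -/
theorem polar_energy_bound (hv : ContDiff ℝ 1 v) (hs : HasCompactSupport v)
    (hg : IsAdmissibleFlux B g) (hB : 0 < B) {S : Finset ℕ} {t : ℝ} (ht : 0 ≤ t)
    (hS : ∀ k ∉ S, 2 * effectiveExpectation B g k ≤ t) :
    ENNReal.ofReal B * (ENNReal.ofReal (2 * Real.pi) * ∑' m : ℤ, sectorNorm v m) ≤
      ENNReal.ofReal (2 * Real.pi) * ∑' m : ℤ, sectorEnergy B g v m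
      + ENNReal.ofReal t * (ENNReal.ofReal (2 * Real.pi) * ∑' m : ℤ, sectorNorm v m)
      + ∑ k ∈ S, ENNReal.ofReal (2 * effectiveExpectation B g k *
          (2 * Real.pi * ‖landauComponent B v k‖ ^ 2)) := by
  have h1 := ENNReal.tsum_le_tsum fun m => sectorNorm_le hv hs hg hB ht hS m
  rw [ENNReal.tsum_mul_left, ENNReal.tsum_add, ENNReal.tsum_add, ENNReal.tsum_mul_left] at h1
  have h2 : ∑' m : ℤ, (if m ∈ S.map Nat.castEmbedding then
      ENNReal.ofReal (2 * effectiveExpectation B g m.toNat * ‖landauComponent B v m.toNat‖ ^ 2)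
      else 0) = ∑ k ∈ S, ENNReal.ofReal (2 * effectiveExpectation B g k *
          ‖landauComponent B v k‖ ^ 2) := by
    rw [tsum_eq_sum (s := S.map Nat.castEmbedding) (fun m hm => if_neg hm), Finset.sum_map]
    refine Finset.sum_congr rfl fun k hk => ?_
    rw [if_pos (Finset.mem_map_of_mem _ hk)]
    simp
  rw [h2] at h1
  have h3 := mul_le_mul_right h1 (ENNReal.ofReal (2 * Real.pi))
  rw [mul_left_comm]
  refine h3.trans (le_of_eq ?_)
  rw [mul_add, mul_add, mul_left_comm _ (ENNReal.ofReal t), Finset.mul_sum]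
  congr 1
  refine Finset.sum_congr rfl fun k _ => ?_
  rw [← ENNReal.ofReal_mul (by positivity)]
  congr 1
  ring

end Sectors

/-! ### The energy bound for test functions -/

section Plane

variable {B : ℝ} {g : ℝ → ℝ} {χ : ℝ × ℝ → ℝ} {φ : ℝ × ℝ → ℂ}

/-- `χ` is a gauge function: its gradient is the difference of the Landau potential and of the
circular potential `a(r) (-y, x) / r`. -/
def IsGauge (B : ℝ) (g : ℝ → ℝ) (χ : ℝ × ℝ → ℝ) : Prop :=
  ∀ z : ℝ × ℝ, HasFDerivAt χ
    ((B * z.2 / 2 - radialField g z.2 z.1) • ContinuousLinearMap.fst ℝ ℝ ℝ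
      + (B * z.1 / 2 - gaugeFun g z + radialField g z.1 z.2) • ContinuousLinearMap.snd ℝ ℝ ℝ) z

theorem IsFieldProfile.exists_isGauge (hg : IsFieldProfile B g) (hB : 0 < B) :
    ∃ χ, IsGauge B g χ := by
  obtain ⟨η, hη⟩ := hg.exists_gauge hB
  refine ⟨fun z => B / 2 * (z.1 * z.2) - η z, fun z => ?_⟩
  have h1 := (((hasFDerivAt_fst (𝕜 := ℝ) (p := z)).mul
    (hasFDerivAt_snd (𝕜 := ℝ) (p := z))).const_mul (B / 2)).sub (hη z)
  refine h1.congr_fderiv ?_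
  ext
  · simp; ring
  · simp; ring

theorem IsGauge.contDiff (h : IsGauge B g χ) (hg : IsFieldProfile B g) (hB : 0 < B) :
    ContDiff ℝ 1 χ := by
  rw [contDiff_one_iff_hasFDerivAt]
  refine ⟨_, ?_, h⟩
  have h1 := hg.continuous_radialField
  have h2 := hg.continuous_radialField_comp (u := Prod.snd) (v := Prod.fst) continuous_snd
    continuous_fst
  have h3 := hg.continuous_gaugeFun hB
  fun_prop

/-- The function `φ` in the circular gauge. -/
def toCircularGauge (χ : ℝ × ℝ → ℝ) (φ : ℝ × ℝ → ℂ) (z : ℝ × ℝ) : ℂ :=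
  Complex.exp (-(χ z * Complex.I)) * φ z

theorem norm_exp_neg_ofReal_mul_I (x : ℝ) : ‖Complex.exp (-(x * Complex.I))‖ = 1 := by
  rw [Complex.norm_exp]; simp

theorem norm_toCircularGauge (χ : ℝ × ℝ → ℝ) (φ : ℝ × ℝ → ℂ) (z : ℝ × ℝ) :
    ‖toCircularGauge χ φ z‖ = ‖φ z‖ := by
  rw [toCircularGauge, norm_mul, norm_exp_neg_ofReal_mul_I, one_mul]

theorem contDiff_toCircularGauge (hχ : ContDiff ℝ 1 χ) (hφ : ContDiff ℝ ∞ φ) :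
    ContDiff ℝ 1 (toCircularGauge χ φ) := by
  have h1 : ContDiff ℝ 1 fun z => (χ z : ℂ) := Complex.ofRealCLM.contDiff.comp hχ
  have h2 : ContDiff ℝ 1 φ := hφ.of_le (by exact_mod_cast le_top)
  exact ((h1.mul contDiff_const).neg.cexp).mul h2

theorem fderiv_toCircularGauge (h : IsGauge B g χ) (hφ : ContDiff ℝ ∞ φ) (z w : ℝ × ℝ) :
    fderiv ℝ (toCircularGauge χ φ) z w = Complex.exp (-(χ z * Complex.I)) *
      (w.1 * (fderiv ℝ φ z (1, 0)
          - Complex.I * (B * z.2 / 2 - radialField g z.2 z.1 : ℝ) * φ z)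
        + w.2 * (fderiv ℝ φ z (0, 1)
          - Complex.I * (B * z.1 / 2 - gaugeFun g z + radialField g z.1 z.2 : ℝ) * φ z)) := by
  have h1 := (((Complex.ofRealCLM.hasFDerivAt.comp z (h z)).mul_const Complex.I).neg).cexp
  have h2 := (hφ.differentiable (by simp) z).hasFDerivAt
  have h3 := (h1.mul h2).fderiv
  have h4 : (fun y => Complex.exp ((-fun y => (Complex.ofRealCLM ∘ χ) y * Complex.I) y)) * φ
      = toCircularGauge χ φ := rfl
  have hw : fderiv ℝ φ z w = w.1 * fderiv ℝ φ z (1, 0) + w.2 * fderiv ℝ φ z (0, 1) := by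
    have : w = w.1 • ((1, 0) : ℝ × ℝ) + w.2 • ((0, 1) : ℝ × ℝ) := by ext <;> simp
    conv_lhs => rw [this, map_add, map_smul, map_smul, Complex.real_smul, Complex.real_smul]
  rw [h4] at h3
  rw [h3]
  simp [hw]
  ring

theorem radialField_polarPt {r : ℝ} (hr : 0 < r) (θ : ℝ) :
    radialField g (polarPt r θ).1 (polarPt r θ).2 = fluxFun g r / r * Real.cos θ ∧
    radialField g (polarPt r θ).2 (polarPt r θ).1 = fluxFun g r / r * Real.sin θ := by
  have h1 : (r * Real.cos θ) ^ 2 + (r * Real.sin θ) ^ 2 = r ^ 2 := by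
    rw [mul_pow, mul_pow, ← mul_add, Real.cos_sq_add_sin_sq, mul_one]
  have h2 : (r * Real.sin θ) ^ 2 + (r * Real.cos θ) ^ 2 = r ^ 2 := by rw [add_comm, h1]
  simp only [radialField, polarPt, h1, h2, Real.sqrt_sq hr.le]
  constructor <;> field_simp

/-- Rotating the two components of the covariant gradient to the radial and angular
directions. -/
theorem energy_density_polar (h : IsGauge B g χ) (hφ : ContDiff ℝ ∞ φ) {r : ℝ} (hr : 0 < r)
    (θ : ℝ) :
    ‖fderiv ℝ (toCircularGauge χ φ) (polarPt r θ) (Real.cos θ, Real.sin θ)‖ₑ ^ 2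
      + ‖(Complex.I / r) * fderiv ℝ (toCircularGauge χ φ) (polarPt r θ)
          (-(r * Real.sin θ), r * Real.cos θ)
        + circularPotential B g r * toCircularGauge χ φ (polarPt r θ)‖ₑ ^ 2 =
    ‖Complex.I * fderiv ℝ φ (polarPt r θ) (1, 0)
        + ((landauPotential B g (polarPt r θ)).1 : ℂ) * φ (polarPt r θ)‖ₑ ^ 2
      + ‖Complex.I * fderiv ℝ φ (polarPt r θ) (0, 1)
        + ((landauPotential B g (polarPt r θ)).2 : ℂ) * φ (polarPt r θ)‖ₑ ^ 2 := by
  obtain ⟨hf1, hf2⟩ := radialField_polarPt (g := g) hr θ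
  have ha : circularPotential B g r = B * r / 2 - fluxFun g r / r := by
    rw [circularPotential, fluxFun]; ring
  rw [fderiv_toCircularGauge h hφ, fderiv_toCircularGauge h hφ, hf1, hf2, ha]
  simp only [landauPotential, toCircularGauge]
  have hz1 : (polarPt r θ).1 = r * Real.cos θ := rfl
  have hz2 : (polarPt r θ).2 = r * Real.sin θ := rfl
  rw [hz1, hz2]
  set e := Complex.exp (-(χ (polarPt r θ) * Complex.I)) with he
  have hen : ‖e‖ = 1 := norm_exp_neg_ofReal_mul_I _
  set D₁ := fderiv ℝ φ (polarPt r θ) (1, 0)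
  set D₂ := fderiv ℝ φ (polarPt r θ) (0, 1)
  set f := gaugeFun g (polarPt r θ)
  set w := φ (polarPt r θ)
  set Φ := fluxFun g r
  set p₁ := Complex.I * D₁ + ((0 : ℝ) : ℂ) * w with hp₁
  set p₂ := Complex.I * D₂ + ((B * (r * Real.cos θ) - f : ℝ) : ℂ) * w with hp₂
  have hr0 : (r : ℂ) ≠ 0 := Complex.ofReal_ne_zero.2 hr.ne'
  have hcs : (Real.cos θ : ℂ) ^ 2 + (Real.sin θ : ℂ) ^ 2 = 1 := by
    exact_mod_cast Real.cos_sq_add_sin_sq θ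
  have hI := Complex.I_sq
  have e1 : e * (((Real.cos θ : ℝ) : ℂ) * (D₁ - Complex.I *
        (B * (r * Real.sin θ) / 2 - Φ / r * Real.sin θ : ℝ) * w)
      + ((Real.sin θ : ℝ) : ℂ) * (D₂ - Complex.I *
        (B * (r * Real.cos θ) / 2 - f + Φ / r * Real.cos θ : ℝ) * w)) =
      (-Complex.I * e) * (Real.cos θ * p₁ + Real.sin θ * p₂) := by
    rw [hp₁, hp₂]
    simp only [Complex.ofReal_mul, Complex.ofReal_sub, Complex.ofReal_add,
      Complex.ofReal_div, Complex.ofReal_ofNat, Complex.ofReal_zero]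
    linear_combination (e * (Real.cos θ * D₁ + Real.sin θ * D₂)) * hI
  have e2 : Complex.I / r * (e * (((-(r * Real.sin θ) : ℝ) : ℂ) * (D₁ - Complex.I *
        (B * (r * Real.sin θ) / 2 - Φ / r * Real.sin θ : ℝ) * w)
      + ((r * Real.cos θ : ℝ) : ℂ) * (D₂ - Complex.I *
        (B * (r * Real.cos θ) / 2 - f + Φ / r * Real.cos θ : ℝ) * w)))
      + ((B * r / 2 - Φ / r : ℝ) : ℂ) * (e * w) =
      e * (-Real.sin θ * p₁ + Real.cos θ * p₂) := by
    rw [hp₁, hp₂]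
    have hcancel : ∀ X Y : ℂ, Complex.I / r * (e * (((-(r * Real.sin θ) : ℝ) : ℂ) * X
        + ((r * Real.cos θ : ℝ) : ℂ) * Y)) =
        Complex.I * (e * (-(Real.sin θ : ℂ) * X + (Real.cos θ : ℂ) * Y)) := by
      intro X Y
      push_cast
      field_simp
    rw [hcancel]
    simp only [Complex.ofReal_mul, Complex.ofReal_sub, Complex.ofReal_add,
      Complex.ofReal_div, Complex.ofReal_ofNat, Complex.ofReal_zero]
    linear_combination (-(e * w) * (-(Real.sin θ : ℂ) * (B * (r * Real.sin θ) / 2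
      - Φ / r * Real.sin θ) + Real.cos θ * (B * (r * Real.cos θ) / 2 - f
      + Φ / r * Real.cos θ))) * hI + (e * w * (Φ / r - B * r / 2)) * hcs
  rw [e1, e2]
  simp only [← ofReal_norm, ← ENNReal.ofReal_pow (norm_nonneg _)]
  rw [← ENNReal.ofReal_add (by positivity) (by positivity),
    ← ENNReal.ofReal_add (by positivity) (by positivity)]
  congr 1
  rw [norm_mul, norm_mul, norm_mul, norm_neg, Complex.norm_I, hen, one_mul, one_mul, one_mul]
  have hrot : ∀ a b : ℂ, ‖a + b‖ ^ 2 = ‖a‖ ^ 2 + 2 * inner ℝ a b + ‖b‖ ^ 2 := norm_add_sq_real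
  have hc : ∀ (c : ℝ) (p : ℂ), (c : ℂ) * p = c • p := fun c p => (Complex.real_smul).symm
  rw [← Complex.ofReal_neg, hc, hc, hc, hc, hrot, hrot, real_inner_smul_left, real_inner_smul_left,
    real_inner_smul_right, real_inner_smul_right, norm_smul, norm_smul, norm_smul, norm_smul,
    mul_pow, mul_pow, mul_pow, mul_pow, Real.norm_eq_abs, Real.norm_eq_abs, Real.norm_eq_abs,
    sq_abs, sq_abs, sq_abs]
  have := Real.cos_sq_add_sin_sq θ
  linear_combination (‖p₁‖ ^ 2 + ‖p₂‖ ^ 2) * this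

theorem lintegral_polar (f : ℝ × ℝ → ℝ≥0∞) :
    ∫⁻ p in Ioi (0 : ℝ) ×ˢ Ioo (-Real.pi) Real.pi, ENNReal.ofReal p.1 * f (polarPt p.1 p.2) =
      ∫⁻ z, f z := lintegral_comp_polarCoord_symm f

theorem integral_polar (f : ℝ × ℝ → ℂ) :
    ∫ p in Ioi (0 : ℝ) ×ˢ Ioo (-Real.pi) Real.pi, p.1 • f (polarPt p.1 p.2) =
      ∫ z, f z := integral_comp_polarCoord_symm f

/-- The Landau state of angular momentum `k` in the plane, in the Landau gauge:
`e^{iχ} (2π)^{-1/2} ψ_k(r) e^{ikθ}`. The value at the origin is irrelevant. -/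
def planeLandauState (B : ℝ) (χ : ℝ × ℝ → ℝ) (k : ℕ) (z : ℝ × ℝ) : ℂ :=
  Complex.exp (χ z * Complex.I) *
    (((Real.sqrt (2 * Real.pi))⁻¹ * landauState B k (Real.sqrt (z.1 ^ 2 + z.2 ^ 2)) : ℝ) *
      ((z.1 + z.2 * Complex.I) / Real.sqrt (z.1 ^ 2 + z.2 ^ 2)) ^ k)

theorem planeLandauState_polarPt {r : ℝ} (hr : 0 < r) (θ : ℝ) (k : ℕ) :
    planeLandauState B χ k (polarPt r θ) = Complex.exp (χ (polarPt r θ) * Complex.I) *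
      (((Real.sqrt (2 * Real.pi))⁻¹ * landauState B k r : ℝ) *
        Complex.exp (k * θ * Complex.I)) := by
  have h1 : (r * Real.cos θ) ^ 2 + (r * Real.sin θ) ^ 2 = r ^ 2 := by
    rw [mul_pow, mul_pow, ← mul_add, Real.cos_sq_add_sin_sq, mul_one]
  have hr0 : (r : ℂ) ≠ 0 := Complex.ofReal_ne_zero.2 hr.ne'
  have h2 : (((r * Real.cos θ : ℝ) : ℂ) + (r * Real.sin θ : ℝ) * Complex.I) / (r : ℝ) =
      Complex.exp (θ * Complex.I) := by
    rw [Complex.exp_mul_I]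
    push_cast
    field_simp
  simp only [planeLandauState, polarPt, h1, Real.sqrt_sq hr.le]
  rw [h2, ← Complex.exp_nat_mul, mul_assoc (k : ℂ)]

theorem memLp_planeLandauState (hB : 0 < B) (hχ : Continuous χ) (k : ℕ) :
    MemLp (planeLandauState B χ k) 2 (volume : Measure (ℝ × ℝ)) := by
  have hm : Measurable (planeLandauState B χ k) := by
    have := hχ.measurable
    have := (continuous_landauState B k).measurable
    unfold planeLandauState
    fun_prop
  refine ⟨hm.aestronglyMeasurable, ?_⟩
  rw [eLpNorm_lt_top_iff_lintegral_rpow_enorm_lt_top two_ne_zero ENNReal.ofNat_ne_top]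
  rw [← lintegral_polar]
  have h1 : ∀ p ∈ Ioi (0 : ℝ) ×ˢ Ioo (-Real.pi) Real.pi,
      ENNReal.ofReal p.1 * ‖planeLandauState B χ k (polarPt p.1 p.2)‖ₑ ^ (2 : ℝ≥0∞).toReal =
      ENNReal.ofReal ((2 * Real.pi)⁻¹ * (landauState B k p.1 ^ 2 * p.1)) * 1 := by
    rintro ⟨r, θ⟩ ⟨hr, -⟩
    have hr' : (0 : ℝ) < r := hr
    have e1 : ‖Complex.exp (χ (polarPt r θ) * Complex.I)‖ = 1 := Complex.norm_exp_ofReal_mul_I _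
    have e2 : ‖Complex.exp (k * θ * Complex.I)‖ = 1 := by
      have : (k * θ * Complex.I : ℂ) = ((k * θ : ℝ) : ℂ) * Complex.I := by push_cast; ring
      rw [this, Complex.norm_exp_ofReal_mul_I]
    simp only
    rw [planeLandauState_polarPt hr', ENNReal.toReal_ofNat, ENNReal.rpow_two, ← ofReal_norm,
      ← ENNReal.ofReal_pow (norm_nonneg _), ← ENNReal.ofReal_mul hr'.le, norm_mul, norm_mul,
      e1, e2, one_mul, mul_one, mul_one, Complex.norm_real, Real.norm_eq_abs, sq_abs, mul_pow,
      inv_pow, Real.sq_sqrt (by positivity)]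
    congr 1
    ring
  rw [setLIntegral_congr_fun measurableSet_polarTarget h1, Measure.volume_eq_prod,
    ← Measure.prod_restrict, lintegral_prod_mul
      (f := fun r => ENNReal.ofReal ((2 * Real.pi)⁻¹ * (landauState B k r ^ 2 * r)))
      (g := fun _ => 1) (by
      have := (continuous_landauState B k).measurable
      fun_prop) aemeasurable_const]
  refine ENNReal.mul_lt_top ?_ ?_
  · exact ((integrableOn_landauState_sq hB k).const_mul _).lintegral_lt_top
  · simp

/-- The `L²` inner product with a Landau state in terms of the radial parts. -/
theorem integral_conj_planeLandauState_mul (hφ : ContDiff ℝ ∞ φ) (hs : HasCompactSupport φ)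
    (hχ : ContDiff ℝ 1 χ) (k : ℕ) :
    ∫ z, conj (planeLandauState B χ k z) * φ z =
      Real.sqrt (2 * Real.pi) * landauComponent B (toCircularGauge χ φ) k := by
  let v := toCircularGauge χ φ
  have hv : ContDiff ℝ 1 v := contDiff_toCircularGauge hχ hφ
  have hvs : HasCompactSupport v := hs.mul_left
  obtain ⟨R, hR, hvR⟩ := exists_radius hvs
  have hvc := hv.continuous
  have hpi := Real.pi_pos
  let c : ℝ := (Real.sqrt (2 * Real.pi))⁻¹
  let G : ℝ × ℝ → ℂ := fun p => (c * (landauState B k p.1 * p.1) : ℝ) *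
    (Complex.exp (-(k * p.2 * Complex.I)) * v (polarPt p.1 p.2))
  have hGc : Continuous G := by
    have := continuous_landauState B k
    fun_prop
  have h1 : ∀ p ∈ Ioi (0 : ℝ) ×ˢ Ioo (-Real.pi) Real.pi,
      p.1 • (conj (planeLandauState B χ k (polarPt p.1 p.2)) * φ (polarPt p.1 p.2)) = G p := by
    rintro ⟨r, θ⟩ ⟨hr, -⟩
    have hr' : (0 : ℝ) < r := hr
    simp only [G, v, c, toCircularGauge]
    rw [planeLandauState_polarPt hr', map_mul, map_mul, Complex.conj_ofReal, ← Complex.exp_conj,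
      ← Complex.exp_conj, Complex.real_smul]
    simp only [map_mul, Complex.conj_ofReal, Complex.conj_I, Complex.conj_natCast, mul_neg]
    push_cast
    ring
  rw [← integral_polar, setIntegral_congr_fun measurableSet_polarTarget h1]
  have hGi : IntegrableOn G (Ioi (0 : ℝ) ×ˢ Ioo (-Real.pi) Real.pi) := by
    have h2 : IntegrableOn G (Icc 0 R ×ˢ Icc (-Real.pi) Real.pi) :=
      hGc.continuousOn.integrableOn_compact (isCompact_Icc.prod isCompact_Icc)
    refine h2.of_forall_sdiff_eq_zero measurableSet_polarTarget fun p hp => ?_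
    have : R ≤ p.1 := by
      by_contra! hlt
      exact hp.2 ⟨⟨le_of_lt hp.1.1, hlt.le⟩, ⟨hp.1.2.1.le, hp.1.2.2.le⟩⟩
    simp only [G, (hvR p.1 p.2 this).1, mul_zero]
  rw [Measure.volume_eq_prod, setIntegral_prod _ (by rwa [← Measure.volume_eq_prod]),
    landauComponent, ← integral_const_mul]
  refine setIntegral_congr_fun measurableSet_Ioi fun r hr => ?_
  simp only [G]
  rw [integral_const_mul, ← integral_Ioc_eq_integral_Ioo,
    ← intervalIntegral.integral_of_le neg_pi_lt_pi.le]
  simp only [radialPart, angCoeff, Int.cast_natCast, Complex.real_smul]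
  have hc : (c : ℂ) = Real.sqrt (2 * Real.pi) * ((2 * Real.pi : ℝ) : ℂ)⁻¹ := by
    have h0 : 0 < Real.sqrt (2 * Real.pi) := Real.sqrt_pos.2 (by positivity)
    have h2 : Real.sqrt (2 * Real.pi) * Real.sqrt (2 * Real.pi) = 2 * Real.pi :=
      Real.mul_self_sqrt (by positivity)
    have h3 : c = Real.sqrt (2 * Real.pi) * (2 * Real.pi)⁻¹ := by
      rw [eq_mul_inv_iff_mul_eq₀ (by positivity)]
      have h4 := inv_mul_cancel_left₀ h0.ne' (Real.sqrt (2 * Real.pi))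
      rwa [h2] at h4
    rw [h3]
    push_cast
    rfl
  rw [Complex.ofReal_mul, hc]
  push_cast
  ring

/-- The lower bound on the energy of a test function, in the Landau gauge, up to the Landau states
with `k ∈ S`. -/
theorem energy_bound (hg : IsFieldProfile B g) (hflux : ∫ r in Ioi (0 : ℝ), g r * r ≤ 1)
    (hB : 0 < B) (h : IsGauge B g χ) (hφ : ContDiff ℝ ∞ φ) (hs : HasCompactSupport φ)
    {S : Finset ℕ} {t : ℝ} (ht : 0 ≤ t)
    (hS : ∀ k ∉ S, 2 * effectiveExpectation B g k ≤ t) :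
    ENNReal.ofReal B * ∫⁻ z, ‖φ z‖ₑ ^ 2 ≤
      (∫⁻ z, (‖Complex.I * fderiv ℝ φ z (1, 0) + ((landauPotential B g z).1 : ℂ) * φ z‖ₑ ^ 2
        + ‖Complex.I * fderiv ℝ φ z (0, 1) + ((landauPotential B g z).2 : ℂ) * φ z‖ₑ ^ 2))
      + ENNReal.ofReal t * (∫⁻ z, ‖φ z‖ₑ ^ 2)
      + ∑ k ∈ S, ENNReal.ofReal (2 * effectiveExpectation B g k *
          ‖∫ z, conj (planeLandauState B χ k z) * φ z‖ ^ 2) := by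
  have hadm := hg.isAdmissibleFlux hflux
  have hχ := h.contDiff hg hB
  have hv := contDiff_toCircularGauge hχ hφ
  have hvs : HasCompactSupport (toCircularGauge χ φ) := hs.mul_left
  have key := polar_energy_bound hv hvs hadm hB ht hS
  rw [← lintegral_polar_norm hv hvs, ← lintegral_polar_energy hv hvs hadm] at key
  have h1 : ∫⁻ p in Ioi (0 : ℝ) ×ˢ Ioo (-Real.pi) Real.pi,
      ENNReal.ofReal p.1 * ‖toCircularGauge χ φ (polarPt p.1 p.2)‖ₑ ^ 2 = ∫⁻ z, ‖φ z‖ₑ ^ 2 := by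
    rw [← lintegral_polar]
    refine lintegral_congr fun p => ?_
    rw [← ofReal_norm, norm_toCircularGauge, ofReal_norm]
  rw [h1] at key
  refine key.trans (le_of_eq ?_)
  refine congrArg₂ (· + ·) (congrArg₂ (· + ·) ?_ rfl) (Finset.sum_congr rfl fun k _ => ?_)
  · rw [← lintegral_polar]
    exact setLIntegral_congr_fun measurableSet_polarTarget fun p hp => by
      simp only [energy_density_polar h hφ hp.1]
  · rw [integral_conj_planeLandauState_mul hφ hs hχ, norm_mul, mul_pow, Complex.norm_real,
      Real.norm_eq_abs, sq_abs, Real.sq_sqrt (by have := Real.pi_pos; positivity)]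

end Plane

/-! ### Dependence on the profile up to null sets -/

section Congr

variable {B : ℝ} {g h : ℝ → ℝ}

/-- Null sets of radii are not seen on any line in the plane. -/
theorem ae_comp_sqrt_eq (hg : Measurable g) (hh : Measurable h)
    (hgh : ∀ᵐ r ∂(volume.restrict (Ioi (0 : ℝ))), g r = h r) (y : ℝ) :
    ∀ᵐ t : ℝ, g (Real.sqrt (t ^ 2 + y ^ 2)) = h (Real.sqrt (t ^ 2 + y ^ 2)) := by
  let u : ℝ → ℝ≥0∞ := fun r => ‖g r - h r‖ₑ
  have hu : Measurable u := (hg.sub hh).enorm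
  have h0 : ∫⁻ r in Ioi (0 : ℝ), ENNReal.ofReal r * u r = 0 := by
    rw [lintegral_eq_zero_iff (by fun_prop)]
    filter_upwards [hgh] with r hr
    simp [u, hr]
  have h1 : ∫⁻ t in Ioi (0 : ℝ), ENNReal.ofReal t * u (Real.sqrt (t ^ 2 + y ^ 2)) = 0 :=
    le_antisymm ((lintegral_Ioi_comp_sqrt_le u y).trans h0.le) zero_le
  have h2 : ∫⁻ t in Ioi (0 : ℝ), u (Real.sqrt (t ^ 2 + y ^ 2)) = 0 := by
    rw [lintegral_eq_zero_iff (by fun_prop)] at h1 ⊢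
    filter_upwards [h1, ae_restrict_mem measurableSet_Ioi] with t ht ht0
    have : ENNReal.ofReal t ≠ 0 := (ENNReal.ofReal_pos.2 ht0).ne'
    exact (mul_eq_zero.1 ht).resolve_left this
  have h3 : ∫⁻ t, u (Real.sqrt (t ^ 2 + y ^ 2)) = 0 := by
    rw [lintegral_eq_two_mul_of_even (by intro t; rw [neg_sq]), h2, mul_zero]
  rw [lintegral_eq_zero_iff (by fun_prop)] at h3
  filter_upwards [h3] with t ht
  exact sub_eq_zero.1 (enorm_eq_zero.1 ht)

theorem perturbedHamiltonian_congr (hg : Measurable g) (hh : Measurable h)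
    (hgh : ∀ᵐ r ∂(volume.restrict (Ioi (0 : ℝ))), g r = h r) :
    perturbedHamiltonian B g = perturbedHamiltonian B h := by
  have : gaugeFun g = gaugeFun h := by
    ext z
    exact congrArg Neg.neg (integral_congr_ae (ae_restrict_of_ae (ae_comp_sqrt_eq hg hh hgh z.2)))
  have h2 : landauPotential B g = landauPotential B h := by
    ext z
    · rfl
    · simp only [landauPotential, this]
  rw [perturbedHamiltonian, perturbedHamiltonian, h2]

theorem effectiveExpectation_congr
    (hgh : ∀ᵐ r ∂(volume.restrict (Ioi (0 : ℝ))), g r = h r) :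
    effectiveExpectation B g = effectiveExpectation B h := by
  have h1 : ∀ r, 0 < r → circularPotential B g r = circularPotential B h r := by
    intro r hr
    have : ∫ s in (0 : ℝ)..r, g s * s = ∫ s in (0 : ℝ)..r, h s * s := by
      rw [intervalIntegral.integral_of_le hr.le, intervalIntegral.integral_of_le hr.le]
      refine integral_congr_ae ?_
      filter_upwards [ae_restrict_of_ae_restrict_of_subset Ioc_subset_Ioi_self hgh] with s hs
      rw [hs]
    rw [circularPotential, circularPotential, this]
  ext k
  refine setIntegral_congr_fun measurableSet_Ioi fun r hr => ?_
  simp only [effectivePotential, h1 r hr]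

/-- A profile with the bounds of `IsFieldProfile` almost everywhere agrees almost everywhere with
a profile with these bounds everywhere. -/
theorem exists_isFieldProfile (hB : 0 < B) (hg_meas : Measurable g)
    (hg_nonneg : ∀ r, 0 < r → 0 ≤ g r)
    (hg_le : ∀ᵐ r ∂(volume.restrict (Ioi (0 : ℝ))), g r ≤ B)
    (hg_int : IntegrableOn (fun r => g r * r) (Ioi 0)) :
    ∃ h, IsFieldProfile B h ∧ ∀ᵐ r ∂(volume.restrict (Ioi (0 : ℝ))), g r = h r := by
  have hae : ∀ᵐ r ∂(volume.restrict (Ioi (0 : ℝ))), g r = max 0 (min (g r) B) := by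
    filter_upwards [hg_le, ae_restrict_mem measurableSet_Ioi] with r hr hr0
    rw [min_eq_left hr, max_eq_right (hg_nonneg r hr0)]
  refine ⟨fun r => max 0 (min (g r) B), ⟨by fun_prop, fun r => le_max_left _ _,
    fun r => max_le hB.le (min_le_right _ _), hg_int.congr ?_⟩, hae⟩
  filter_upwards [hae] with r hr
  rw [← hr]

end Congr

/-! ### The magnetic Laplacian as the operator of a closed form -/

section MagneticForm

variable {A : ℝ × ℝ → ℝ × ℝ}

/-- Triples of `L²` functions, with the Hilbert space norm instead of the maximum norm. -/
abbrev TripleL2 : Type := WithLp 2 (PlaneL2 × WithLp 2 (PlaneL2 × PlaneL2))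

/-- Forgetting the Hilbert space structure of a triple. -/
def tripleMap : TripleL2 →L[ℂ] PlaneL2 × PlaneL2 × PlaneL2 :=
  (WithLp.fstL 2 ℂ PlaneL2 (WithLp 2 (PlaneL2 × PlaneL2))).prod
    ((WithLp.prodContinuousLinearEquiv 2 ℂ PlaneL2 PlaneL2).toContinuousLinearMap ∘L
      WithLp.sndL 2 ℂ PlaneL2 (WithLp 2 (PlaneL2 × PlaneL2)))

/-- The domain of the closed magnetic form, realized as the closed graph of the magnetic gradient,
so that the norm is the form norm. -/
def magneticFormDomain (A : ℝ × ℝ → ℝ × ℝ) : Submodule ℂ TripleL2 :=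
  (magneticGradientGraph A).topologicalClosure.comap tripleMap.toLinearMap

/-- The embedding of the form domain into `L²`. -/
def magneticFormEmbedding (A : ℝ × ℝ → ℝ × ℝ) : magneticFormDomain A →L[ℂ] PlaneL2 :=
  WithLp.fstL 2 ℂ _ _ ∘L (magneticFormDomain A).subtypeL

/-- The magnetic gradient on the form domain. -/
def magneticFormGradient (A : ℝ × ℝ → ℝ × ℝ) :
    magneticFormDomain A →L[ℂ] WithLp 2 (PlaneL2 × PlaneL2) :=
  WithLp.sndL 2 ℂ _ _ ∘L (magneticFormDomain A).subtypeL

instance : CompleteSpace (magneticFormDomain A) := by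
  have : IsClosed (magneticFormDomain A : Set TripleL2) :=
    (Submodule.isClosed_topologicalClosure _).preimage tripleMap.continuous
  exact this.completeSpace_coe

/-- The point of the form domain given by an element of the closed graph. -/
def magneticFormPoint (t : PlaneL2 × PlaneL2 × PlaneL2)
    (ht : t ∈ (magneticGradientGraph A).topologicalClosure) : magneticFormDomain A :=
  ⟨WithLp.toLp 2 (t.1, WithLp.toLp 2 t.2), ht⟩

/-- Test functions are in the form domain when the potential is continuous. -/
theorem exists_mem_magneticGradientGraph (hA : Continuous A) {φ : ℝ × ℝ → ℂ}
    (hφ : ContDiff ℝ ∞ φ) (hs : HasCompactSupport φ) :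
    ∃ t ∈ magneticGradientGraph A, t.1 =ᵐ[volume] φ := by
  have hd : ∀ w, Continuous fun z => fderiv ℝ φ z w := fun w =>
    (hφ.continuous_fderiv (by simp)).clm_apply continuous_const
  have hds : ∀ w, HasCompactSupport fun z => fderiv ℝ φ z w := fun w =>
    hs.fderiv_apply (𝕜 := ℝ) w
  have hc := hφ.continuous
  have h1 : MemLp (fun z => Complex.I * fderiv ℝ φ z (1, 0) + ((A z).1 : ℂ) * φ z) 2
      (volume : Measure (ℝ × ℝ)) := by
    have := hd (1, 0)
    refine Continuous.memLp_of_hasCompactSupport (by fun_prop) ?_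
    exact (hds (1, 0)).mul_left.add hs.mul_left
  have h2 : MemLp (fun z => Complex.I * fderiv ℝ φ z (0, 1) + ((A z).2 : ℂ) * φ z) 2
      (volume : Measure (ℝ × ℝ)) := by
    have := hd (0, 1)
    refine Continuous.memLp_of_hasCompactSupport (by fun_prop) ?_
    exact (hds (0, 1)).mul_left.add hs.mul_left
  have h0 : MemLp φ 2 (volume : Measure (ℝ × ℝ)) := hc.memLp_of_hasCompactSupport hs
  exact ⟨(h0.toLp _, h1.toLp _, h2.toLp _), ⟨φ, hφ, hs, h0.coeFn_toLp, h1.coeFn_toLp,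
    h2.coeFn_toLp⟩, h0.coeFn_toLp⟩

/-- Test functions are dense in `L²`, in the form needed here. -/
theorem eq_zero_of_inner_test_eq_zero (hA : Continuous A) {w : PlaneL2}
    (hw : ∀ t ∈ magneticGradientGraph A, inner ℂ t.1 w = 0) : w = 0 := by
  have hloc : LocallyIntegrable w (volume : Measure (ℝ × ℝ)) :=
    (Lp.memLp w).locallyIntegrable (by norm_num)
  have := ae_eq_zero_of_integral_contDiff_smul_eq_zero hloc fun η hη hηs => by
    obtain ⟨t, ht, hte⟩ := exists_mem_magneticGradientGraph hA
      (φ := fun z => (η z : ℂ)) (Complex.ofRealCLM.contDiff.comp hη)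
      (hηs.comp_left (g := fun x : ℝ => (x : ℂ)) (by simp))
    rw [← hw t ht, L2.inner_def]
    refine integral_congr_ae ?_
    filter_upwards [hte] with z hz
    rw [hz, RCLike.inner_apply, Complex.conj_ofReal, Complex.real_smul, mul_comm]
  exact (Lp.eq_zero_iff_ae_eq_zero).2 this

/-- A condition tested on test functions extends to the closed graph. -/
theorem forall_closure_of_forall_graph {p : PlaneL2 × PlaneL2} {w : PlaneL2}
    (h : ∀ t ∈ magneticGradientGraph A,
      inner ℂ t.2.1 p.1 + inner ℂ t.2.2 p.2 = inner ℂ t.1 w) :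
    ∀ t ∈ (magneticGradientGraph A).topologicalClosure,
      inner ℂ t.2.1 p.1 + inner ℂ t.2.2 p.2 = inner ℂ t.1 w := by
  have hcl : IsClosed {t : PlaneL2 × PlaneL2 × PlaneL2 |
      inner ℂ t.2.1 p.1 + inner ℂ t.2.2 p.2 = inner ℂ t.1 w} :=
    isClosed_eq (by fun_prop) (by fun_prop)
  intro t ht
  exact closure_minimal (fun t ht => h t ht) hcl ht

theorem magneticLaplacian_graph (hA : Continuous A) :
    (magneticLaplacian A).graph = magneticLaplacianGraph A := by
  refine Submodule.toLinearPMap_graph_eq _ ?_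
  rintro ⟨u, w⟩ ⟨p, hp, h⟩ (rfl : u = 0)
  have h1 := forall_closure_of_forall_graph h _ hp
  simp only [inner_zero_left] at h1
  -- the form is closable: testing against `(0, p)` itself gives `p = 0`
  have h2 : ‖p.1‖ ^ 2 + ‖p.2‖ ^ 2 = 0 := by
    rw [inner_self_eq_norm_sq_to_K, inner_self_eq_norm_sq_to_K] at h1
    refine Complex.ofReal_injective ?_
    push_cast
    exact h1
  have hp1 : p.1 = 0 := by
    have : ‖p.1‖ ^ 2 = 0 := by nlinarith [sq_nonneg ‖p.1‖, sq_nonneg ‖p.2‖]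
    simpa using this
  have hp2 : p.2 = 0 := by
    have : ‖p.2‖ ^ 2 = 0 := by nlinarith [sq_nonneg ‖p.1‖, sq_nonneg ‖p.2‖]
    simpa using this
  refine eq_zero_of_inner_test_eq_zero hA fun t ht => ?_
  rw [← h t ht, hp1, hp2, inner_zero_right, inner_zero_right, add_zero]

theorem isFormOperator_magneticLaplacian (hA : Continuous A) :
    IsFormOperator (F := WithLp 2 (PlaneL2 × PlaneL2)) (X := magneticFormDomain A)
      (magneticLaplacian A) (magneticFormEmbedding A) (magneticFormGradient A) where
  norm_sq x := WithLp.prod_norm_sq_eq_of_L2 (x : TripleL2)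
  mem_graph_iff u w := by
    rw [magneticLaplacian_graph hA]
    constructor
    · rintro ⟨p, hp, h⟩
      refine ⟨magneticFormPoint _ hp, rfl, fun y => ?_⟩
      exact forall_closure_of_forall_graph h _ y.2
    · rintro ⟨x, rfl, h⟩
      exact ⟨_, x.2, fun t ht => h (magneticFormPoint t (Submodule.le_topologicalClosure _ ht))⟩

end MagneticForm

/-! ### The form bound and the trace -/

section Conclusion

variable {B : ℝ} {g : ℝ → ℝ} {A : ℝ × ℝ → ℝ × ℝ}

theorem IsFieldProfile.continuous_landauPotential (hg : IsFieldProfile B g) (hB : 0 < B) :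
    Continuous (landauPotential B g) := by
  have := hg.continuous_gaugeFun hB
  unfold landauPotential
  fun_prop

theorem ofReal_norm_sq_eq_lintegral {u : PlaneL2} {φ : ℝ × ℝ → ℂ} (h : u =ᵐ[volume] φ) :
    ENNReal.ofReal (‖u‖ ^ 2) = ∫⁻ z, ‖φ z‖ₑ ^ 2 := by
  rw [ENNReal.ofReal_pow (norm_nonneg _), ofReal_norm, Lp.enorm_def, eLpNorm_congr_ae h,
    eLpNorm_eq_lintegral_rpow_enorm_toReal two_ne_zero ENNReal.ofNat_ne_top, ← ENNReal.rpow_two,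
    ← ENNReal.rpow_mul]
  simp

/-- An inequality for the closed form may be checked on test functions. -/
theorem formBound_of_forall_graph {Ψ : ℕ → PlaneL2} {b : ℕ → ℝ} {S : Finset ℕ} {e : ℝ}
    (h : ∀ t ∈ magneticGradientGraph A, e * ‖t.1‖ ^ 2 ≤ ‖t.2.1‖ ^ 2 + ‖t.2.2‖ ^ 2
      + ∑ k ∈ S, b k * ‖inner ℂ (Ψ k) t.1‖ ^ 2) :
    FormBound (F := WithLp 2 (PlaneL2 × PlaneL2)) (X := magneticFormDomain A)
      (magneticFormEmbedding A) (magneticFormGradient A) Ψ b S e := by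
  have hcl : IsClosed {t : PlaneL2 × PlaneL2 × PlaneL2 |
      e * ‖t.1‖ ^ 2 ≤ ‖t.2.1‖ ^ 2 + ‖t.2.2‖ ^ 2 + ∑ k ∈ S, b k * ‖inner ℂ (Ψ k) t.1‖ ^ 2} :=
    isClosed_le (by fun_prop) (by fun_prop)
  intro x
  have := closure_minimal (fun t ht => h t ht) hcl x.2
  rwa [WithLp.prod_norm_sq_eq_of_L2]

/-- The magnetic form is bounded below by `B - t` up to the Landau states with
`k ∈ S`, weighted by `2 Λ_k`, if `2 Λ_k ≤ t` for `k ∉ S`. -/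
theorem IsGauge.formBound {χ : ℝ × ℝ → ℝ} (h : IsGauge B g χ) (hg : IsFieldProfile B g)
    (hflux : ∫ r in Ioi (0 : ℝ), g r * r ≤ 1) (hB : 0 < B) {Ψ : ℕ → PlaneL2}
    (hΨ : ∀ k, Ψ k =ᵐ[volume] planeLandauState B χ k) {S : Finset ℕ} {t : ℝ} (ht : 0 ≤ t)
    (hS : ∀ k ∉ S, 2 * effectiveExpectation B g k ≤ t) :
    FormBound (F := WithLp 2 (PlaneL2 × PlaneL2)) (X := magneticFormDomain (landauPotential B g))
      (magneticFormEmbedding _) (magneticFormGradient _) Ψ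
      (fun k => 2 * effectiveExpectation B g k) S (B - t) := by
  refine formBound_of_forall_graph ?_
  rintro ⟨u, p, q⟩ ⟨φ, hφ, hs, hu, hp, hq⟩
  have key := energy_bound hg hflux hB h hφ hs ht hS
  have hΛ : ∀ k, 0 ≤ 2 * effectiveExpectation B g k := fun k =>
    mul_nonneg zero_le_two (effectiveExpectation_nonneg B g k)
  have hinner : ∀ k, ∫ z, conj (planeLandauState B χ k z) * φ z = inner ℂ (Ψ k) u := by
    intro k
    rw [L2.inner_def]
    refine integral_congr_ae ?_
    filter_upwards [hΨ k, hu] with z h1 h2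
    rw [h1, h2, RCLike.inner_apply, mul_comm]
  have hpm : AEMeasurable (fun z => ‖Complex.I * fderiv ℝ φ z (1, 0)
      + ((landauPotential B g z).1 : ℂ) * φ z‖ₑ ^ 2) volume :=
    ((Lp.aestronglyMeasurable p).congr hp).enorm.pow_const 2
  rw [lintegral_add_left' hpm, ← ofReal_norm_sq_eq_lintegral hu, ← ofReal_norm_sq_eq_lintegral hp,
    ← ofReal_norm_sq_eq_lintegral hq] at key
  simp only [hinner] at key
  rw [← ENNReal.ofReal_sum_of_nonneg fun k _ => mul_nonneg (hΛ k) (by positivity),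
    ← ENNReal.ofReal_mul hB.le, ← ENNReal.ofReal_mul ht,
    ← ENNReal.ofReal_add (by positivity) (by positivity),
    ← ENNReal.ofReal_add (by positivity) (by positivity),
    ← ENNReal.ofReal_add (by positivity)
      (Finset.sum_nonneg fun k _ => mul_nonneg (hΛ k) (by positivity))] at key
  have := (ENNReal.ofReal_le_ofReal_iff (add_nonneg (by positivity)
      (Finset.sum_nonneg fun k _ => mul_nonneg (hΛ k) (by positivity)))).1 key
  simp only
  linarith

theorem IsFieldProfile.traceNegPartPow_le (hg : IsFieldProfile B g)
    (hflux : ∫ r in Ioi (0 : ℝ), g r * r ≤ 1) (hB : 0 < B) {γ : ℝ} (hγ : 0 ≤ γ) :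
    traceNegPartPow (perturbedHamiltonian B g) B γ ≤
      2 ^ γ * ∑' k : ℕ, posPartPow (effectiveExpectation B g k) γ := by
  obtain ⟨χ, hχ⟩ := hg.exists_isGauge hB
  have hL := memLp_planeLandauState hB (hχ.contDiff hg hB).continuous
  have hA := hg.continuous_landauPotential hB
  rw [← ENNReal.tsum_mul_left]
  simp only [← posPartPow_two_mul hγ]
  exact IsFormOperator.traceNegPartPow_le (F := WithLp 2 (PlaneL2 × PlaneL2))
    (X := magneticFormDomain (landauPotential B g))
    (b := fun k => 2 * effectiveExpectation B g k) (Ψ := fun k => (hL k).toLp _)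
    (isFormOperator_magneticLaplacian hA) B
    (fun k => mul_nonneg zero_le_two (effectiveExpectation_nonneg B g k))
    (fun t ht S hS => hχ.formBound hg hflux hB (fun k => (hL k).coeFn_toLp) ht.le hS) hγ

end Conclusion

end

theorem mainTheorem2 (B₀ : ℝ) (hB₀ : 0 < B₀) (g : ℝ → ℝ) (hg_meas : Measurable g)
    (hg_nonneg : ∀ r, 0 < r → 0 ≤ g r)
    (hg_le : ∀ᵐ r ∂(volume.restrict (Ioi (0 : ℝ))), g r ≤ B₀)
    (hg_int : IntegrableOn (fun r => g r * r) (Ioi 0))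
    (hg_flux : ∫ r in Ioi (0 : ℝ), g r * r ≤ 1)
    (γ : ℝ) (hγ : 0 ≤ γ) :
    traceNegPartPow (perturbedHamiltonian B₀ g) B₀ γ ≤
      2 ^ γ * ∑' k : ℕ, posPartPow (effectiveExpectation B₀ g k) γ := by
  obtain ⟨h, hh, hgh⟩ := exists_isFieldProfile hB₀ hg_meas hg_nonneg hg_le hg_int
  have hflux : ∫ r in Ioi (0 : ℝ), h r * r ≤ 1 := by
    refine le_trans (le_of_eq (integral_congr_ae ?_)) hg_flux
    filter_upwards [hgh] with r hr
    rw [hr]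
  rw [perturbedHamiltonian_congr hg_meas hh.measurable hgh, effectiveExpectation_congr hgh]
  exact hh.traceNegPartPow_le hflux hB₀ hγ
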